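/- Let $1\le m\le n$, let $\Omega\subset\mathbb C^n$ be open, let $T$ be a real number, and let $v$ be a nonnegative continuous plurisubharmonic function on $\Omega$ such that $\{v<t\}$ is relatively compact in $\Omega$ for every $t\in(0,T)$. Let $u=v^2/2$, let $\beta=i\partial\bar\partial|z|^2$, and let $\theta$ be a closed positive current of bidegree $(1,1)$ on $\Omega$. Then the products $\theta\wedge(i\partial\bar\partial u)^{m-1}\wedge\beta^{n-m}$ and $\theta\wedge(i\partial\bar\partial v)^{m-1}\wedge\beta^{n-m}$, in the sense of Bedford and Taylor (that is, $\theta\wedge(i\partial\bar\partial w)^{k+1}=i\partial\bar\partial\big(w\,\theta\wedge(i\partial\bar\partial w)^{k}\big)$ for $w=u,v$), are well defined as positive Radon measures on $\Omega$. Put $$\sigma(t)=\int_{\{v<t\}}\theta\wedge(i\partial\bar\partial u)^{m-1}\wedge\beta^{n-m},\qquad 0<t<T.$$ Then $\sigma(t)$ is finite and $$\frac{\sigma(t)}{t^{m-1}}=\int_{\{v<t\}}\theta\wedge(i\partial\bar\partial v)^{m-1}\wedge\beta^{n-m}<\infty\qquad\text{for every } t\in(0,T);$$ in particular $\sigma(t)/t^{m-1}$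 is (weakly) increasing in $t$ on $(0,T)$. -/

import Mathlib

open MeasureTheory Set Filter Topology TopologicalSpace
open scoped Distributions LineDeriv ComplexOrder ContDiff

noncomputable section

namespace Pluri

/-- Complex `n`-space with its Euclidean norm. -/
abbrev Cn (n : ℕ) : Type := EuclideanSpace ℂ (Fin n)

/-! ### Constant coefficient differential forms -/

/-- The algebra of differential forms with constant complex coefficients on `ℂⁿ`: the exterior
algebra on the `2n` generators `dz₁, …, dzₙ, dz̄₁, …, dz̄ₙ`. Its product is the wedge product. -/
abbrev ConstForm (n : ℕ) : Type := ExteriorAlgebra ℂ (Fin n ⊕ Fin n → ℂ)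

/-- The form `dz_j`. -/
def dz {n : ℕ} (j : Fin n) : ConstForm n :=
  ExteriorAlgebra.ι ℂ (Pi.single (Sum.inl j) (1 : ℂ))

/-- The form `dz̄_j`. -/
def dzbar {n : ℕ} (j : Fin n) : ConstForm n :=
  ExteriorAlgebra.ι ℂ (Pi.single (Sum.inr j) (1 : ℂ))

/-- The standard Kähler form `β = i ∂∂̄|z|² = ∑ i dz_j ∧ dz̄_j`. -/
def kahler (n : ℕ) : ConstForm n :=
  ∑ j : Fin n, Complex.I • (dz j * dzbar j)

/-- The Euclidean volume form
`dx₁ ∧ dy₁ ∧ … ∧ dxₙ ∧ dyₙ = (i/2) dz₁ ∧ dz̄₁ ∧ … ∧ (i/2) dzₙ ∧ dz̄ₙ`. -/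
def volForm (n : ℕ) : ConstForm n :=
  (List.ofFn fun j : Fin n => (Complex.I / 2) • (dz j * dzbar j)).prod

/-! ### Currents, as differential forms whose coefficients are distributions -/

/-- Differential forms `T = ∑ T_A dx_A` on `Ω` whose coefficients `T_A` are linear functionals on
the complex valued test functions of `Ω`; the value `T f` is `∑ ⟨T_A, f⟩ dx_A`. A smooth form `α`
is the functional `f ↦ ∫ f α` (integration of the coefficients against Lebesgue measure). -/
abbrev FormFunctional {n : ℕ} (Ω : Opens (Cn n)) : Type :=
  𝓓(Ω, ℂ) →ₗ[ℂ] ConstForm n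

variable {n : ℕ} {Ω : Opens (Cn n)}

/-- `T` is a current: its coefficients are distributions, i.e. they are continuous on the space
of test functions. -/
def IsCurrent (T : FormFunctional Ω) : Prop :=
  ∀ l : Module.Dual ℂ (ConstForm n), Continuous fun f : 𝓓(Ω, ℂ) => l (T f)

/-- `∂/∂z_j = (∂/∂x_j - i ∂/∂y_j)/2` on test functions. -/
def dPartial (j : Fin n) (f : 𝓓(Ω, ℂ)) : 𝓓(Ω, ℂ) :=
  (1 / 2 : ℂ) • (∂_{(EuclideanSpace.single j (1 : ℂ) : Cn n)} f
    - Complex.I • ∂_{(EuclideanSpace.single j Complex.I : Cn n)} f)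

/-- `∂/∂z̄_j = (∂/∂x_j + i ∂/∂y_j)/2` on test functions. -/
def dbarPartial (j : Fin n) (f : 𝓓(Ω, ℂ)) : 𝓓(Ω, ℂ) :=
  (1 / 2 : ℂ) • (∂_{(EuclideanSpace.single j (1 : ℂ) : Cn n)} f
    + Complex.I • ∂_{(EuclideanSpace.single j Complex.I : Cn n)} f)

lemma dPartial_add (j : Fin n) (f g : 𝓓(Ω, ℂ)) :
    dPartial j (f + g) = dPartial j f + dPartial j g := by
  simp only [dPartial, LineDeriv.lineDerivOp_add, smul_add, smul_sub]
  abel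

lemma dPartial_smul (j : Fin n) (c : ℂ) (f : 𝓓(Ω, ℂ)) :
    dPartial j (c • f) = c • dPartial j f := by
  simp only [dPartial, LineDeriv.lineDerivOp_smul, smul_sub, smul_comm c]

lemma dbarPartial_add (j : Fin n) (f g : 𝓓(Ω, ℂ)) :
    dbarPartial j (f + g) = dbarPartial j f + dbarPartial j g := by
  simp only [dbarPartial, LineDeriv.lineDerivOp_add, smul_add]
  abel

lemma dbarPartial_smul (j : Fin n) (c : ℂ) (f : 𝓓(Ω, ℂ)) :
    dbarPartial j (c • f) = c • dbarPartial j f := by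
  simp only [dbarPartial, LineDeriv.lineDerivOp_smul, smul_add, smul_comm c]

/-- `T` is closed: `dT = ∑ dz_j ∧ ∂T/∂z_j + ∑ dz̄_j ∧ ∂T/∂z̄_j` vanishes, the derivatives of
the coefficients being taken in the sense of distributions, `⟨∂T/∂z_j, f⟩ = -⟨T, ∂f/∂z_j⟩`. -/
def IsClosedForm (T : FormFunctional Ω) : Prop :=
  ∀ f : 𝓓(Ω, ℂ), -∑ j : Fin n, (dz j * T (dPartial j f) + dzbar j * T (dbarPartial j f)) = 0

/-- `i∂∂̄T = i ∑ dz_j ∧ dz̄_k ∧ ∂²T/∂z_j∂z̄_k`, with derivatives in the sense of distributions. -/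
def iddbar (T : FormFunctional Ω) : FormFunctional Ω where
  toFun f := ∑ j : Fin n, ∑ k : Fin n,
    Complex.I • (dz j * dzbar k * T (dPartial j (dbarPartial k f)))
  map_add' f g := by
    simp only [dbarPartial_add, dPartial_add, map_add, mul_add, smul_add, Finset.sum_add_distrib]
  map_smul' c f := by
    simp only [dbarPartial_smul, dPartial_smul, map_smul, mul_smul_comm, Finset.smul_sum,
      RingHom.id_apply, smul_comm c]

/-- A positive current of bidegree `(1,1)`: `θ = i ∑ θ_{jk} dz_j ∧ dz̄_k`, where the matrix
`(⟨θ_{jk}, f⟩)` is positive semidefinite (in particular Hermitian) for each test function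
`f ≥ 0`. -/
def IsPositiveOneOne (θ : FormFunctional Ω) : Prop :=
  ∀ f : 𝓓(Ω, ℂ), (∀ z, 0 ≤ f z) → ∃ h : Matrix (Fin n) (Fin n) ℂ, h.PosSemidef ∧
    θ f = ∑ j : Fin n, ∑ k : Fin n, (Complex.I * h j k) • (dz j * dzbar k)

/-- Closed positive currents of bidegree `(1,1)` on `Ω`. -/
structure IsClosedPositiveCurrent (θ : FormFunctional Ω) : Prop where
  isCurrent : IsCurrent θ
  isPositive : IsPositiveOneOne θ
  isClosed : IsClosedForm θ

/-! ### Bedford–Taylor products -/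

/-- `S = uT`, the product of the current `T`, of order zero, and the function `u`, continuous
on `Ω`. A current of order zero has a unique extension to the continuous functions with compact
support in `Ω` that is continuous for uniform convergence with supports in a fixed compact set, and
`⟨uT, f⟩` is the value of that extension at `uf`: the limit of `⟨T, g_i⟩` for each sequence of test
functions `g_i`, supported in a fixed compact subset of `Ω`, that tends uniformly to `uf`. The
limit is taken coefficientwise. -/
def IsProductWith (u : Cn n → ℝ) (T S : FormFunctional Ω) : Prop :=
  ∀ (f : 𝓓(Ω, ℂ)) (g : ℕ → 𝓓(Ω, ℂ)) (K : Set (Cn n)), IsCompact K → K ⊆ Ω →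
    (∀ i, tsupport (g i) ⊆ K) →
    TendstoUniformly (fun i z => g i z) (fun z => (u z : ℂ) * f z) atTop →
    ∀ l : Module.Dual ℂ (ConstForm n), Tendsto (fun i => l (T (g i))) atTop (𝓝 (l (S f)))

/-- `S = θ ∧ (i∂∂̄u)^k` in the sense of Bedford and Taylor: `θ ∧ (i∂∂̄u)^0 = θ` and
`θ ∧ (i∂∂̄u)^(k+1) = i∂∂̄ (u · (θ ∧ (i∂∂̄u)^k))`. -/
def IsBTProduct (u : Cn n → ℝ) (θ : FormFunctional Ω) : ℕ → FormFunctional Ω → Prop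
  | 0, S => S = θ
  | k + 1, S => ∃ R P : FormFunctional Ω,
      IsBTProduct u θ k R ∧ IsProductWith u R P ∧ S = iddbar P

/-- `μ` is the form `θ ∧ (i∂∂̄u)^k ∧ β^q` of top degree, as a Radon measure on `Ω` (extended
by zero to `ℂⁿ`): the product exists and equals `μ` times the Euclidean volume form. The condition
`isMeasure` is meant for `1 + k + q = n`. -/
structure IsWedgeMeasure (θ : FormFunctional Ω) (u : Cn n → ℝ) (k q : ℕ)
    (μ : Measure (Cn n)) : Prop where
  isMeasure : ∃ S : FormFunctional Ω, IsBTProduct u θ k S ∧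
    ∀ f : 𝓓(Ω, ℂ), S f * kahler n ^ q = (∫ z, f z ∂μ) • volForm n
  finite_on_compacts : ∀ K : Set (Cn n), IsCompact K → K ⊆ Ω → μ K < ⊤
  compl_null : μ (Ω : Set (Cn n))ᶜ = 0

/-! ### Plurisubharmonic functions -/

/-- Continuous (real valued) plurisubharmonic functions on `Ω`: the sub-mean value inequality
holds on each closed complex disc in `Ω`. -/
structure IsContinuousPSH (Ω : Opens (Cn n)) (v : Cn n → ℝ) : Prop where
  continuousOn : ContinuousOn v Ω
  submean : ∀ z w : Cn n, (∀ c : ℂ, ‖c‖ ≤ 1 → z + c • w ∈ Ω) →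
    v z ≤ Real.circleAverage (fun c : ℂ => v (z + c • w)) 0 1

/-- The sublevel set `{v < t}` in `Ω`. -/
def sublevel (Ω : Opens (Cn n)) (v : Cn n → ℝ) (t : ℝ) : Set (Cn n) :=
  {z | z ∈ Ω ∧ v z < t}

end Pluri

end

/-!
# Bedford–Taylor products with `v` and with `v² / 2`

Formally, `i∂∂̄(v²/2) = v i∂∂̄v + i ∂v ∧ ∂̄v`, so for a closed positive current `S` and functions of
one variable with `ψ'(s) = s φ'(s)` one has
`φ(v) i∂∂̄(v²/2) ∧ S - ψ(v) i∂∂̄v ∧ S = i∂((v φ(v) - ψ(v)) ∂̄v) ∧ S`,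
and the total mass of the right-hand side is zero by Stokes when `φ` and `ψ` vanish near the
boundary values of `v`. If `φ` is decreasing with `φ'` supported in `[a, b]` and `φ = 0` on
`[b, ∞)`, then `ψ` has the same properties and `a φ ≤ ψ ≤ b φ`. So trading one factor `i∂∂̄(v²/2)`
for `i∂∂̄v` changes the mass weighted by `φ(v)` by a factor between `a` and `b`. Bedford–Taylor
products commute, so the new factor can be absorbed into the current, and an induction trades all
`k = m - 1` factors: the masses of `φ(v) θ ∧ (i∂∂̄(v²/2))^k ∧ β^q` and of
`φ(v) θ ∧ (i∂∂̄v)^k ∧ β^q` differ by a factor between `a^k` and `b^k`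
(`IsPositiveClosed.extend_iterate_bounds`). Letting `φ` tend to the indicator function of
`(-∞, t)`, with `a, b → t`, gives the factor `t^k` for the masses of `{v < t}`
(`IsPositiveClosed.measureReal_sublevel_eq`).

The formal computation is justified by regularization. A continuous plurisubharmonic function is,
locally uniformly, the limit of its convolutions `w_i`, whose complex Hessians are positive
semidefinite (`IsContinuousPSH.exists_smooth_approx`). For a closed positive current `T` the
currents `i∂∂̄w_i ∧ T` are positive (`IsPositiveClosed.isPositiveOn_lev`), and they converge to
`i∂∂̄(vT)`, which is therefore positive (`IsPositiveClosed.bt`). Positive currents are bounded in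
terms of their mass (`uniformlyBoundedOn_of_isPositiveOn`), because pairing with the strongly
positive forms `i α₁ ∧ ᾱ₁ ∧ … ∧ i α_q ∧ ᾱ_q`, `p + q = n`, spans the dual of the `(p, p)`-forms
(`exists_eq_on_bideg`). Hence they extend to continuous functions, and the convergence of
`i∂∂̄w_i ∧ T` may be tested on uniformly convergent sequences of test functions
(`IsSmoothApprox.tendsto_lev_approx`). This yields the commutation of Bedford–Taylor products
(`IsPositiveClosed.bt_comm`) and the exchange of one factor
(`IsPositiveClosed.extend_bt_sq_div_two`) from the corresponding identities for smooth functions.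
Positive currents of top degree are Radon measures by the Riesz representation theorem
(`IsPositiveClosed.exists_represents`).
-/

noncomputable section

namespace Pluri

variable {n : ℕ} {Ω : Opens (Cn n)}

/-! ### The Berezin functional and bidegrees -/

/-- The basis `dz₁, …, dzₙ, dz̄₁, …, dz̄ₙ` of the space of forms of degree one. -/
def formBasis (n : ℕ) : Module.Basis (Fin (n + n)) ℂ (Fin n ⊕ Fin n → ℂ) :=
  (Pi.basisFun ℂ (Fin n ⊕ Fin n)).reindex finSumFinEquiv

/-- The coefficient of `dz₁ ∧ … ∧ dzₙ ∧ dz̄₁ ∧ … ∧ dz̄ₙ`. -/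
def topCoeff (n : ℕ) : ConstForm n →ₗ[ℂ] ℂ :=
  ExteriorAlgebra.liftAlternating (R := ℂ) (M := Fin n ⊕ Fin n → ℂ) (N := ℂ)
    (Pi.single (n + n) (formBasis n).det)

lemma topCoeff_ιMulti (v : Fin (n + n) → Fin n ⊕ Fin n → ℂ) :
    topCoeff n (ExteriorAlgebra.ιMulti ℂ (n + n) v) = (formBasis n).det v := by
  simp [topCoeff, ExteriorAlgebra.liftAlternating_apply_ιMulti]

lemma topCoeff_ιMulti_of_ne {k : ℕ} (hk : k ≠ n + n) (v : Fin k → Fin n ⊕ Fin n → ℂ) :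
    topCoeff n (ExteriorAlgebra.ιMulti ℂ k v) = 0 := by
  simp [topCoeff, ExteriorAlgebra.liftAlternating_apply_ιMulti, Pi.single_eq_of_ne hk]

lemma topCoeff_map (A : (Fin n ⊕ Fin n → ℂ) →ₗ[ℂ] (Fin n ⊕ Fin n → ℂ)) (x : ConstForm n) :
    topCoeff n (ExteriorAlgebra.map A x) = LinearMap.det A * topCoeff n x := by
  suffices h : topCoeff n ∘ₗ (ExteriorAlgebra.map A).toLinearMap
      = LinearMap.det A • topCoeff n from congrArg (fun f => f x) h
  refine ExteriorAlgebra.lhom_ext fun i => ?_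
  ext v
  simp only [LinearMap.compAlternatingMap_apply, LinearMap.comp_apply, AlgHom.toLinearMap_apply,
    ExteriorAlgebra.map_apply_ιMulti, LinearMap.smul_apply, smul_eq_mul]
  by_cases hi : i = n + n
  · subst hi
    rw [topCoeff_ιMulti, topCoeff_ιMulti, Module.Basis.det_comp]
  · rw [topCoeff_ιMulti_of_ne hi, topCoeff_ιMulti_of_ne hi, mul_zero]

/-- The wedge product pairs the exterior algebra perfectly with itself: up to nonzero factors, the
monomial of a complement `tᶜ` reads off the coefficient of the monomial of `t`. -/
lemma topCoeff_nondegenerate (x : ConstForm n) (hx : ∀ y, topCoeff n (x * y) = 0) : x = 0 := by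
  classical
  set b := (formBasis n).ExteriorAlgebra with hb
  have hunit : ∀ s : Set.powersetCard (Fin (n + n)) (n + n),
      topCoeff n (b s) ≠ 0 := by
    intro s
    rw [hb, ExteriorAlgebra.basis_apply_powersetCard, ExteriorAlgebra.ιMulti_family,
      topCoeff_ιMulti]
    set σ := Set.powersetCard.ofFinEmbEquiv.symm s
    have hσ : Function.Bijective σ := Finite.injective_iff_bijective.1 σ.injective
    have : (formBasis n) ∘ σ = (formBasis n) ∘ (Equiv.ofBijective σ hσ) := rfl
    rw [this, AlternatingMap.map_perm, Module.Basis.det_self]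
    rcases Int.units_eq_one_or (Equiv.Perm.sign (Equiv.ofBijective σ hσ)) with h | h <;> simp [h]
  have key : ∀ s t : Finset (Fin (n + n)), s ≠ t → topCoeff n (b s * b tᶜ) = 0 := by
    intro s t hst
    by_cases hd : Disjoint s tᶜ
    · have hsub : s ⊆ t := by
        rw [Finset.disjoint_left] at hd
        intro i hi
        simpa using hd hi
      rw [hb, ExteriorAlgebra.basis_apply, ExteriorAlgebra.basis_apply,
        ExteriorAlgebra.ιMulti_mul_ιMulti]
      apply topCoeff_ιMulti_of_ne
      have h1 := Finset.card_lt_card (lt_of_le_of_ne hsub hst)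
      have h2 := Finset.card_compl_add_card t
      simp only [Fintype.card_fin] at h2
      omega
    · have := ExteriorAlgebra.basis_mul_of_not_disjoint (formBasis n)
        (⟨s, rfl⟩ : Set.powersetCard (Fin (n + n)) s.card)
        (⟨tᶜ, rfl⟩ : Set.powersetCard (Fin (n + n)) tᶜ.card) hd
      rw [hb]
      erw [this]
      simp
  have key2 : ∀ t : Finset (Fin (n + n)), topCoeff n (b t * b tᶜ) ≠ 0 := by
    intro t
    have hd : Disjoint t tᶜ := disjoint_compl_right
    have h := ExteriorAlgebra.basis_mul_of_disjoint (formBasis n)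
        (⟨t, rfl⟩ : Set.powersetCard (Fin (n + n)) t.card)
        (⟨tᶜ, rfl⟩ : Set.powersetCard (Fin (n + n)) tᶜ.card) hd
    have hu : ((Set.powersetCard.disjUnion (s := (⟨t, rfl⟩ : Set.powersetCard (Fin (n + n)) t.card))
        (t := (⟨tᶜ, rfl⟩ : Set.powersetCard (Fin (n + n)) tᶜ.card)) hd :
          Set.powersetCard (Fin (n + n)) (t.card + tᶜ.card)) : Finset (Fin (n + n)))
          = Finset.univ := by
      simp [Set.powersetCard.disjUnion]
    have h1 : topCoeff n (b Finset.univ) ≠ 0 :=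
      hunit ⟨Finset.univ, by simp [Set.powersetCard]⟩
    rw [hb]
    erw [h]
    rw [hu]
    have h2 : ∀ e : ℤˣ, topCoeff n (e • b Finset.univ) ≠ 0 := by
      intro e
      rcases Int.units_eq_one_or e with h | h <;> rw [h] <;> simpa using h1
    exact h2 _
  refine b.ext_elem fun t => ?_
  have h1 := hx (b tᶜ)
  conv at h1 => lhs; rw [← b.sum_repr x]
  rw [Finset.sum_mul, map_sum, Finset.sum_eq_single t] at h1
  · rw [smul_mul_assoc, map_smul, smul_eq_mul] at h1
    simpa using (mul_eq_zero.1 h1).resolve_right (key2 t)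
  · intro s _ hs
    rw [smul_mul_assoc, map_smul, key s t hs, smul_zero]
  · simp

/-- The form `∑ a_j dz_j`. -/
def alpha (a : Fin n → ℂ) : ConstForm n := ∑ j, a j • dz j

/-- The form `∑ conj a_j dz̄_j`, conjugate to `alpha a`. -/
def alphaBar (a : Fin n → ℂ) : ConstForm n := ∑ j, (starRingEnd ℂ) (a j) • dzbar j

/-- The positive form `i α ∧ ᾱ`, where `α = ∑ a_j dz_j`. -/
def posForm (a : Fin n → ℂ) : ConstForm n := Complex.I • (alpha a * alphaBar a)

/-- The strongly positive form `i α₁ ∧ ᾱ₁ ∧ … ∧ i α_q ∧ ᾱ_q`. -/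
def posProd {q : ℕ} (a : Fin q → Fin n → ℂ) : ConstForm n :=
  (List.ofFn fun l => posForm (a l)).prod

lemma alpha_eq_ι (a : Fin n → ℂ) : alpha a = ExteriorAlgebra.ι ℂ (Sum.elim a fun _ => 0) := by
  have : (Sum.elim a fun _ => 0)
      = ∑ j : Fin n, a j • (Pi.single (Sum.inl j) (1 : ℂ) : Fin n ⊕ Fin n → ℂ) := by
    ext (k | k) <;> simp [Finset.sum_apply, Pi.single_apply]
  rw [this, map_sum]
  simp [alpha, dz]

lemma alphaBar_eq_ι (a : Fin n → ℂ) :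
    alphaBar a = ExteriorAlgebra.ι ℂ (Sum.elim (fun _ => 0) fun j => (starRingEnd ℂ) (a j)) := by
  have : Sum.elim (fun _ => 0) (fun j => (starRingEnd ℂ) (a j))
      = ∑ j : Fin n, (starRingEnd ℂ) (a j) •
        (Pi.single (Sum.inr j) (1 : ℂ) : Fin n ⊕ Fin n → ℂ) := by
    ext (k | k) <;> simp [Finset.sum_apply, Pi.single_apply]
  rw [this, map_sum]
  simp [alphaBar, dzbar]

lemma ι_eq_alpha_add_alphaBar (v : Fin n ⊕ Fin n → ℂ) :
    ExteriorAlgebra.ι ℂ v = alpha (fun j => v (Sum.inl j))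
      + alphaBar (fun j => (starRingEnd ℂ) (v (Sum.inr j))) := by
  rw [alpha_eq_ι, alphaBar_eq_ι, ← map_add]
  congr 1
  ext (k | k) <;> simp

/-- Forms of degree two are central. -/
lemma ι_mul_ι_comm (v w : Fin n ⊕ Fin n → ℂ) (x : ConstForm n) :
    ExteriorAlgebra.ι ℂ v * ExteriorAlgebra.ι ℂ w * x
      = x * (ExteriorAlgebra.ι ℂ v * ExteriorAlgebra.ι ℂ w) := by
  induction x using ExteriorAlgebra.induction with
  | algebraMap r => exact (Algebra.commutes r _).symm
  | add a b ha hb => rw [mul_add, add_mul, ha, hb]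
  | mul a b ha hb => rw [← mul_assoc, ha, mul_assoc, hb, mul_assoc]
  | ι u =>
    have h1 : ∀ y z : Fin n ⊕ Fin n → ℂ, ExteriorAlgebra.ι ℂ y * ExteriorAlgebra.ι ℂ z
        = -(ExteriorAlgebra.ι ℂ z * ExteriorAlgebra.ι ℂ y) := fun y z =>
      eq_neg_of_add_eq_zero_left (ExteriorAlgebra.ι_add_mul_swap y z)
    rw [mul_assoc, h1 w u, mul_neg, ← mul_assoc, h1 v u, neg_mul, neg_neg, mul_assoc]

lemma posForm_comm (a : Fin n → ℂ) (x : ConstForm n) : posForm a * x = x * posForm a := by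
  rw [posForm, alpha_eq_ι, alphaBar_eq_ι, smul_mul_assoc, ι_mul_ι_comm, mul_smul_comm]

lemma posProd_comm {q : ℕ} (a : Fin q → Fin n → ℂ) (x : ConstForm n) :
    posProd a * x = x * posProd a := by
  induction q with
  | zero => simp [posProd]
  | succ q ih =>
    have : posProd a = posForm (a 0) * posProd (fun l => a l.succ) := by
      simp [posProd, List.ofFn_succ]
    rw [this, mul_assoc, ih, ← mul_assoc, posForm_comm, mul_assoc]

lemma posProd_zero (a : Fin 0 → Fin n → ℂ) : posProd a = 1 := by simp [posProd]

lemma posProd_cons {q : ℕ} (b : Fin n → ℂ) (a : Fin q → Fin n → ℂ) :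
    posProd (Fin.cons b a : Fin (q + 1) → Fin n → ℂ) = posForm b * posProd a := by
  simp [posProd, List.ofFn_succ]

lemma dz_mul_dzbar_comm (j k : Fin n) (x : ConstForm n) :
    dz j * dzbar k * x = x * (dz j * dzbar k) := ι_mul_ι_comm _ _ x

lemma dz_mul_dz (j k : Fin n) : (dz j * dz k : ConstForm n) = -(dz k * dz j) :=
  eq_neg_of_add_eq_zero_left (ExteriorAlgebra.ι_add_mul_swap _ _)

lemma dzbar_mul_dzbar (j k : Fin n) : (dzbar j * dzbar k : ConstForm n) = -(dzbar k * dzbar j) :=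
  eq_neg_of_add_eq_zero_left (ExteriorAlgebra.ι_add_mul_swap _ _)

lemma dz_mul_dzbar (j k : Fin n) : (dz j * dzbar k : ConstForm n) = -(dzbar k * dz j) :=
  eq_neg_of_add_eq_zero_left (ExteriorAlgebra.ι_add_mul_swap _ _)

/-- The product of `v₁ w₁, …, v_q w_q` is `± v₁ ⋯ v_q w₁ ⋯ w_q`. -/
lemma exists_prod_mul_eq (q : ℕ) (v w : Fin q → Fin n ⊕ Fin n → ℂ) :
    ∃ e : ℂ, e ≠ 0 ∧
      (List.ofFn fun j => ExteriorAlgebra.ι ℂ (v j) * ExteriorAlgebra.ι ℂ (w j)).prod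
      = e • (ExteriorAlgebra.ιMulti ℂ q v * ExteriorAlgebra.ιMulti ℂ q w) := by
  induction q with
  | zero => exact ⟨1, one_ne_zero, by simp⟩
  | succ q ih =>
    obtain ⟨e, he, h⟩ := ih (fun l => v l.succ) (fun l => w l.succ)
    have hs : ∀ (r : ℕ) (u : Fin n ⊕ Fin n → ℂ) (v' : Fin r → Fin n ⊕ Fin n → ℂ),
        ∃ e : ℂ, e ≠ 0 ∧ ExteriorAlgebra.ι ℂ u * ExteriorAlgebra.ιMulti ℂ r v'
          = e • (ExteriorAlgebra.ιMulti ℂ r v' * ExteriorAlgebra.ι ℂ u) := by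
      intro r u
      induction r with
      | zero => intro v'; exact ⟨1, one_ne_zero, by simp⟩
      | succ r ih =>
        intro v'
        obtain ⟨e, he, h⟩ := ih (fun l => v' l.succ)
        refine ⟨-e, neg_ne_zero.2 he, ?_⟩
        rw [ExteriorAlgebra.ιMulti_succ_apply, ← mul_assoc,
          eq_neg_of_add_eq_zero_left (ExteriorAlgebra.ι_add_mul_swap u (v' 0)), neg_mul, mul_assoc]
        erw [h]
        rw [mul_smul_comm, neg_smul, mul_assoc]
        rfl
    obtain ⟨e', he', h'⟩ := hs q (w 0) (fun l => v l.succ)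
    refine ⟨e * e', mul_ne_zero he he', ?_⟩
    rw [List.ofFn_succ, List.prod_cons, h, ExteriorAlgebra.ιMulti_succ_apply,
      ExteriorAlgebra.ιMulti_succ_apply]
    change _ = (e * e') • (ExteriorAlgebra.ι ℂ (v 0)
      * ExteriorAlgebra.ιMulti ℂ q (fun l => v l.succ)
      * (ExteriorAlgebra.ι ℂ (w 0) * ExteriorAlgebra.ιMulti ℂ q (fun l => w l.succ)))
    rw [mul_smul_comm, mul_smul, mul_assoc, ← mul_assoc (ExteriorAlgebra.ι ℂ (w 0)), h',
      mul_assoc (ExteriorAlgebra.ι ℂ (v 0)), ← mul_assoc _ (ExteriorAlgebra.ι ℂ (w 0)),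
      smul_mul_assoc, mul_smul_comm]

lemma topCoeff_volForm_ne_zero (n : ℕ) : topCoeff n (volForm n) ≠ 0 := by
  have h1 : volForm n = (List.ofFn fun j : Fin n =>
      ExteriorAlgebra.ι ℂ ((Complex.I / 2) • (Pi.single (Sum.inl j) (1 : ℂ) : Fin n ⊕ Fin n → ℂ))
      * ExteriorAlgebra.ι ℂ (Pi.single (Sum.inr j) (1 : ℂ) : Fin n ⊕ Fin n → ℂ)).prod := by
    simp only [volForm, dz, dzbar, map_smul, smul_mul_assoc]
  obtain ⟨e, he, h⟩ := exists_prod_mul_eq (n := n) n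
    (fun j => (Complex.I / 2) • (Pi.single (Sum.inl j) (1 : ℂ) : Fin n ⊕ Fin n → ℂ))
    (fun j => (Pi.single (Sum.inr j) (1 : ℂ) : Fin n ⊕ Fin n → ℂ))
  rw [h1, h, map_smul, smul_eq_mul]
  refine mul_ne_zero he ?_
  have h2 := (ExteriorAlgebra.ιMulti ℂ n).toMultilinearMap.map_smul_univ
    (fun _ => Complex.I / 2) (fun j => (Pi.single (Sum.inl j) (1 : ℂ) : Fin n ⊕ Fin n → ℂ))
  erw [h2]
  rw [AlternatingMap.coe_multilinearMap, smul_mul_assoc, map_smul,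
    ExteriorAlgebra.ιMulti_mul_ιMulti, topCoeff_ιMulti]
  have : Fin.append (fun j => (Pi.single (Sum.inl j) (1 : ℂ) : Fin n ⊕ Fin n → ℂ))
      (fun j => (Pi.single (Sum.inr j) (1 : ℂ) : Fin n ⊕ Fin n → ℂ)) = formBasis n := by
    ext i : 1
    refine Fin.addCases (fun j => ?_) (fun j => ?_) i
    · simp [formBasis]
    · rw [Fin.append_right]
      simp [formBasis, -Fin.natAdd_eq_addNat]
  rw [this, Module.Basis.det_self]
  simp

/-- The coefficient of the volume form: the Berezin integral of a constant form. -/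
def berezin (n : ℕ) : ConstForm n →ₗ[ℂ] ℂ := (topCoeff n (volForm n))⁻¹ • topCoeff n

lemma berezin_volForm (n : ℕ) : berezin n (volForm n) = 1 := by
  simp [berezin, topCoeff_volForm_ne_zero]

lemma volForm_ne_zero (n : ℕ) : volForm n ≠ 0 := fun h => by
  simpa [h] using berezin_volForm n

lemma berezin_map (A : (Fin n ⊕ Fin n → ℂ) →ₗ[ℂ] (Fin n ⊕ Fin n → ℂ)) (x : ConstForm n) :
    berezin n (ExteriorAlgebra.map A x) = LinearMap.det A * berezin n x := by
  simp only [berezin, LinearMap.smul_apply, topCoeff_map, smul_eq_mul]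
  ring

lemma berezin_nondegenerate (x : ConstForm n) (hx : ∀ y, berezin n (x * y) = 0) : x = 0 :=
  topCoeff_nondegenerate x fun y => by
    simpa [berezin, topCoeff_volForm_ne_zero] using hx y

/-- The linear map that multiplies `dz_j` by `s` and `dz̄_j` by `t`. -/
def scale (s t : ℂ) : (Fin n ⊕ Fin n → ℂ) →ₗ[ℂ] (Fin n ⊕ Fin n → ℂ) :=
  Matrix.toLin' (Matrix.diagonal (Sum.elim (fun _ => s) (fun _ => t)))

lemma scale_apply (s t : ℂ) (v : Fin n ⊕ Fin n → ℂ) :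
    scale s t v = Sum.elim (fun j => s * v (Sum.inl j)) (fun j => t * v (Sum.inr j)) := by
  ext (k | k) <;> simp [scale, Matrix.mulVec_diagonal]

lemma det_scale (s t : ℂ) : LinearMap.det (scale (n := n) s t) = s ^ n * t ^ n := by
  simp [scale]

/-- The forms of bidegree `(a, b)`, as simultaneous eigenspace of the scalings of the `dz_j` and
of the `dz̄_j`. -/
def bideg (n a b : ℕ) : Submodule ℂ (ConstForm n) where
  carrier := {x | ∀ s t : ℂ, ExteriorAlgebra.map (scale s t) x = (s ^ a * t ^ b) • x}
  add_mem' := by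
    intro x y hx hy s t
    rw [map_add, hx, hy, smul_add]
  zero_mem' := by simp
  smul_mem' := by
    intro c x hx s t
    rw [map_smul, hx, smul_comm]

lemma mul_mem_bideg {a b c d e f : ℕ} {x y : ConstForm n} (hx : x ∈ bideg n a b)
    (hy : y ∈ bideg n c d) (he : a + c = e) (hf : b + d = f) : x * y ∈ bideg n e f := by
  subst he hf
  intro s t
  rw [map_mul, hx, hy, smul_mul_smul_comm]
  congr 1
  ring

lemma one_mem_bideg : (1 : ConstForm n) ∈ bideg n 0 0 := by
  intro s t
  simp

lemma alpha_mem_bideg (a : Fin n → ℂ) : alpha a ∈ bideg n 1 0 := by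
  intro s t
  rw [alpha_eq_ι, ExteriorAlgebra.map_apply_ι, ← map_smul, scale_apply]
  congr 1
  ext (k | k) <;> simp

lemma alphaBar_mem_bideg (a : Fin n → ℂ) : alphaBar a ∈ bideg n 0 1 := by
  intro s t
  rw [alphaBar_eq_ι, ExteriorAlgebra.map_apply_ι, ← map_smul, scale_apply]
  congr 1
  ext (k | k) <;> simp

lemma alpha_single (j : Fin n) : alpha (Pi.single j 1) = dz j := by
  simp [alpha, Pi.single_apply, ite_smul]

lemma alphaBar_single (j : Fin n) : alphaBar (Pi.single j 1) = dzbar j := by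
  simp [alphaBar, Pi.single_apply, ite_smul, apply_ite]

lemma dz_mem_bideg (j : Fin n) : (dz j : ConstForm n) ∈ bideg n 1 0 :=
  (alpha_single (n := n) j) ▸ alpha_mem_bideg (Pi.single j 1)

lemma dzbar_mem_bideg (j : Fin n) : (dzbar j : ConstForm n) ∈ bideg n 0 1 :=
  (alphaBar_single (n := n) j) ▸ alphaBar_mem_bideg (Pi.single j 1)

lemma dz_mul_dzbar_mem_bideg (j k : Fin n) : (dz j * dzbar k : ConstForm n) ∈ bideg n 1 1 :=
  mul_mem_bideg (dz_mem_bideg j) (dzbar_mem_bideg k) rfl rfl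

lemma posForm_mem_bideg (a : Fin n → ℂ) : posForm a ∈ bideg n 1 1 :=
  (bideg n 1 1).smul_mem _ (mul_mem_bideg (alpha_mem_bideg a) (alphaBar_mem_bideg a) rfl rfl)

lemma posProd_mem_bideg {q : ℕ} (a : Fin q → Fin n → ℂ) : posProd a ∈ bideg n q q := by
  induction q with
  | zero => rw [posProd_zero]; exact one_mem_bideg
  | succ q ih =>
    rw [← Fin.cons_self_tail a, posProd_cons]
    exact mul_mem_bideg (posForm_mem_bideg (a 0)) (ih (Fin.tail a)) (add_comm 1 q) (add_comm 1 q)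

/-- Only forms of bidegree `(n, n)` have a nonzero Berezin integral. -/
lemma berezin_eq_zero {a b : ℕ} {x : ConstForm n} (hx : x ∈ bideg n a b)
    (hab : a ≠ n ∨ b ≠ n) : berezin n x = 0 := by
  have h : ∀ s t : ℂ, (s ^ a * t ^ b - s ^ n * t ^ n) * berezin n x = 0 := by
    intro s t
    have := berezin_map (scale s t) x
    rw [hx s t, map_smul, det_scale, smul_eq_mul] at this
    linear_combination this
  have h2 : ∀ k : ℕ, k ≠ n → (2 : ℂ) ^ k - 2 ^ n ≠ 0 := by
    intro k hk h
    apply hk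
    have : ((2 ^ k : ℕ) : ℂ) = (2 ^ n : ℕ) := by push_cast; exact sub_eq_zero.1 h
    exact Nat.pow_right_injective le_rfl (Nat.cast_injective this)
  rcases hab with hab | hab
  · exact (mul_eq_zero.1 (by simpa using h 2 1)).resolve_left (h2 a hab)
  · exact (mul_eq_zero.1 (by simpa using h 1 2)).resolve_left (h2 b hab)

/-- Forms of bidegrees `(a+1,b)` and `(a,b+1)` are independent. -/
lemma eq_zero_of_add_eq_zero {a b : ℕ} {x y : ConstForm n} (hx : x ∈ bideg n (a + 1) b)
    (hy : y ∈ bideg n a (b + 1)) (h : x + y = 0) : x = 0 ∧ y = 0 := by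
  have h1 := congrArg (ExteriorAlgebra.map (scale 2 1)) h
  rw [map_add, hx, hy, map_zero, eq_neg_of_add_eq_zero_right h] at h1
  have h2 : (2 : ℂ) ^ a • x = 0 := by
    rw [← h1]
    simp only [one_pow, mul_one, smul_neg, pow_succ]
    module
  have hx0 : x = 0 := (smul_eq_zero.1 h2).resolve_left (by positivity)
  exact ⟨hx0, by simpa [hx0] using h⟩

lemma exists_eq_algebraMap {y : ConstForm n} (hy : y ∈ bideg n 0 0) :
    ∃ c : ℂ, y = algebraMap ℂ _ c := by
  refine ⟨ExteriorAlgebra.algebraMapInv y, ?_⟩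
  have h0 : ExteriorAlgebra.map (scale (n := n) 0 0)
      = (Algebra.ofId ℂ (ConstForm n)).comp ExteriorAlgebra.algebraMapInv := by
    ext v
    have : (Sum.elim (fun _ => 0) fun _ => 0 : Fin n ⊕ Fin n → ℂ) = 0 := by
      ext (k | k) <;> rfl
    simp [scale_apply, ExteriorAlgebra.algebraMapInv, this]
  have := hy 0 0
  rw [h0] at this
  simpa [Algebra.ofId_apply] using this.symm

/-! ### Strongly positive forms and duality -/

/-- The form `i α₁ ∧ ᾱ₁ ∧ … ∧ i αₙ ∧ ᾱₙ` is `2ⁿ |det M|²` times the volume form, where the linear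
map `M` takes the `dz_j` to the `α_j`. -/
lemma berezin_posProd_nonneg_self (a : Fin n → Fin n → ℂ) : 0 ≤ berezin n (posProd a) := by
  classical
  set M : Matrix (Fin n) (Fin n) ℂ := Matrix.of fun i j => a j i
  set A := Matrix.toLin' (Matrix.fromBlocks M 0 0 (M.map (starRingEnd ℂ)))
  have hA : ∀ v : Fin n ⊕ Fin n → ℂ, A v = Sum.elim (M.mulVec (v ∘ Sum.inl))
      ((M.map (starRingEnd ℂ)).mulVec (v ∘ Sum.inr)) := by
    intro v
    simp [A, Matrix.fromBlocks_mulVec]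
  have h1 : ∀ j, ExteriorAlgebra.map A (dz j) = alpha (a j) := by
    intro j
    rw [dz, ExteriorAlgebra.map_apply_ι, hA, alpha_eq_ι]
    congr 1
    ext (k | k)
    · simp [Matrix.mulVec, dotProduct, Pi.single_apply, M]
    · simp [Matrix.mulVec, dotProduct, M]
  have h2 : ∀ j, ExteriorAlgebra.map A (dzbar j) = alphaBar (a j) := by
    intro j
    rw [dzbar, ExteriorAlgebra.map_apply_ι, hA, alphaBar_eq_ι]
    congr 1
    ext (k | k)
    · simp [Matrix.mulVec, dotProduct, M]
    · simp [Matrix.mulVec, dotProduct, Pi.single_apply, M]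
  have h3 : ∀ (q : ℕ) (c : Fin q → Fin n → ℂ), posProd c = (2 : ℂ) ^ q •
      (List.ofFn fun l => (Complex.I / 2) • (alpha (c l) * alphaBar (c l))).prod := by
    intro q
    induction q with
    | zero => intro c; simp [posProd]
    | succ q ih =>
      intro c
      rw [List.ofFn_succ, List.prod_cons, ← Fin.cons_self_tail c, posProd_cons, ih]
      simp only [Fin.cons_zero, Fin.cons_succ, posForm, smul_mul_assoc, mul_smul_comm, smul_smul]
      congr 1
      ring
  have h4 : posProd a = (2 : ℂ) ^ n • ExteriorAlgebra.map A (volForm n) := by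
    rw [h3, volForm, map_list_prod, List.map_ofFn]
    simp [Function.comp_def, h1, h2]
  have h5 : LinearMap.det A = M.det * (starRingEnd ℂ) M.det := by
    simp only [A, LinearMap.det_toLin', Matrix.det_fromBlocks_zero₂₁]
    congr 1
    exact (RingHom.map_det (starRingEnd ℂ) M).symm
  rw [h4, map_smul, berezin_map, berezin_volForm, h5, mul_one, smul_eq_mul]
  exact mul_nonneg (by positivity) (mul_star_self_nonneg M.det)

lemma eq_smul_volForm {x : ConstForm n} (hx : x ∈ bideg n n n) :
    x = berezin n x • volForm n := by
  have hv : volForm n ∈ bideg n n n := by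
    have h : ∀ (q : ℕ) (v : Fin q → Fin n),
        (List.ofFn fun l => (Complex.I / 2) • (dz (v l) * dzbar (v l) : ConstForm n)).prod
          ∈ bideg n q q := by
      intro q
      induction q with
      | zero => intro v; simpa using one_mem_bideg
      | succ q ih =>
        intro v
        rw [List.ofFn_succ, List.prod_cons]
        exact mul_mem_bideg ((bideg n 1 1).smul_mem _ (dz_mul_dzbar_mem_bideg _ _)) (ih _)
          (add_comm _ _) (add_comm _ _)
    exact h n id
  rw [← sub_eq_zero]
  set y := x - berezin n x • volForm n with hy
  have hyB : y ∈ bideg n n n := (bideg n n n).sub_mem hx ((bideg n n n).smul_mem _ hv)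
  have hy0 : berezin n y = 0 := by simp [hy, berezin_volForm]
  -- for `z` of positive degree by bidegree, for constants `z` by the choice of `y`
  have key : ∀ (z : ConstForm n), berezin n (y * z) = 0 := by
    have hspan : ∀ z : ConstForm n, z ∈ Submodule.span ℂ
        {w : ConstForm n | ∃ a b, w ∈ bideg n a b} := by
      intro z
      induction z using CliffordAlgebra.left_induction with
      | algebraMap r =>
        rw [Algebra.algebraMap_eq_smul_one]
        exact Submodule.smul_mem _ _ (Submodule.subset_span ⟨0, 0, one_mem_bideg⟩)
      | add x y hx hy => exact add_mem hx hy
      | ι_mul z v hz =>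
        change ExteriorAlgebra.ι ℂ v * z ∈ _
        rw [ι_eq_alpha_add_alphaBar, add_mul]
        induction hz using Submodule.span_induction with
        | mem w hw =>
          obtain ⟨a, b, hw⟩ := hw
          exact add_mem (Submodule.subset_span ⟨1 + a, 0 + b,
            mul_mem_bideg (alpha_mem_bideg _) hw rfl rfl⟩)
            (Submodule.subset_span ⟨0 + a, 1 + b,
            mul_mem_bideg (alphaBar_mem_bideg _) hw rfl rfl⟩)
        | zero => simp
        | add x y _ _ hx hy =>
          rw [mul_add, mul_add, add_add_add_comm]
          exact add_mem hx hy
        | smul c x _ hx =>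
          rw [mul_smul_comm, mul_smul_comm, ← smul_add]
          exact Submodule.smul_mem _ _ hx
    intro z
    induction hspan z using Submodule.span_induction with
    | mem w hw =>
      obtain ⟨a, b, hw⟩ := hw
      by_cases hab : a = 0 ∧ b = 0
      · obtain ⟨rfl, rfl⟩ := hab
        obtain ⟨c, rfl⟩ := exists_eq_algebraMap hw
        rw [Algebra.algebraMap_eq_smul_one, mul_smul_comm, mul_one, map_smul, hy0, smul_zero]
      · exact berezin_eq_zero (mul_mem_bideg hyB hw rfl rfl) (by omega)
    | zero => simp
    | add x y _ _ hx hy => rw [mul_add, map_add, hx, hy, add_zero]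
    | smul c x _ hx => rw [mul_smul_comm, map_smul, hx, smul_zero]
  exact berezin_nondegenerate y key

/-- Polarization: `α ∧ β̄` is a combination of the forms `γ ∧ γ̄`. -/
lemma alpha_mul_alphaBar_mem_span (a b : Fin n → ℂ) :
    alpha a * alphaBar b ∈ Submodule.span ℂ (Set.range (posForm (n := n))) := by
  have hadd : ∀ c d : Fin n → ℂ, alpha (c + d) = alpha c + alpha d := by
    intro c d
    simp [alpha, add_smul, Finset.sum_add_distrib]
  have haddB : ∀ c d : Fin n → ℂ, alphaBar (c + d) = alphaBar c + alphaBar d := by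
    intro c d
    simp [alphaBar, add_smul, Finset.sum_add_distrib]
  have hsm : ∀ (s : ℂ) (d : Fin n → ℂ), alpha (s • d) = s • alpha d := by
    intro s d
    simp [alpha, mul_smul, Finset.smul_sum]
  have hsmB : ∀ (s : ℂ) (d : Fin n → ℂ), alphaBar (s • d) = (starRingEnd ℂ) s • alphaBar d := by
    intro s d
    simp [alphaBar, mul_smul, Finset.smul_sum]
  have hid : alpha a * alphaBar b = (-Complex.I / 4) • posForm (a + b)
      + (1 / 4 : ℂ) • posForm (a + Complex.I • b) + (Complex.I / 4) • posForm (a + (-1 : ℂ) • b)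
      + (-1 / 4 : ℂ) • posForm (a + (-Complex.I) • b) := by
    simp only [posForm, hadd, haddB, hsm, hsmB, mul_add, add_mul, smul_mul_assoc, mul_smul_comm,
      smul_add, smul_smul, map_neg, map_one, Complex.conj_I]
    match_scalars <;> ring_nf <;> simp [Complex.I_sq]
  rw [hid]
  refine add_mem (add_mem (add_mem ?_ ?_) ?_) ?_ <;>
  exact Submodule.smul_mem _ _ (Submodule.subset_span ⟨_, rfl⟩)

/-- A form of bidegree `(p, p)` that pairs to zero with all strongly positive forms of
complementary bidegree vanishes. -/
lemma eq_zero_of_forall_posProd {p q : ℕ} (hpq : p + q = n) {x : ConstForm n}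
    (hx : x ∈ bideg n p p) (h : ∀ a : Fin q → Fin n → ℂ, berezin n (x * posProd a) = 0) :
    x = 0 := by
  -- The exterior algebra is spanned by the `y w` with `y` strongly positive and `w` a product of
  -- forms `α` only, or of forms `ᾱ` only.
  let hol : Set (ConstForm n) := {w | ∃ (r c : ℕ) (a : Fin r → Fin n → ℂ) (b : Fin c → Fin n → ℂ),
    w = posProd a * (List.ofFn fun l => alpha (b l)).prod}
  let anti : Set (ConstForm n) := {w | ∃ (r c : ℕ) (a : Fin r → Fin n → ℂ) (b : Fin c → Fin n → ℂ),
    w = posProd a * (List.ofFn fun l => alphaBar (b l)).prod}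
  have hpos : ∀ u ∈ Submodule.span ℂ (Set.range (posForm (n := n))), ∀ w,
      (w ∈ hol ∨ w ∈ anti) → u * w ∈ Submodule.span ℂ (hol ∪ anti) := by
    intro u hu w hw
    induction hu using Submodule.span_induction with
    | mem u hu =>
      obtain ⟨d, rfl⟩ := hu
      refine Submodule.subset_span ?_
      rcases hw with ⟨r, c, a, b, rfl⟩ | ⟨r, c, a, b, rfl⟩
      · exact Or.inl ⟨r + 1, c, Fin.cons d a, b, by rw [posProd_cons, mul_assoc]⟩
      · exact Or.inr ⟨r + 1, c, Fin.cons d a, b, by rw [posProd_cons, mul_assoc]⟩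
    | zero => simp
    | add u v _ _ hu hv => rw [add_mul]; exact add_mem hu hv
    | smul c u _ hu => rw [smul_mul_assoc]; exact Submodule.smul_mem _ _ hu
  have hswap : ∀ a b : Fin n → ℂ, alphaBar b * alpha a = -(alpha a * alphaBar b) := by
    intro a b
    rw [alpha_eq_ι, alphaBar_eq_ι]
    exact eq_neg_of_add_eq_zero_left (ExteriorAlgebra.ι_add_mul_swap _ _)
  have hmul : ∀ (v : Fin n ⊕ Fin n → ℂ), ∀ w ∈ hol ∪ anti,
      ExteriorAlgebra.ι ℂ v * w ∈ Submodule.span ℂ (hol ∪ anti) := by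
    intro v w hw
    rw [ι_eq_alpha_add_alphaBar, add_mul]
    set d := fun j => v (Sum.inl j)
    set e := fun j => (starRingEnd ℂ) (v (Sum.inr j))
    rcases hw with ⟨r, c, a, b, rfl⟩ | ⟨r, c, a, b, rfl⟩
    · refine add_mem (Submodule.subset_span (Or.inl ⟨r, c + 1, a, Fin.cons d b, ?_⟩)) ?_
      · rw [← mul_assoc, ← posProd_comm, mul_assoc]
        simp [List.ofFn_succ]
      · rw [← mul_assoc, ← posProd_comm, mul_assoc]
        cases c with
        | zero =>
          refine Submodule.subset_span (Or.inr ⟨r, 1, a, fun _ => e, ?_⟩)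
          simp
        | succ c =>
          have : posProd a * (alphaBar e * (List.ofFn fun l => alpha (b l)).prod)
              = -(alpha (b 0) * alphaBar e) *
                (posProd a * (List.ofFn fun l : Fin c => alpha (b l.succ)).prod) := by
            rw [List.ofFn_succ, List.prod_cons, ← mul_assoc (alphaBar e), hswap, ← mul_assoc,
              posProd_comm, mul_assoc]
          rw [this]
          exact hpos _ (Submodule.neg_mem _ (alpha_mul_alphaBar_mem_span _ _)) _
            (Or.inl ⟨r, c, a, fun l => b l.succ, rfl⟩)
    · refine add_mem ?_ (Submodule.subset_span (Or.inr ⟨r, c + 1, a, Fin.cons e b, ?_⟩))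
      · rw [← mul_assoc, ← posProd_comm, mul_assoc]
        cases c with
        | zero =>
          refine Submodule.subset_span (Or.inl ⟨r, 1, a, fun _ => d, ?_⟩)
          simp
        | succ c =>
          have : posProd a * (alpha d * (List.ofFn fun l => alphaBar (b l)).prod)
              = (alpha d * alphaBar (b 0)) *
                (posProd a * (List.ofFn fun l : Fin c => alphaBar (b l.succ)).prod) := by
            rw [List.ofFn_succ, List.prod_cons, ← mul_assoc (alpha d), ← mul_assoc,
              posProd_comm, mul_assoc]
          rw [this]
          exact hpos _ (alpha_mul_alphaBar_mem_span _ _) _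
            (Or.inr ⟨r, c, a, fun l => b l.succ, rfl⟩)
      · rw [← mul_assoc, ← posProd_comm, mul_assoc]
        simp [List.ofFn_succ]
  have hspan : ∀ z : ConstForm n, z ∈ Submodule.span ℂ (hol ∪ anti) := by
    intro z
    induction z using CliffordAlgebra.left_induction with
    | algebraMap r =>
      rw [Algebra.algebraMap_eq_smul_one]
      exact Submodule.smul_mem _ _ (Submodule.subset_span
        (Or.inl ⟨0, 0, Fin.elim0, Fin.elim0, by simp [posProd]⟩))
    | add x y hx hy => exact add_mem hx hy
    | ι_mul z v hz =>
      change ExteriorAlgebra.ι ℂ v * z ∈ _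
      induction hz using Submodule.span_induction with
      | mem w hw => exact hmul v w hw
      | zero => simp
      | add x y _ _ hx hy => rw [mul_add]; exact add_mem hx hy
      | smul c x _ hx => rw [mul_smul_comm]; exact Submodule.smul_mem _ _ hx
  have hprod : ∀ (c : ℕ) (b : Fin c → Fin n → ℂ),
      (List.ofFn fun l => alpha (b l)).prod ∈ bideg n c 0 ∧
      (List.ofFn fun l => alphaBar (b l)).prod ∈ bideg n 0 c := by
    intro c
    induction c with
    | zero => intro b; simpa using one_mem_bideg
    | succ c ih =>
      intro b
      rw [List.ofFn_succ, List.ofFn_succ, List.prod_cons, List.prod_cons]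
      exact ⟨mul_mem_bideg (alpha_mem_bideg _) (ih _).1 (add_comm _ _) rfl,
        mul_mem_bideg (alphaBar_mem_bideg _) (ih _).2 rfl (add_comm _ _)⟩
  have h0 : ∀ (r : ℕ) (a : Fin r → Fin n → ℂ), berezin n (x * posProd a) = 0 := by
    intro r a
    by_cases hr : r = q
    · subst hr
      exact h a
    · exact berezin_eq_zero (mul_mem_bideg hx (posProd_mem_bideg a) rfl rfl) (by omega)
  refine berezin_nondegenerate x fun z => ?_
  induction hspan z using Submodule.span_induction with
  | mem w hw =>
    rcases hw with ⟨r, c, a, b, rfl⟩ | ⟨r, c, a, b, rfl⟩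
    · by_cases hc : c = 0
      · subst hc
        simpa using h0 r a
      · exact berezin_eq_zero (mul_mem_bideg hx (mul_mem_bideg (posProd_mem_bideg a)
          (hprod c b).1 rfl rfl) rfl rfl) (by omega)
    · by_cases hc : c = 0
      · subst hc
        simpa using h0 r a
      · exact berezin_eq_zero (mul_mem_bideg hx (mul_mem_bideg (posProd_mem_bideg a)
          (hprod c b).2 rfl rfl) rfl rfl) (by omega)
  | zero => simp
  | add x y _ _ hx hy => rw [mul_add, map_add, hx, hy, add_zero]
  | smul c x _ hx => rw [mul_smul_comm, map_smul, hx, smul_zero]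

instance : Module.Finite ℂ (ConstForm n) :=
  Module.Finite.of_basis (formBasis n).ExteriorAlgebra

/-- On forms of bidegree `(p, p)` each linear functional is a combination of pairings with
strongly positive forms of complementary bidegree. -/
lemma exists_eq_on_bideg {p q : ℕ} (hpq : p + q = n) (l : Module.Dual ℂ (ConstForm n)) :
    ∃ l' ∈ Submodule.span ℂ (Set.range fun a : Fin q → Fin n → ℂ =>
      berezin n ∘ₗ LinearMap.mulRight ℂ (posProd a)), ∀ x ∈ bideg n p p, l x = l' x := by
  set S := Submodule.span ℂ (Set.range fun a : Fin q → Fin n → ℂ =>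
      berezin n ∘ₗ LinearMap.mulRight ℂ (posProd a)) with hS
  set W := bideg n p p
  -- restriction to `W` maps `S` onto the dual of `W`
  have htop : S.map (LinearMap.lcomp ℂ ℂ W.subtype) = ⊤ := by
    set D := S.map (LinearMap.lcomp ℂ ℂ W.subtype)
    have hbot : D.dualCoannihilator = ⊥ := by
      rw [eq_bot_iff]
      intro x hx
      rw [Submodule.mem_dualCoannihilator] at hx
      have : (x : ConstForm n) = 0 := eq_zero_of_forall_posProd hpq x.2 fun a =>
        hx _ ⟨_, Submodule.subset_span ⟨a, rfl⟩, rfl⟩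
      simpa using this
    rw [← Subspace.dualCoannihilator_dualAnnihilator_eq (W := D), hbot,
      Submodule.dualAnnihilator_bot]
  have : l ∘ₗ W.subtype ∈ S.map (LinearMap.lcomp ℂ ℂ W.subtype) := htop ▸ Submodule.mem_top
  obtain ⟨l', hl', he⟩ := this
  exact ⟨l', hl', fun x hx => (congrArg (fun f => f ⟨x, hx⟩) he).symm⟩

lemma kahler_eq_sum : kahler n = ∑ j, posForm (Pi.single j 1) := by
  simp [kahler, posForm, alpha_single, alphaBar_single]

lemma kahler_mem_bideg : kahler n ∈ bideg n 1 1 := by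
  rw [kahler_eq_sum]
  exact (bideg n 1 1).sum_mem fun j _ => posForm_mem_bideg _

/-! ### Wirtinger derivatives of functions and of test functions -/

/-- The operator `(∂/∂x_j + ε ∂/∂y_j)/2`. It is `∂/∂z_j` for `ε = -i` and `∂/∂z̄_j` for `ε = i`. -/
def wirt (ε : ℂ) (j : Fin n) (f : Cn n → ℂ) (z : Cn n) : ℂ :=
  (1 / 2) * (fderiv ℝ f z (EuclideanSpace.single j (1 : ℂ))
    + ε * fderiv ℝ f z (EuclideanSpace.single j Complex.I))

lemma lineDeriv_test_apply (f : 𝓓(Ω, ℂ)) (v z : Cn n) : (∂_{v} f) z = fderiv ℝ f z v := by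
  rw [TestFunction.lineDerivOp_eq_lineDerivCLM ℝ, TestFunction.lineDerivCLM_eq_fderivCLM,
    TestFunction.fderivCLM_apply_of_le]
  simp

lemma dPartial_apply (j : Fin n) (f : 𝓓(Ω, ℂ)) (z : Cn n) :
    dPartial j f z = wirt (-Complex.I) j f z := by
  simp only [dPartial, wirt, FunLike.coe_smul, FunLike.coe_sub, Pi.smul_apply, Pi.sub_apply,
    lineDeriv_test_apply, smul_eq_mul]
  ring

lemma dbarPartial_apply (j : Fin n) (f : 𝓓(Ω, ℂ)) (z : Cn n) :
    dbarPartial j f z = wirt Complex.I j f z := by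
  simp only [dbarPartial, wirt, FunLike.coe_smul, FunLike.coe_add, Pi.smul_apply, Pi.add_apply,
    lineDeriv_test_apply, smul_eq_mul]

lemma contDiff_wirt (ε : ℂ) (j : Fin n) {f : Cn n → ℂ} (hf : ContDiff ℝ ∞ f) :
    ContDiff ℝ ∞ (wirt ε j f) := by
  have h : ∀ v : Cn n, ContDiff ℝ ∞ fun z => fderiv ℝ f z v := fun v =>
    (hf.fderiv_right (m := ∞) (by simp)).clm_apply contDiff_const
  unfold wirt
  exact contDiff_const.mul ((h _).add (contDiff_const.mul (h _)))

lemma wirt_mul (ε : ℂ) (j : Fin n) {f g : Cn n → ℂ} (hf : ContDiff ℝ ∞ f) (hg : ContDiff ℝ ∞ g)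
    (z : Cn n) : wirt ε j (fun z => f z * g z) z = wirt ε j f z * g z + f z * wirt ε j g z := by
  have h := fderiv_fun_mul (hf.differentiable (by simp) z) (hg.differentiable (by simp) z)
  simp only [wirt, h, FunLike.coe_add, FunLike.coe_smul, Pi.add_apply, Pi.smul_apply, smul_eq_mul]
  ring

lemma fderiv_fderiv_comm {f : Cn n → ℂ} (hf : ContDiff ℝ ∞ f) (v w z : Cn n) :
    fderiv ℝ (fun z => fderiv ℝ f z v) z w = fderiv ℝ (fun z => fderiv ℝ f z w) z v := by
  have hd : DifferentiableAt ℝ (fderiv ℝ f) z :=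
    (hf.fderiv_right (m := ∞) (by simp)).differentiable (by simp) z
  have h : ∀ v : Cn n, fderiv ℝ (fun z => fderiv ℝ f z v) z
      = (fderiv ℝ (fderiv ℝ f) z).flip v := by
    intro v
    rw [fderiv_clm_apply hd (differentiableAt_const v)]
    simp
  rw [h, h]
  exact (hf.contDiffAt.isSymmSndFDerivAt
    (by simpa using (WithTop.coe_le_coe.2 le_top : ((2 : ℕ∞) : ℕ∞ω) ≤ ((⊤ : ℕ∞) : ℕ∞ω)))).eq w v

lemma wirt_comm (ε δ : ℂ) (j k : Fin n) {f : Cn n → ℂ} (hf : ContDiff ℝ ∞ f) :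
    wirt ε j (wirt δ k f) = wirt δ k (wirt ε j f) := by
  have hd : ∀ v : Cn n, ContDiff ℝ ∞ fun z => fderiv ℝ f z v := fun v =>
    (hf.fderiv_right (m := ∞) (by simp)).clm_apply contDiff_const
  have h : ∀ (δ : ℂ) (k : Fin n) (z v : Cn n), fderiv ℝ (wirt δ k f) z v
      = (1 / 2) * (fderiv ℝ (fun z => fderiv ℝ f z (EuclideanSpace.single k (1 : ℂ))) z v
        + δ * fderiv ℝ (fun z => fderiv ℝ f z (EuclideanSpace.single k Complex.I)) z v) := by
    intro δ k z v
    have h1 := (hd (EuclideanSpace.single k (1 : ℂ))).differentiable (by simp) z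
    have h2 := (hd (EuclideanSpace.single k Complex.I)).differentiable (by simp) z
    have := ((h1.hasFDerivAt.add (h2.hasFDerivAt.const_mul δ)).const_mul (1 / 2 : ℂ)).fderiv
    change fderiv ℝ (fun z => (1 / 2 : ℂ) * (fderiv ℝ f z (EuclideanSpace.single k (1 : ℂ))
      + δ * fderiv ℝ f z (EuclideanSpace.single k Complex.I))) z v = _
    erw [this]
    simp [mul_add]
  funext z
  rw [wirt, wirt, h, h, h, h, fderiv_fderiv_comm hf (EuclideanSpace.single k (1 : ℂ)),
    fderiv_fderiv_comm hf (EuclideanSpace.single k (1 : ℂ)),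
    fderiv_fderiv_comm hf (EuclideanSpace.single k Complex.I),
    fderiv_fderiv_comm hf (EuclideanSpace.single k Complex.I)]
  ring

lemma contDiff_ofReal {w : Cn n → ℝ} (hw : ContDiff ℝ ∞ w) :
    ContDiff ℝ ∞ fun z => (w z : ℂ) := Complex.ofRealCLM.contDiff.comp hw

lemma fderiv_ofReal {w : Cn n → ℝ} (hw : ContDiff ℝ ∞ w) (z v : Cn n) :
    fderiv ℝ (fun z => (w z : ℂ)) z v = (fderiv ℝ w z v : ℂ) := by
  have := (Complex.ofRealCLM.hasFDerivAt.comp z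
    (hw.differentiable (by simp) z).hasFDerivAt).fderiv
  change fderiv ℝ (Complex.ofRealCLM ∘ w) z v = _
  rw [this]
  simp

/-- The chain rule. -/
lemma wirt_comp (ε : ℂ) (j : Fin n) {φ : ℝ → ℝ} (hφ : ContDiff ℝ ∞ φ) {w : Cn n → ℝ}
    (hw : ContDiff ℝ ∞ w) (z : Cn n) :
    wirt ε j (fun z => (φ (w z) : ℂ)) z
      = ((deriv φ (w z) : ℝ) : ℂ) * wirt ε j (fun z => (w z : ℂ)) z := by
  have h : ∀ v, fderiv ℝ (fun z => (φ (w z) : ℂ)) z v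
      = ((deriv φ (w z) * fderiv ℝ w z v : ℝ) : ℂ) := by
    intro v
    have h1 := ((hφ.differentiable (by simp) (w z)).hasDerivAt.comp_hasFDerivAt z
      (hw.differentiable (by simp) z).hasFDerivAt).fderiv
    have h2 := fderiv_ofReal (hφ.comp hw) z v
    rw [h1] at h2
    exact h2
  simp only [wirt, fderiv_ofReal hw, h]
  push_cast
  ring

lemma support_wirt_subset (ε : ℂ) (j : Fin n) (f : Cn n → ℂ) :
    Function.support (wirt ε j f) ⊆ tsupport f := by
  intro z hz
  by_contra h
  apply hz
  have : fderiv ℝ f z = 0 := by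
    by_contra h0
    exact h (support_fderiv_subset ℝ h0)
  simp [wirt, this]

lemma tsupport_dPartial_subset (j : Fin n) (f : 𝓓(Ω, ℂ)) :
    tsupport (dPartial j f) ⊆ tsupport f := by
  refine closure_minimal ?_ (isClosed_tsupport _)
  have : (dPartial j f : Cn n → ℂ) = wirt (-Complex.I) j f := funext (dPartial_apply j f)
  rw [this]
  exact support_wirt_subset _ _ _

lemma tsupport_dbarPartial_subset (j : Fin n) (f : 𝓓(Ω, ℂ)) :
    tsupport (dbarPartial j f) ⊆ tsupport f := by
  refine closure_minimal ?_ (isClosed_tsupport _)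
  have : (dbarPartial j f : Cn n → ℂ) = wirt Complex.I j f := funext (dbarPartial_apply j f)
  rw [this]
  exact support_wirt_subset _ _ _

lemma dPartial_comm (j k : Fin n) (f : 𝓓(Ω, ℂ)) :
    dPartial j (dPartial k f) = dPartial k (dPartial j f) := by
  ext z
  have : ∀ k, (dPartial k f : Cn n → ℂ) = wirt (-Complex.I) k f :=
    fun k => funext (dPartial_apply k f)
  rw [dPartial_apply, dPartial_apply, this, this, wirt_comm _ _ _ _ f.contDiff]

lemma dbarPartial_comm (j k : Fin n) (f : 𝓓(Ω, ℂ)) :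
    dbarPartial j (dbarPartial k f) = dbarPartial k (dbarPartial j f) := by
  ext z
  have : ∀ k, (dbarPartial k f : Cn n → ℂ) = wirt (Complex.I) k f :=
    fun k => funext (dbarPartial_apply k f)
  rw [dbarPartial_apply, dbarPartial_apply, this, this, wirt_comm _ _ _ _ f.contDiff]

lemma dPartial_dbarPartial_comm (j k : Fin n) (f : 𝓓(Ω, ℂ)) :
    dPartial j (dbarPartial k f) = dbarPartial k (dPartial j f) := by
  ext z
  have h1 : (dbarPartial k f : Cn n → ℂ) = wirt (Complex.I) k f := funext (dbarPartial_apply k f)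
  have h2 : (dPartial j f : Cn n → ℂ) = wirt (-Complex.I) j f := funext (dPartial_apply j f)
  rw [dbarPartial_apply, dPartial_apply, h1, h2, wirt_comm _ _ _ _ f.contDiff]

/-! ### Products of test functions with smooth functions -/

/-- The product of a test function and a smooth function. -/
def mulTest (w : Cn n → ℂ) (hw : ContDiff ℝ ∞ w) (f : 𝓓(Ω, ℂ)) : 𝓓(Ω, ℂ) where
  toFun z := w z * f z
  contDiff' := hw.mul f.contDiff
  hasCompactSupport' := f.hasCompactSupport.mul_left
  tsupport_subset' := (tsupport_mul_subset_right (f := w) (g := f)).trans f.tsupport_subset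

lemma mulTest_apply (w : Cn n → ℂ) (hw : ContDiff ℝ ∞ w) (f : 𝓓(Ω, ℂ)) (z : Cn n) :
    mulTest w hw f z = w z * f z := rfl

lemma tsupport_mulTest_subset (w : Cn n → ℂ) (hw : ContDiff ℝ ∞ w) (f : 𝓓(Ω, ℂ)) :
    tsupport (mulTest w hw f) ⊆ tsupport f :=
  tsupport_mul_subset_right (f := w) (g := f)

lemma dPartial_mulTest (j : Fin n) (w : Cn n → ℂ) (hw : ContDiff ℝ ∞ w) (f : 𝓓(Ω, ℂ)) :
    dPartial j (mulTest w hw f) = mulTest (wirt (-Complex.I) j w) (contDiff_wirt _ _ hw) f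
      + mulTest w hw (dPartial j f) := by
  ext z
  rw [dPartial_apply, FunLike.coe_add, Pi.add_apply, mulTest_apply, mulTest_apply, dPartial_apply]
  exact wirt_mul _ _ hw f.contDiff z

lemma dbarPartial_mulTest (j : Fin n) (w : Cn n → ℂ) (hw : ContDiff ℝ ∞ w) (f : 𝓓(Ω, ℂ)) :
    dbarPartial j (mulTest w hw f) = mulTest (wirt Complex.I j w) (contDiff_wirt _ _ hw) f
      + mulTest w hw (dbarPartial j f) := by
  ext z
  rw [dbarPartial_apply, FunLike.coe_add, Pi.add_apply, mulTest_apply, mulTest_apply,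
    dbarPartial_apply]
  exact wirt_mul _ _ hw f.contDiff z

lemma mulTest_add (w : Cn n → ℂ) (hw : ContDiff ℝ ∞ w) (f g : 𝓓(Ω, ℂ)) :
    mulTest w hw (f + g) = mulTest w hw f + mulTest w hw g := by
  ext z
  simp [mulTest_apply, mul_add]

lemma mulTest_smul (w : Cn n → ℂ) (hw : ContDiff ℝ ∞ w) (c : ℂ) (f : 𝓓(Ω, ℂ)) :
    mulTest w hw (c • f) = c • mulTest w hw f := by
  ext z
  simp [mulTest_apply]
  ring

/-! ### Regularization of continuous functions -/

instance : FiniteDimensional ℝ (Cn n) := FiniteDimensional.trans ℝ ℂ (Cn n)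

/-- A smooth bump function supported in the ball of radius `δ`. -/
def bump (n : ℕ) {δ : ℝ} (hδ : 0 < δ) : ContDiffBump (0 : Cn n) where
  rIn := δ / 2
  rOut := δ
  rIn_pos := half_pos hδ
  rIn_lt_rOut := half_lt_self hδ

/-- The mollification of `F` at scale `δ`. -/
def mollify {E : Type*} [NormedAddCommGroup E] [NormedSpace ℝ E] {δ : ℝ} (hδ : 0 < δ)
    (F : Cn n → E) : Cn n → E :=
  MeasureTheory.convolution ((bump n hδ).normed Measure.addHaar) F (ContinuousLinearMap.lsmul ℝ ℝ)
    Measure.addHaar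

section mollify

variable {E : Type*} [NormedAddCommGroup E] [NormedSpace ℝ E]
  {δ : ℝ} (hδ : 0 < δ) {F : Cn n → E}

lemma mollify_apply (F : Cn n → E) (z : Cn n) : mollify hδ F z
    = ∫ y, (bump n hδ).normed Measure.addHaar y • F (z - y) ∂Measure.addHaar := rfl

lemma contDiff_mollify (hF : Continuous F) : ContDiff ℝ ∞ (mollify hδ F) :=
  (bump n hδ).hasCompactSupport_normed.contDiff_convolution_left _ (bump n hδ).contDiff_normed
    hF.locallyIntegrable

lemma dist_mollify_le [CompleteSpace E] (hF : Continuous F) {ε : ℝ} {z : Cn n}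
    (h : ∀ y, dist y z < δ → dist (F y) (F z) ≤ ε) : dist (mollify hδ F z) (F z) ≤ ε :=
  ContDiffBump.dist_normed_convolution_le hF.aestronglyMeasurable fun y hy => h y hy

lemma support_mollify_subset (F : Cn n → E) :
    Function.support (mollify hδ F) ⊆ Metric.cthickening δ (tsupport F) := by
  refine (MeasureTheory.support_convolution_subset _).trans ?_
  rintro z ⟨x, hx, y, hy, rfl⟩
  rw [(bump n hδ).support_normed_eq] at hx
  have hx' : ‖x‖ < δ := by simpa [bump] using hx
  refine Metric.mem_cthickening_of_dist_le _ y _ _ (subset_tsupport F hy) ?_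
  simpa [dist_eq_norm] using hx'.le

end mollify

lemma mollify_nonneg {δ : ℝ} (hδ : 0 < δ) {F : Cn n → ℝ} (hF : ∀ z, 0 ≤ F z) (z : Cn n) :
    0 ≤ mollify hδ F z :=
  integral_nonneg fun y => mul_nonneg ((bump n hδ).nonneg_normed y) (hF _)

/-- `g` is a sequence of test functions with supports in the compact set `K ⊆ Ω` that tends
uniformly to `F`. -/
structure Approx (F : Cn n → ℂ) (g : ℕ → 𝓓(Ω, ℂ)) (K : Set (Cn n)) : Prop where
  isCompact : IsCompact K
  subset : K ⊆ Ω
  tsupport_subset : ∀ i, tsupport (g i) ⊆ K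
  tendsto : TendstoUniformly (fun i z => g i z) F atTop

lemma mollify_ofReal {δ : ℝ} (hδ : 0 < δ) (F : Cn n → ℝ) (z : Cn n) :
    mollify hδ (fun z => (F z : ℂ)) z = ((mollify hδ F z : ℝ) : ℂ) := by
  rw [mollify_apply, mollify_apply]
  refine Eq.trans ?_ integral_complex_ofReal
  simp

lemma exists_approx_subset {F : Cn n → ℂ} (hF : Continuous F) {K L : Set (Cn n)}
    (hK : IsCompact K) (hFK : tsupport F ⊆ K) (hL : IsCompact L) (hLΩ : L ⊆ Ω)
    (hKL : K ⊆ interior L) :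
    ∃ g : ℕ → 𝓓(Ω, ℂ), Approx F g L ∧ ((∀ z, 0 ≤ F z) → ∀ i z, 0 ≤ g i z) := by
  obtain ⟨δ, hδ, hδL⟩ := hK.exists_cthickening_subset_open isOpen_interior hKL
  have hpos : ∀ i : ℕ, 0 < δ / (i + 1) := fun i => by positivity
  have hsupp : ∀ i : ℕ, tsupport (mollify (hpos i) F) ⊆ L := by
    intro i
    refine closure_minimal ?_ hL.isClosed
    refine (support_mollify_subset _ F).trans ?_
    refine (Metric.cthickening_subset_of_subset _ hFK).trans ?_
    refine (Metric.cthickening_mono ?_ _).trans (hδL.trans interior_subset)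
    exact div_le_self hδ.le (by linarith [Nat.cast_nonneg (α := ℝ) i])
  let g : ℕ → 𝓓(Ω, ℂ) := fun i =>
    ⟨mollify (hpos i) F, contDiff_mollify _ hF,
      hL.of_isClosed_subset (isClosed_tsupport _) (hsupp i), (hsupp i).trans hLΩ⟩
  refine ⟨g, ⟨hL, hLΩ, hsupp, ?_⟩, ?_⟩
  · have hFc : HasCompactSupport F := hK.of_isClosed_subset (isClosed_tsupport _) hFK
    have huc := hFc.uniformContinuous_of_continuous hF
    rw [Metric.tendstoUniformly_iff]
    intro ε hε
    obtain ⟨η, hη, h⟩ := Metric.uniformContinuous_iff.1 huc (ε / 2) (half_pos hε)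
    have hlim : Tendsto (fun i : ℕ => δ / ((i : ℝ) + 1)) atTop (𝓝 0) :=
      tendsto_const_div_atTop_nhds_zero_nat δ |>.comp (tendsto_add_atTop_nat 1) |>.congr
        fun i => by simp
    filter_upwards [hlim.eventually_lt_const hη] with i hi z
    rw [dist_comm]
    refine lt_of_le_of_lt (dist_mollify_le (hpos i) hF fun y hy => ?_) (half_lt_self hε)
    exact (h (hy.trans hi)).le
  · intro h0 i z
    have : F = fun z => (((F z).re : ℝ) : ℂ) := by
      funext z
      exact Complex.ext rfl (by simpa using (Complex.nonneg_iff.1 (h0 z)).2.symm)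
    change 0 ≤ mollify (hpos i) F z
    rw [this, mollify_ofReal]
    exact_mod_cast mollify_nonneg (hpos i) (fun z => (Complex.nonneg_iff.1 (h0 z)).1) z

lemma exists_compact_nhds_subset {K : Set (Cn n)} (hK : IsCompact K) (hKΩ : K ⊆ Ω) :
    ∃ L, IsCompact L ∧ K ⊆ interior L ∧ L ⊆ Ω :=
  exists_compact_between hK Ω.isOpen hKΩ

lemma exists_approx {F : Cn n → ℂ} (hF : Continuous F) (hFc : HasCompactSupport F)
    (hFΩ : tsupport F ⊆ Ω) :
    ∃ (g : ℕ → 𝓓(Ω, ℂ)) (K : Set (Cn n)), Approx F g K ∧ ((∀ z, 0 ≤ F z) → ∀ i z, 0 ≤ g i z) := by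
  obtain ⟨L, hL, hKL, hLΩ⟩ := exists_compact_nhds_subset hFc hFΩ
  obtain ⟨g, hg⟩ := exists_approx_subset hF hFc subset_rfl hL hLΩ hKL
  exact ⟨g, L, hg⟩

/-- A test function with values in `[0, 1]` that is one near `K` and has support in the interior
of `L`. -/
lemma exists_cutoff {K L : Set (Cn n)} (hK : IsCompact K) (hL : IsCompact L) (hLΩ : L ⊆ Ω)
    (hKL : K ⊆ interior L) :
    ∃ χ : Cn n → ℝ, ContDiff ℝ ∞ χ ∧ (∀ᶠ z in 𝓝ˢ K, χ z = 1) ∧ (∀ z, 0 ≤ χ z ∧ χ z ≤ 1) ∧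
      tsupport χ ⊆ L ∧ ∃ χ' : 𝓓(Ω, ℂ), ∀ z, χ' z = χ z := by
  obtain ⟨M, hM, hKM, hML⟩ := exists_compact_between hK isOpen_interior hKL
  have hd : Disjoint (interior L)ᶜ M := by
    rw [Set.disjoint_compl_left_iff_subset]
    exact hML
  obtain ⟨χ, h1, h2, h3⟩ := exists_contMDiffMap_zero_one_of_isClosed (n := (⊤ : ℕ∞))
    (modelWithCornersSelf ℝ (Cn n)) isOpen_interior.isClosed_compl hM.isClosed hd
  have hs : tsupport χ ⊆ L := by
    refine closure_minimal (fun z hz => ?_) hL.isClosed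
    by_contra h
    exact hz (h1 fun h' => h (interior_subset h'))
  have hχ : ContDiff ℝ ∞ χ := χ.contMDiff.contDiff
  refine ⟨χ, hχ, ?_, fun z => h3 z, hs,
    ⟨⟨fun z => χ z, contDiff_ofReal hχ, ?_, ?_⟩, fun z => rfl⟩⟩
  · exact Filter.mem_of_superset (isOpen_interior.mem_nhdsSet.2 hKM) fun z hz =>
      h2 (interior_subset hz)
  · have : tsupport (fun z => (χ z : ℂ)) ⊆ tsupport χ := closure_mono fun z hz => by
      simpa using hz
    exact hL.of_isClosed_subset (isClosed_tsupport _) (this.trans hs)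
  · have : tsupport (fun z => (χ z : ℂ)) ⊆ tsupport χ := closure_mono fun z hz => by
      simpa using hz
    exact (this.trans hs).trans hLΩ

/-! ### Currents of order zero and their extension to continuous functions -/

/-- The functionals `A i` are bounded on the test functions supported in `K`, with respect to the
supremum norm, uniformly in `i`. -/
def UniformlyBoundedOn {ι : Type*} (A : ι → FormFunctional Ω) (K : Set (Cn n)) : Prop :=
  ∀ l : Module.Dual ℂ (ConstForm n), ∃ C : ℝ, ∀ (i : ι) (f : 𝓓(Ω, ℂ)), tsupport f ⊆ K →
    ∀ M : ℝ, (∀ z, ‖f z‖ ≤ M) → ‖l (A i f)‖ ≤ C * M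

/-- `T` is of order zero. -/
def HasOrderZero (T : FormFunctional Ω) : Prop :=
  ∀ K : Set (Cn n), IsCompact K → K ⊆ Ω → UniformlyBoundedOn (fun _ : Unit => T) K

/-- `F` is continuous with compact support in `Ω`. -/
structure IsCc (Ω : Opens (Cn n)) (F : Cn n → ℂ) : Prop where
  continuous : Continuous F
  hasCompactSupport : HasCompactSupport F
  tsupport_subset : tsupport F ⊆ Ω

/-- `y` is the value at `F` of the extension of `T` to continuous functions. -/
def IsExtValue (T : FormFunctional Ω) (F : Cn n → ℂ) (y : ConstForm n) : Prop :=
  ∀ (g : ℕ → 𝓓(Ω, ℂ)) (K : Set (Cn n)), Approx F g K →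
    ∀ l : Module.Dual ℂ (ConstForm n), Tendsto (fun i => l (T (g i))) atTop (𝓝 (l y))

open Classical in
/-- The extension of a current of order zero to continuous functions with compact support. -/
def extend (T : FormFunctional Ω) (F : Cn n → ℂ) : ConstForm n :=
  if h : ∃ y, IsExtValue T F y then h.choose else 0

lemma eq_of_forall_dual {x y : ConstForm n} (h : ∀ l : Module.Dual ℂ (ConstForm n), l x = l y) :
    x = y := by
  rw [← sub_eq_zero, ← Module.forall_dual_apply_eq_zero_iff ℂ]
  intro l
  rw [map_sub, h, sub_self]

lemma IsCc.exists_approx {F : Cn n → ℂ} (hF : IsCc Ω F) :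
    ∃ (g : ℕ → 𝓓(Ω, ℂ)) (K : Set (Cn n)), Approx F g K ∧ ((∀ z, 0 ≤ F z) → ∀ i z, 0 ≤ g i z) :=
  Pluri.exists_approx hF.continuous hF.hasCompactSupport hF.tsupport_subset

lemma isCc_test (f : 𝓓(Ω, ℂ)) : IsCc Ω f := ⟨f.continuous, f.hasCompactSupport, f.tsupport_subset⟩

lemma IsCc.add {F G : Cn n → ℂ} (hF : IsCc Ω F) (hG : IsCc Ω G) : IsCc Ω (fun z => F z + G z) :=
  ⟨hF.continuous.add hG.continuous, hF.hasCompactSupport.add hG.hasCompactSupport,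
    (tsupport_add F G).trans (union_subset hF.tsupport_subset hG.tsupport_subset)⟩

lemma IsCc.const_mul {F : Cn n → ℂ} (hF : IsCc Ω F) (c : ℂ) : IsCc Ω (fun z => c * F z) :=
  ⟨continuous_const.mul hF.continuous, hF.hasCompactSupport.mul_left,
    (tsupport_mul_subset_right (f := fun _ => c) (g := F)).trans hF.tsupport_subset⟩

/-- The product of a function that is continuous on `Ω` and a continuous function with compact
support in `Ω`. -/
lemma IsCc.mul_left {F : Cn n → ℂ} (hF : IsCc Ω F) {w : Cn n → ℝ} (hw : ContinuousOn w Ω) :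
    IsCc Ω (fun z => (w z : ℂ) * F z) := by
  refine ⟨?_, hF.hasCompactSupport.mul_left,
    (tsupport_mul_subset_right (f := fun z => (w z : ℂ)) (g := F)).trans hF.tsupport_subset⟩
  rw [continuous_iff_continuousAt]
  intro z
  by_cases hz : z ∈ Ω
  · exact (Complex.continuous_ofReal.continuousAt.comp
      (hw.continuousAt (Ω.isOpen.mem_nhds hz))).mul hF.continuous.continuousAt
  · have h0 : (fun z => (w z : ℂ) * F z) =ᶠ[𝓝 z] fun _ => 0 := by
      filter_upwards [(isClosed_tsupport F).isOpen_compl.mem_nhds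
        fun h => hz (hF.tsupport_subset h)] with y hy
      rw [image_eq_zero_of_notMem_tsupport hy, mul_zero]
    exact continuousAt_const.congr h0.symm

lemma Approx.const (f : 𝓓(Ω, ℂ)) : Approx f (fun _ => f) (tsupport f) where
  isCompact := f.hasCompactSupport
  subset := f.tsupport_subset
  tsupport_subset _ := subset_rfl
  tendsto := by
    rw [Metric.tendstoUniformly_iff]
    intro ε hε
    simp [hε]

lemma Approx.add {F G : Cn n → ℂ} {f g : ℕ → 𝓓(Ω, ℂ)} {K L : Set (Cn n)} (hf : Approx F f K)
    (hg : Approx G g L) : Approx (fun z => F z + G z) (fun i => f i + g i) (K ∪ L) where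
  isCompact := hf.isCompact.union hg.isCompact
  subset := union_subset hf.subset hg.subset
  tsupport_subset i := (tsupport_add (f i) (g i)).trans
    (union_subset_union (hf.tsupport_subset i) (hg.tsupport_subset i))
  tendsto := hf.tendsto.add hg.tendsto

lemma Approx.const_smul {F : Cn n → ℂ} {f : ℕ → 𝓓(Ω, ℂ)} {K : Set (Cn n)} (hf : Approx F f K)
    (c : ℂ) : Approx (fun z => c * F z) (fun i => c • f i) K where
  isCompact := hf.isCompact
  subset := hf.subset
  tsupport_subset i := (tsupport_smul_subset_right (fun _ => c) (f i)).trans (hf.tsupport_subset i)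
  tendsto := (uniformContinuous_const_smul c).comp_tendstoUniformly hf.tendsto

lemma IsExtValue.unique {T : FormFunctional Ω} {F : Cn n → ℂ} (hF : IsCc Ω F) {x y : ConstForm n}
    (hx : IsExtValue T F x) (hy : IsExtValue T F y) : x = y := by
  obtain ⟨g, K, hg, -⟩ := hF.exists_approx
  exact eq_of_forall_dual fun l => tendsto_nhds_unique (hx g K hg l) (hy g K hg l)

lemma exists_of_forall_tendsto {x : ℕ → ConstForm n}
    (h : ∀ l : Module.Dual ℂ (ConstForm n), ∃ c, Tendsto (fun i => l (x i)) atTop (𝓝 c)) :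
    ∃ y, ∀ l : Module.Dual ℂ (ConstForm n), Tendsto (fun i => l (x i)) atTop (𝓝 (l y)) := by
  set b := (formBasis n).ExteriorAlgebra
  choose c hc using fun s => h (b.coord s)
  refine ⟨∑ s, c s • b s, fun l => ?_⟩
  have h1 : ∀ z, l z = ∑ s, b.coord s z * l (b s) := by
    intro z
    conv_lhs => rw [← b.sum_repr z, map_sum]
    exact Finset.sum_congr rfl fun s _ => by rw [map_smul, smul_eq_mul]; rfl
  have h2 : l (∑ s, c s • b s) = ∑ s, c s * l (b s) := by simp
  rw [h2]
  simp only [funext fun i => h1 (x i)]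
  exact tendsto_finsetSum _ fun s _ => (hc s).mul_const _

lemma Approx.norm_sub_le {F : Cn n → ℂ} {g : ℕ → 𝓓(Ω, ℂ)} {K : Set (Cn n)} (hg : Approx F g K)
    {ε : ℝ} (hε : 0 < ε) : ∃ N, ∀ i ≥ N, ∀ z, ‖F z - g i z‖ ≤ ε := by
  obtain ⟨N, hN⟩ := eventually_atTop.1 (Metric.tendstoUniformly_iff.1 hg.tendsto ε hε)
  exact ⟨N, fun i hi z => by simpa [dist_eq_norm] using (hN i hi z).le⟩

/-- A current of order zero extends to continuous functions with compact support. -/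
lemma HasOrderZero.exists_isExtValue {T : FormFunctional Ω} (hT : HasOrderZero T) {F : Cn n → ℂ}
    (hF : IsCc Ω F) : ∃ y, IsExtValue T F y := by
  obtain ⟨g, K, hg, -⟩ := hF.exists_approx
  have key : ∀ (f : ℕ → 𝓓(Ω, ℂ)) (L : Set (Cn n)), Approx F f L →
      ∀ l : Module.Dual ℂ (ConstForm n), ∀ ε > 0, ∃ N, ∀ i ≥ N, ∀ j ≥ N,
        ‖l (T (g i)) - l (T (f j))‖ ≤ ε := by
    intro f L hf l ε hε
    obtain ⟨C, hC⟩ := hT (K ∪ L) (hg.isCompact.union hf.isCompact)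
      (union_subset hg.subset hf.subset) l
    obtain ⟨N, hN⟩ := hg.norm_sub_le (ε := ε / (2 * (|C| + 1))) (by positivity)
    obtain ⟨N', hN'⟩ := hf.norm_sub_le (ε := ε / (2 * (|C| + 1))) (by positivity)
    refine ⟨max N N', fun i hi j hj => ?_⟩
    have h1 : tsupport (g i - f j : 𝓓(Ω, ℂ)) ⊆ K ∪ L := (tsupport_sub (g i) (f j)).trans
      (union_subset_union (hg.tsupport_subset i) (hf.tsupport_subset j))
    have h2 : ∀ z, ‖(g i - f j : 𝓓(Ω, ℂ)) z‖ ≤ ε / (|C| + 1) := by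
      intro z
      have e : (g i - f j : 𝓓(Ω, ℂ)) z = (F z - f j z) - (F z - g i z) := by
        rw [FunLike.coe_sub, Pi.sub_apply]; ring
      rw [e]
      refine (norm_sub_le _ _).trans ((add_le_add (hN' j (le_of_max_le_right hj) z)
        (hN i (le_of_max_le_left hi) z)).trans_eq ?_)
      field_simp
      norm_num
    have h3 := hC () _ h1 _ h2
    rw [map_sub, map_sub] at h3
    refine h3.trans ?_
    rw [mul_div_assoc', div_le_iff₀ (by positivity)]
    nlinarith [le_abs_self C]
  obtain ⟨y, hy⟩ := exists_of_forall_tendsto (x := fun i => T (g i)) fun l => by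
    refine cauchySeq_tendsto_of_complete (Metric.cauchySeq_iff.2 fun ε hε => ?_)
    obtain ⟨N, hN⟩ := key g K hg l (ε / 2) (half_pos hε)
    exact ⟨N, fun i hi j hj => by
      rw [dist_eq_norm]; exact (hN i hi j hj).trans_lt (half_lt_self hε)⟩
  refine ⟨y, fun f L hf l => ?_⟩
  have h0 : Tendsto (fun i => l (T (f i)) - l (T (g i))) atTop (𝓝 0) := by
    rw [Metric.tendsto_atTop]
    intro ε hε
    obtain ⟨N, hN⟩ := key f L hf l (ε / 2) (half_pos hε)
    exact ⟨N, fun i hi => by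
      rw [dist_eq_norm, sub_zero, norm_sub_rev]
      exact (hN i hi i hi).trans_lt (half_lt_self hε)⟩
  simpa using h0.add (hy l)

lemma HasOrderZero.extend_spec {T : FormFunctional Ω} (hT : HasOrderZero T) {F : Cn n → ℂ}
    (hF : IsCc Ω F) : IsExtValue T F (extend T F) := by
  have h := hT.exists_isExtValue hF
  rw [extend, dif_pos h]
  exact h.choose_spec

lemma IsExtValue.eq_extend {T : FormFunctional Ω} (hT : HasOrderZero T) {F : Cn n → ℂ}
    (hF : IsCc Ω F) {y : ConstForm n} (hy : IsExtValue T F y) : extend T F = y :=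
  (hT.extend_spec hF).unique hF hy

lemma HasOrderZero.extend_test {T : FormFunctional Ω} (hT : HasOrderZero T) (f : 𝓓(Ω, ℂ)) :
    extend T f = T f :=
  eq_of_forall_dual fun l => tendsto_nhds_unique
    (hT.extend_spec (isCc_test f) _ _ (Approx.const f) l) tendsto_const_nhds

lemma HasOrderZero.extend_add {T : FormFunctional Ω} (hT : HasOrderZero T) {F G : Cn n → ℂ}
    (hF : IsCc Ω F) (hG : IsCc Ω G) :
    extend T (fun z => F z + G z) = extend T F + extend T G := by
  obtain ⟨f, K, hf, -⟩ := hF.exists_approx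
  obtain ⟨g, L, hg, -⟩ := hG.exists_approx
  refine eq_of_forall_dual fun l => tendsto_nhds_unique
    (hT.extend_spec (hF.add hG) _ _ (hf.add hg) l) ?_
  simp_rw [map_add]
  exact (hT.extend_spec hF _ _ hf l).add (hT.extend_spec hG _ _ hg l)

lemma HasOrderZero.extend_const_mul {T : FormFunctional Ω} (hT : HasOrderZero T) {F : Cn n → ℂ}
    (hF : IsCc Ω F) (c : ℂ) : extend T (fun z => c * F z) = c • extend T F := by
  obtain ⟨f, K, hf, -⟩ := hF.exists_approx
  refine eq_of_forall_dual fun l => tendsto_nhds_unique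
    (hT.extend_spec (hF.const_mul c) _ _ (hf.const_smul c) l) ?_
  simp_rw [map_smul]
  exact (hT.extend_spec hF _ _ hf l).const_smul c

lemma HasOrderZero.extend_mem {T : FormFunctional Ω} (hT : HasOrderZero T) {F : Cn n → ℂ}
    (hF : IsCc Ω F) {W : Submodule ℂ (ConstForm n)} (hW : ∀ f, T f ∈ W) : extend T F ∈ W := by
  obtain ⟨f, K, hf, -⟩ := hF.exists_approx
  by_contra h
  obtain ⟨l, hl, hlW⟩ := Submodule.exists_le_ker_of_notMem h
  refine hl (tendsto_nhds_unique (hT.extend_spec hF _ _ hf l) ?_)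
  have : ∀ i, l (T (f i)) = 0 := fun i => hlW (hW (f i))
  simp [this]

/-- The product of a current of order zero and a function continuous on `Ω`, defined by the
extension of the current. -/
def product {w : Cn n → ℝ} (hw : ContinuousOn w Ω) {T : FormFunctional Ω} (hT : HasOrderZero T) :
    FormFunctional Ω where
  toFun f := extend T fun z => (w z : ℂ) * f z
  map_add' f g := by
    rw [← hT.extend_add ((isCc_test f).mul_left hw) ((isCc_test g).mul_left hw)]
    congr 1
    ext z
    rw [FunLike.coe_add, Pi.add_apply, mul_add]
  map_smul' c f := by
    rw [RingHom.id_apply, ← hT.extend_const_mul ((isCc_test f).mul_left hw)]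
    congr 1
    ext z
    rw [FunLike.coe_smul, Pi.smul_apply, smul_eq_mul]
    ring

lemma isProductWith_iff {w : Cn n → ℝ} {T S : FormFunctional Ω} :
    IsProductWith w T S ↔ ∀ f : 𝓓(Ω, ℂ), IsExtValue T (fun z => (w z : ℂ) * f z) (S f) :=
  ⟨fun h f g K hg l => h f g K hg.isCompact hg.subset hg.tsupport_subset hg.tendsto l,
    fun h f g K h1 h2 h3 h4 l => h f g K ⟨h1, h2, h3, h4⟩ l⟩

lemma isProductWith_product {w : Cn n → ℝ} (hw : ContinuousOn w Ω) {T : FormFunctional Ω}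
    (hT : HasOrderZero T) : IsProductWith w T (product hw hT) :=
  isProductWith_iff.2 fun f => hT.extend_spec ((isCc_test f).mul_left hw)

lemma IsProductWith.unique {w : Cn n → ℝ} (hw : ContinuousOn w Ω) {T S S' : FormFunctional Ω}
    (h : IsProductWith w T S) (h' : IsProductWith w T S') : S = S' :=
  LinearMap.ext fun f => (isProductWith_iff.1 h f).unique ((isCc_test f).mul_left hw)
    (isProductWith_iff.1 h' f)

/-- If uniformly bounded functionals `A i` tend weakly to `R`, then `A i (g i)` tends to the value
of `R` at the uniform limit of the `g i`. -/
lemma tendsto_of_uniformlyBoundedOn {A : ℕ → FormFunctional Ω} {R : FormFunctional Ω}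
    {K : Set (Cn n)} (hA : UniformlyBoundedOn A K)
    (hAR : ∀ f : 𝓓(Ω, ℂ), tsupport f ⊆ K → ∀ l : Module.Dual ℂ (ConstForm n),
      Tendsto (fun i => l (A i f)) atTop (𝓝 (l (R f))))
    {F : Cn n → ℂ} {y : ConstForm n} (hy : IsExtValue R F y) {g : ℕ → 𝓓(Ω, ℂ)} (hg : Approx F g K)
    (l : Module.Dual ℂ (ConstForm n)) : Tendsto (fun i => l (A i (g i))) atTop (𝓝 (l y)) := by
  obtain ⟨C, hC⟩ := hA l
  rw [Metric.tendsto_atTop]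
  intro ε hε
  obtain ⟨N, hN⟩ := hg.norm_sub_le (ε := ε / (8 * (|C| + 1))) (by positivity)
  obtain ⟨N', hN'⟩ := Metric.tendsto_atTop.1 (hy g K hg l) (ε / 4) (by positivity)
  set j := max N N'
  obtain ⟨N'', hN''⟩ := Metric.tendsto_atTop.1 (hAR (g j) (hg.tsupport_subset j) l) (ε / 4)
    (by positivity)
  refine ⟨max N N'', fun i hi => ?_⟩
  have h1 : tsupport (g i - g j : 𝓓(Ω, ℂ)) ⊆ K := (tsupport_sub (g i) (g j)).trans
    (union_subset (hg.tsupport_subset i) (hg.tsupport_subset j))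
  have h2 : ∀ z, ‖(g i - g j : 𝓓(Ω, ℂ)) z‖ ≤ ε / (4 * (|C| + 1)) := by
    intro z
    have e : (g i - g j : 𝓓(Ω, ℂ)) z = (F z - g j z) - (F z - g i z) := by
      rw [FunLike.coe_sub, Pi.sub_apply]; ring
    rw [e]
    refine (norm_sub_le _ _).trans ((add_le_add (hN j (le_max_left _ _) z)
      (hN i (le_of_max_le_left hi) z)).trans_eq ?_)
    field_simp
    norm_num
  have h3 : dist (l (A i (g i))) (l (A i (g j))) ≤ ε / 4 := by
    have := hC i _ h1 _ h2
    rw [map_sub, map_sub] at this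
    rw [dist_eq_norm]
    refine this.trans ?_
    rw [mul_div_assoc', div_le_iff₀ (by positivity)]
    nlinarith [le_abs_self C]
  have h4 := hN'' i (le_of_max_le_right hi)
  have h5 := hN' j (le_max_right _ _)
  have h6 := dist_triangle4 (l (A i (g i))) (l (A i (g j))) (l (R (g j))) (l y)
  linarith

/-! ### Positive currents have order zero -/

/-- `T` is weakly positive on test functions supported in `L`: its products with strongly positive
forms of bidegree `(n - p, n - p)` are positive. -/
def IsPositiveOn (p : ℕ) (L : Set (Cn n)) (T : FormFunctional Ω) : Prop :=
  ∀ q, p + q = n → ∀ (a : Fin q → Fin n → ℂ) (f : 𝓓(Ω, ℂ)), tsupport f ⊆ L → (∀ z, 0 ≤ f z) →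
    0 ≤ berezin n (T f * posProd a)

/-- The real part of a test function. -/
def reTest (f : 𝓓(Ω, ℂ)) : 𝓓(Ω, ℂ) :=
  TestFunction.postcompCLM (Complex.ofRealCLM ∘L Complex.reCLM) f

lemma reTest_apply (f : 𝓓(Ω, ℂ)) (z : Cn n) : reTest f z = ((f z).re : ℂ) := rfl

lemma tsupport_reTest_subset (f : 𝓓(Ω, ℂ)) : tsupport (reTest f) ⊆ tsupport f := by
  refine closure_mono fun z hz => ?_
  intro h
  apply hz
  rw [reTest_apply, h, Complex.zero_re, Complex.ofReal_zero]

lemma norm_le_of_nonneg {x y : ℂ} (h1 : 0 ≤ y - x) (h2 : 0 ≤ y + x) : ‖x‖ ≤ ‖y‖ := by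
  obtain ⟨h1, h1'⟩ := Complex.nonneg_iff.1 h1
  obtain ⟨h2, h2'⟩ := Complex.nonneg_iff.1 h2
  simp only [Complex.sub_re, Complex.sub_im, Complex.add_re, Complex.add_im] at h1 h1' h2 h2'
  have hx : x = (x.re : ℂ) := Complex.ext rfl (by simp; linarith)
  calc ‖x‖ = |x.re| := by rw [hx]; simp
    _ ≤ |y.re| := (abs_le.2 ⟨by linarith, by linarith⟩).trans (le_abs_self _)
    _ ≤ ‖y‖ := Complex.abs_re_le_norm y

/-- Positive currents whose masses on a cutoff function are bounded are uniformly bounded. For `f`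
real with `|f| ≤ M` on `K`, the functions `M χ ± f` are nonnegative. -/
lemma uniformlyBoundedOn_of_isPositiveOn {ι : Type*} {p q : ℕ} (hpq : p + q = n)
    {A : ι → FormFunctional Ω} {K L : Set (Cn n)} (hA : ∀ i f, A i f ∈ bideg n p p)
    (hpos : ∀ i, IsPositiveOn p L (A i)) {χ : 𝓓(Ω, ℂ)} (hχ0 : ∀ z, 0 ≤ χ z)
    (hχ1 : ∀ z ∈ K, χ z = 1) (hχL : tsupport χ ⊆ L) (hKL : K ⊆ L)
    (hb : ∀ a : Fin q → Fin n → ℂ, ∃ C, ∀ i, ‖berezin n (A i χ * posProd a)‖ ≤ C) :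
    UniformlyBoundedOn A K := by
  have hreal : ∀ (i : ι) (a : Fin q → Fin n → ℂ) (f : 𝓓(Ω, ℂ)) (M : ℝ), tsupport f ⊆ K →
      (∀ z, ‖f z‖ ≤ M) → ‖berezin n (A i (reTest f) * posProd a)‖
        ≤ M * ‖berezin n (A i χ * posProd a)‖ := by
    intro i a f M hf hM
    have hM0 : 0 ≤ M := (norm_nonneg _).trans (hM 0)
    have hle : ∀ z, |(f z).re| ≤ M * (χ z).re := by
      intro z
      by_cases hz : z ∈ K
      · rw [hχ1 z hz, Complex.one_re, mul_one]
        exact (Complex.abs_re_le_norm _).trans (hM z)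
      · rw [image_eq_zero_of_notMem_tsupport fun h => hz (hf h), Complex.zero_re, abs_zero]
        exact mul_nonneg hM0 (Complex.nonneg_iff.1 (hχ0 z)).1
    have hχre : ∀ z, χ z = ((χ z).re : ℂ) := fun z =>
      Complex.ext rfl (by simpa using (Complex.nonneg_iff.1 (hχ0 z)).2.symm)
    have hs : ∀ c : ℂ, tsupport ((M : ℂ) • χ + c • reTest f : 𝓓(Ω, ℂ)) ⊆ L := by
      intro c
      refine (tsupport_add _ _).trans (union_subset ?_ ?_)
      · exact (tsupport_smul_subset_right (fun _ => (M : ℂ)) χ).trans hχL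
      · exact (tsupport_smul_subset_right (fun _ => c) (reTest f)).trans
          ((tsupport_reTest_subset f).trans (hf.trans hKL))
    have h1 := hpos i q hpq a _ (hs (-1)) fun z => by
      have : ((M : ℂ) • χ + (-1 : ℂ) • reTest f : 𝓓(Ω, ℂ)) z
          = ((M * (χ z).re - (f z).re : ℝ) : ℂ) := by
        rw [FunLike.coe_add, Pi.add_apply, FunLike.coe_smul, FunLike.coe_smul, Pi.smul_apply,
          Pi.smul_apply, reTest_apply, hχre]
        push_cast
        simp [sub_eq_add_neg]
      rw [this]
      exact_mod_cast sub_nonneg.2 ((le_abs_self _).trans (hle z))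
    have h2 := hpos i q hpq a _ (hs 1) fun z => by
      have : ((M : ℂ) • χ + (1 : ℂ) • reTest f : 𝓓(Ω, ℂ)) z
          = ((M * (χ z).re + (f z).re : ℝ) : ℂ) := by
        rw [FunLike.coe_add, Pi.add_apply, FunLike.coe_smul, FunLike.coe_smul, Pi.smul_apply,
          Pi.smul_apply, reTest_apply, hχre]
        push_cast
        simp
      rw [this]
      have := (neg_le_abs _).trans (hle z)
      exact_mod_cast (by linarith)
    simp only [map_add, map_smul, add_mul, smul_mul_assoc, smul_eq_mul, neg_mul,
      one_mul, ← sub_eq_add_neg] at h1 h2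
    refine (norm_le_of_nonneg h1 h2).trans ?_
    rw [norm_mul, Complex.norm_real, Real.norm_of_nonneg hM0]
  intro l
  obtain ⟨l', hl', hll⟩ := exists_eq_on_bideg hpq l
  suffices h : ∃ C : ℝ, ∀ (i : ι) (f : 𝓓(Ω, ℂ)), tsupport f ⊆ K →
      ∀ M : ℝ, (∀ z, ‖f z‖ ≤ M) → ‖l' (A i f)‖ ≤ C * M by
    obtain ⟨C, hC⟩ := h
    exact ⟨C, fun i f hf M hM => by rw [hll _ (hA i f)]; exact hC i f hf M hM⟩
  clear hll
  induction hl' using Submodule.span_induction with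
  | mem l hl =>
    obtain ⟨a, rfl⟩ := hl
    obtain ⟨C, hC⟩ := hb a
    refine ⟨2 * C, fun i f hf M hM => ?_⟩
    have hM0 : 0 ≤ M := (norm_nonneg _).trans (hM 0)
    have hdec : f = reTest f + Complex.I • reTest ((-Complex.I) • f) := by
      ext z
      rw [FunLike.coe_add, Pi.add_apply, FunLike.coe_smul, Pi.smul_apply, reTest_apply,
        reTest_apply, FunLike.coe_smul, Pi.smul_apply]
      apply Complex.ext <;> simp
    have h1 := hreal i a f M hf hM
    have h2 := hreal i a ((-Complex.I) • f) M
      ((tsupport_smul_subset_right (fun _ => -Complex.I) f).trans hf) (fun z => by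
        rw [FunLike.coe_smul, Pi.smul_apply, norm_smul]
        simpa using hM z)
    change ‖berezin n (A i f * posProd a)‖ ≤ _
    conv_lhs => rw [hdec]
    rw [map_add, map_smul, add_mul, smul_mul_assoc, map_add, map_smul]
    refine (norm_add_le _ _).trans ?_
    rw [norm_smul, Complex.norm_I, one_mul]
    have := mul_le_mul_of_nonneg_left (hC i) hM0
    linarith
  | zero => exact ⟨0, fun i f _ M _ => by simp⟩
  | add l₁ l₂ _ _ h₁ h₂ =>
    obtain ⟨C₁, h₁⟩ := h₁
    obtain ⟨C₂, h₂⟩ := h₂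
    refine ⟨C₁ + C₂, fun i f hf M hM => ?_⟩
    rw [LinearMap.add_apply, add_mul]
    exact (norm_add_le _ _).trans (add_le_add (h₁ i f hf M hM) (h₂ i f hf M hM))
  | smul c l _ h =>
    obtain ⟨C, h⟩ := h
    refine ⟨‖c‖ * C, fun i f hf M hM => ?_⟩
    rw [LinearMap.smul_apply, norm_smul, mul_assoc]
    exact mul_le_mul_of_nonneg_left (h i f hf M hM) (norm_nonneg c)

/-- Closed currents of bidegree `(p, p)`. -/
structure IsClosedPure (p : ℕ) (T : FormFunctional Ω) : Prop where
  mem_bideg : ∀ f, T f ∈ bideg n p p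
  isClosed : IsClosedForm T

/-- Closed (weakly) positive currents of bidegree `(p, p)`. Continuity on test functions is not
required: positivity makes them of order zero. -/
structure IsPositiveClosed (p : ℕ) (T : FormFunctional Ω) : Prop extends IsClosedPure p T where
  isPositive : IsPositiveOn p univ T

lemma IsPositiveClosed.hasOrderZero {p q : ℕ} (hpq : p + q = n) {T : FormFunctional Ω}
    (hT : IsPositiveClosed p T) : HasOrderZero T := by
  intro K hK hKΩ
  obtain ⟨L, hL, hKL, hLΩ⟩ := exists_compact_nhds_subset hK hKΩ
  obtain ⟨χ, -, h1, h2, -, χ', hχ'⟩ := exists_cutoff hK hL hLΩ hKL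
  refine uniformlyBoundedOn_of_isPositiveOn hpq (fun _ => hT.mem_bideg) (fun _ => hT.isPositive)
    (χ := χ') (fun z => ?_) (fun z hz => ?_) (subset_univ _) (subset_univ _)
    fun a => ⟨_, fun _ => le_rfl⟩
  · rw [hχ']
    exact_mod_cast (h2 z).1
  · rw [hχ', h1.self_of_nhdsSet z hz, Complex.ofReal_one]

/-! ### Integration by parts against closed currents -/

/-- For reasons of bidegree `∂T = 0` and `∂̄T = 0` if `dT = 0`. -/
lemma IsClosedPure.sum_dz_mul {p : ℕ} {T : FormFunctional Ω} (hT : IsClosedPure p T)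
    (f : 𝓓(Ω, ℂ)) : ∑ j, dz j * T (dPartial j f) = 0 ∧ ∑ j, dzbar j * T (dbarPartial j f) = 0 := by
  have h := hT.isClosed f
  rw [neg_eq_zero, Finset.sum_add_distrib] at h
  exact eq_zero_of_add_eq_zero
    ((bideg n (p + 1) p).sum_mem fun j _ =>
      mul_mem_bideg (dz_mem_bideg j) (hT.mem_bideg _) (add_comm _ _) (zero_add _))
    ((bideg n p (p + 1)).sum_mem fun j _ =>
      mul_mem_bideg (dzbar_mem_bideg j) (hT.mem_bideg _) (zero_add _) (add_comm _ _)) h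

/-- Currents `∂(∑ h_k dz̄_k) ∧ T` have total mass zero. -/
lemma IsClosedPure.sum_dPartial {p : ℕ} {T : FormFunctional Ω} (hT : IsClosedPure p T)
    (h : Fin n → 𝓓(Ω, ℂ)) : ∑ j, ∑ k, dz j * dzbar k * T (dPartial j (h k)) = 0 := by
  rw [Finset.sum_comm]
  refine Finset.sum_eq_zero fun k _ => ?_
  have : ∀ j, dz j * dzbar k * T (dPartial j (h k))
      = -(dzbar k * (dz j * T (dPartial j (h k)))) := by
    intro j
    rw [dz_mul_dzbar, neg_mul, mul_assoc]
  simp_rw [this]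
  rw [Finset.sum_neg_distrib, ← Finset.mul_sum, (hT.sum_dz_mul (h k)).1, mul_zero, neg_zero]

lemma IsClosedPure.sum_dbarPartial {p : ℕ} {T : FormFunctional Ω} (hT : IsClosedPure p T)
    (h : Fin n → 𝓓(Ω, ℂ)) : ∑ j, ∑ k, dz j * dzbar k * T (dbarPartial k (h j)) = 0 := by
  refine Finset.sum_eq_zero fun j _ => ?_
  simp_rw [mul_assoc]
  rw [← Finset.mul_sum, (hT.sum_dz_mul (h j)).2, mul_zero]

/-- The second derivative `∂²w/∂z_j∂z̄_k`. -/
def hess (w : Cn n → ℂ) (j k : Fin n) : Cn n → ℂ := wirt (-Complex.I) j (wirt Complex.I k w)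

lemma contDiff_hess {w : Cn n → ℂ} (hw : ContDiff ℝ ∞ w) (j k : Fin n) :
    ContDiff ℝ ∞ (hess w j k) :=
  contDiff_wirt _ _ (contDiff_wirt _ _ hw)

/-- The current `i∂∂̄w ∧ T` for a smooth function `w`. -/
def lev (w : Cn n → ℂ) (hw : ContDiff ℝ ∞ w) (T : FormFunctional Ω) : FormFunctional Ω where
  toFun f := ∑ j, ∑ k, Complex.I • (dz j * dzbar k *
    T (mulTest (hess w j k) (contDiff_hess hw j k) f))
  map_add' f g := by
    simp only [mulTest_add, map_add, mul_add, smul_add, Finset.sum_add_distrib]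
  map_smul' c f := by
    simp only [mulTest_smul, map_smul, mul_smul_comm, Finset.smul_sum, RingHom.id_apply,
      smul_comm c]

lemma lev_apply (w : Cn n → ℂ) (hw : ContDiff ℝ ∞ w) (T : FormFunctional Ω) (f : 𝓓(Ω, ℂ)) :
    lev w hw T f = ∑ j, ∑ k, Complex.I • (dz j * dzbar k *
    T (mulTest (hess w j k) (contDiff_hess hw j k) f)) := rfl

/-- For a closed current `T`, `i∂∂̄(wT) = i∂∂̄w ∧ T`. -/
lemma IsClosedPure.lev_eq {p : ℕ} {T : FormFunctional Ω} (hT : IsClosedPure p T)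
    (w : Cn n → ℂ) (hw : ContDiff ℝ ∞ w) (f : 𝓓(Ω, ℂ)) :
    lev w hw T f = ∑ j, ∑ k, Complex.I • (dz j * dzbar k *
      T (mulTest w hw (dPartial j (dbarPartial k f)))) := by
  have key : ∀ j k : Fin n, mulTest w hw (dPartial j (dbarPartial k f))
      = mulTest (hess w j k) (contDiff_hess hw j k) f
        + dPartial j (mulTest w hw (dbarPartial k f))
        - dbarPartial k (mulTest (wirt (-Complex.I) j w) (contDiff_wirt _ _ hw) f) := by
    intro j k
    rw [dPartial_mulTest, dbarPartial_mulTest]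
    ext z
    simp only [FunLike.coe_sub, FunLike.coe_add, Pi.sub_apply, Pi.add_apply, mulTest_apply]
    rw [hess, wirt_comm _ _ _ _ hw]
    ring
  simp_rw [key, map_sub, map_add, mul_sub, mul_add, smul_sub, smul_add, Finset.sum_sub_distrib,
    Finset.sum_add_distrib]
  have h1 := hT.sum_dPartial fun k => mulTest w hw (dbarPartial k f)
  have h2 := hT.sum_dbarPartial fun j =>
    mulTest (wirt (-Complex.I) j w) (contDiff_wirt _ _ hw) f
  simp_rw [← Finset.smul_sum]
  rw [h1, h2, smul_zero, add_zero, sub_zero, lev_apply]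
  simp_rw [← Finset.smul_sum]

/-! ### Positivity of `i∂∂̄w ∧ T` for smooth plurisubharmonic functions -/

/-- The complex Hessian of a real function. -/
def levi (w : Cn n → ℝ) (z : Cn n) : Matrix (Fin n) (Fin n) ℂ :=
  Matrix.of fun j k => hess (fun z => (w z : ℂ)) j k z

open scoped MatrixOrder in
lemma _root_.Matrix.PosSemidef.exists_eq_conjTranspose_mul_self {H : Matrix (Fin n) (Fin n) ℂ}
    (hH : H.PosSemidef) : ∃ B : Matrix (Fin n) (Fin n) ℂ, H = B.conjTranspose * B := by
  refine ⟨CFC.sqrt H, ?_⟩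
  rw [(Matrix.nonneg_iff_posSemidef.1 (CFC.sqrt_nonneg H)).isHermitian.eq,
    CFC.sqrt_mul_sqrt_self H hH.nonneg]

/-- A positive semidefinite matrix defines a sum of forms `i α ∧ ᾱ`. -/
lemma exists_sum_posForm {H : Matrix (Fin n) (Fin n) ℂ} (hH : H.PosSemidef) :
    ∃ b : Fin n → Fin n → ℂ, ∑ j, ∑ k, (Complex.I * H j k) • (dz j * dzbar k : ConstForm n)
      = ∑ l, posForm (b l) := by
  obtain ⟨B, rfl⟩ := hH.exists_eq_conjTranspose_mul_self
  refine ⟨fun l j => (starRingEnd ℂ) (B l j), ?_⟩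
  have : ∀ l, posForm (fun j => (starRingEnd ℂ) (B l j)) = ∑ j, ∑ k,
      (Complex.I * ((starRingEnd ℂ) (B l j) * B l k)) • (dz j * dzbar k : ConstForm n) := by
    intro l
    simp only [posForm, alpha, alphaBar, Finset.sum_mul_sum, Finset.smul_sum, smul_mul_smul_comm,
      smul_smul, RCLike.conj_conj]
  simp_rw [this]
  rw [Finset.sum_comm]
  have h2 : ∀ k : Fin n, ∑ l, ∑ j, (Complex.I * ((starRingEnd ℂ) (B l j) * B l k)) •
      (dz j * dzbar k : ConstForm n) = ∑ j, ∑ l, (Complex.I * ((starRingEnd ℂ) (B l j) * B l k)) •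
      (dz j * dzbar k : ConstForm n) := fun k => Finset.sum_comm
  have h3 : ∑ l, ∑ j, ∑ k, (Complex.I * ((starRingEnd ℂ) (B l j) * B l k)) •
      (dz j * dzbar k : ConstForm n) = ∑ k, ∑ l, ∑ j,
      (Complex.I * ((starRingEnd ℂ) (B l j) * B l k)) • (dz j * dzbar k : ConstForm n) := by
    rw [Finset.sum_comm' (s' := fun _ => Finset.univ) (t' := Finset.univ) (by simp)]
    rw [Finset.sum_congr rfl fun j _ => Finset.sum_comm]
    rw [Finset.sum_comm]
    exact Finset.sum_congr rfl fun k _ => Finset.sum_comm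
  rw [h3]
  simp_rw [h2, Matrix.mul_apply, Matrix.conjTranspose_apply, Finset.mul_sum, Finset.sum_smul]
  rfl

/-- The pairing of a current with `i dz_j ∧ dz̄_k` and a strongly positive form. -/
def coeffJK {q : ℕ} (T : FormFunctional Ω) (a : Fin q → Fin n → ℂ) (j k : Fin n) :
    𝓓(Ω, ℂ) →ₗ[ℂ] ℂ :=
  berezin n ∘ₗ LinearMap.mulRight ℂ (posProd a) ∘ₗ
    LinearMap.mulLeft ℂ (Complex.I • (dz j * dzbar k)) ∘ₗ T

lemma coeffJK_apply {q : ℕ} (T : FormFunctional Ω) (a : Fin q → Fin n → ℂ) (j k : Fin n)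
    (f : 𝓓(Ω, ℂ)) :
    coeffJK T a j k f = berezin n (Complex.I • (dz j * dzbar k) * T f * posProd a) := rfl

lemma IsPositiveClosed.sum_coeffJK_nonneg {p q : ℕ} (hpq : p + (q + 1) = n) {T : FormFunctional Ω}
    (hT : IsPositiveClosed p T) (a : Fin q → Fin n → ℂ) {H : Matrix (Fin n) (Fin n) ℂ}
    (hH : H.PosSemidef) {f : 𝓓(Ω, ℂ)} (hf : ∀ z, 0 ≤ f z) :
    0 ≤ ∑ j, ∑ k, H j k * coeffJK T a j k f := by
  obtain ⟨b, hb⟩ := exists_sum_posForm hH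
  have h1 : ∑ j, ∑ k, H j k * coeffJK T a j k f
      = berezin n ((∑ j, ∑ k, (Complex.I * H j k) • (dz j * dzbar k : ConstForm n))
        * T f * posProd a) := by
    simp only [Finset.sum_mul, map_sum, coeffJK_apply, smul_mul_assoc, map_smul, smul_eq_mul]
    refine Finset.sum_congr rfl fun j _ => Finset.sum_congr rfl fun k _ => ?_
    ring
  rw [h1, hb, Finset.sum_mul, Finset.sum_mul, map_sum]
  refine Finset.sum_nonneg fun l _ => ?_
  have := hT.isPositive _ hpq (Fin.cons (b l) a) f (subset_univ _) hf
  rwa [posProd_cons, ← mul_assoc, ← posForm_comm] at this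

/-- `i∂∂̄w ∧ T` is positive where the complex Hessian of `w` is. The Hessian is approximated by
combinations of constant positive matrices, with a partition of unity as coefficients. -/
lemma IsPositiveClosed.isPositiveOn_lev {p : ℕ} {T : FormFunctional Ω}
    (hT : IsPositiveClosed p T) {w : Cn n → ℝ} (hw : ContDiff ℝ ∞ fun z => (w z : ℂ))
    {L : Set (Cn n)} (hL : ∀ z ∈ L, (levi w z).PosSemidef) :
    IsPositiveOn (p + 1) L (lev _ hw T) := by
  intro q hpq a f hfL hf0
  have hpq' : p + (q + 1) = n := by omega
  set h := fun j k => hess (fun z => (w z : ℂ)) j k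
  set K := tsupport f
  have hK : IsCompact K := f.hasCompactSupport
  have hlev : berezin n (lev _ hw T f * posProd a) = ∑ j, ∑ k,
      coeffJK T a j k (mulTest (h j k) (contDiff_hess hw j k) f) := by
    simp only [lev_apply, Finset.sum_mul, map_sum, coeffJK_apply, smul_mul_assoc]
    rfl
  rw [hlev]
  -- bounds for the coefficients
  have hbd : ∀ j k, ∃ C : ℝ, ∀ g : 𝓓(Ω, ℂ), tsupport g ⊆ K → ∀ M : ℝ, (∀ z, ‖g z‖ ≤ M) →
      ‖coeffJK T a j k g‖ ≤ C * M := by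
    intro j k
    obtain ⟨C, hC⟩ := hT.hasOrderZero hpq' K hK f.tsupport_subset (berezin n ∘ₗ
      LinearMap.mulRight ℂ (posProd a) ∘ₗ LinearMap.mulLeft ℂ (Complex.I • (dz j * dzbar k)))
    exact ⟨C, fun g hg M hM => hC () g hg M hM⟩
  choose C hC using hbd
  obtain ⟨B, hB⟩ := f.continuous.bounded_above_of_compact_support f.hasCompactSupport
  have hB0 : 0 ≤ B := (norm_nonneg _).trans (hB 0)
  set X := ∑ j, ∑ k,
    coeffJK T a j k (mulTest (h j k) (contDiff_hess hw j k) f) with hX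
  suffices hs : ∀ ε > 0, ∃ y : ℂ, 0 ≤ y ∧ ‖X - y‖ ≤ ε * ∑ j, ∑ k, |C j k| * B by
    have hcl : IsClosed {y : ℂ | 0 ≤ y} := isClosed_Ici
    refine hcl.closure_subset_iff.2 subset_rfl (Metric.mem_closure_iff.2 fun ε hε => ?_)
    have hS : 0 ≤ ∑ j, ∑ k, |C j k| * B := by positivity
    obtain ⟨y, hy, hXy⟩   := hs (ε / (2 * (∑ j, ∑ k, |C j k| * B + 1))) (by positivity)
    refine ⟨y, hy, ?_⟩
    rw [dist_eq_norm]
    refine hXy.trans_lt ?_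
    rw [div_mul_eq_mul_div, div_lt_iff₀ (by positivity)]
    nlinarith
  intro ε hε
  have hcont : ∀ j k, Continuous (h j k) := fun j k =>
    (contDiff_hess hw j k).continuous
  let U : K → Set (Cn n) := fun z => {y | ∀ j k, ‖h j k y - h j k z‖ < ε}
  have hUo : ∀ z, IsOpen (U z) := by
    intro z
    simp only [U, ofPred_forall]
    exact isOpen_iInter_of_finite fun j => isOpen_iInter_of_finite fun k =>
      isOpen_lt ((hcont j k).sub continuous_const).norm continuous_const
  obtain ⟨ρ, hρ⟩ := SmoothPartitionOfUnity.exists_isSubordinate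
    (modelWithCornersSelf ℝ (Cn n)) hK.isClosed U hUo fun z hz =>
      mem_iUnion.2 ⟨⟨z, hz⟩, fun j k => by simpa using hε⟩
  have hfin := ρ.locallyFinite.finite_nonempty_inter_compact hK
  set s := hfin.toFinset
  have hsum : ∀ y ∈ K, ∑ i ∈ s, ρ i y = 1 := by
    intro y hy
    rw [← ρ.sum_eq_one hy]
    refine (finsum_eq_sum_of_support_subset _ fun i hi => ?_).symm
    simp only [s, Finite.coe_toFinset]
    exact ⟨y, hi, hy⟩
  have hρs : ∀ i, ContDiff ℝ ∞ fun z => (ρ i z : ℂ) := fun i =>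
    contDiff_ofReal (ρ i).contMDiff.contDiff
  refine ⟨∑ i ∈ s, ∑ j, ∑ k, h j k i * coeffJK T a j k (mulTest _ (hρs i) f), ?_, ?_⟩
  · refine Finset.sum_nonneg fun i _ => hT.sum_coeffJK_nonneg hpq' a (hL _ (hfL i.2)) fun z => ?_
    rw [mulTest_apply]
    exact mul_nonneg (by exact_mod_cast ρ.nonneg i z) (hf0 z)
  · have h1 : ∑ i ∈ s, ∑ j, ∑ k, h j k i * coeffJK T a j k (mulTest _ (hρs i) f)
        = ∑ j, ∑ k, coeffJK T a j k (∑ i ∈ s, h j k i • mulTest _ (hρs i) f) := by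
      rw [Finset.sum_comm]
      refine Finset.sum_congr rfl fun j _ => ?_
      rw [Finset.sum_comm]
      refine Finset.sum_congr rfl fun k _ => ?_
      rw [map_sum]
      refine Finset.sum_congr rfl fun i _ => ?_
      rw [map_smul, smul_eq_mul]
    rw [h1, hX]
    simp_rw [← Finset.sum_sub_distrib, ← map_sub]
    rw [Finset.mul_sum]
    refine (norm_sum_le _ _).trans (Finset.sum_le_sum fun j _ => ?_)
    rw [Finset.mul_sum]
    refine (norm_sum_le _ _).trans (Finset.sum_le_sum fun k _ => ?_)
    set g : 𝓓(Ω, ℂ) := mulTest (h j k) (contDiff_hess hw j k) f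
      - ∑ i ∈ s, h j k i • mulTest _ (hρs i) f with hg
    have hgz : ∀ z, g z = (∑ i ∈ s, (ρ i z : ℂ) * (h j k z - h j k i)) * f z := by
      intro z
      have e1 : g z = h j k z * f z - (∑ i ∈ s, h j k i * (ρ i z : ℂ)) * f z := by
        rw [hg, FunLike.coe_sub, Pi.sub_apply, mulTest_apply, FunLike.coe_sum, Finset.sum_apply,
          Finset.sum_mul]
        congr 1
        refine Finset.sum_congr rfl fun i _ => ?_
        rw [FunLike.coe_smul, Pi.smul_apply, mulTest_apply, smul_eq_mul, mul_assoc]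
      rw [e1]
      by_cases hz : z ∈ K
      · have e2 : ∑ i ∈ s, (ρ i z : ℂ) = 1 := by exact_mod_cast hsum z hz
        simp_rw [mul_sub, Finset.sum_sub_distrib, ← Finset.sum_mul, e2, one_mul, sub_mul]
        simp_rw [mul_comm]
      · rw [image_eq_zero_of_notMem_tsupport hz]
        simp
    have hgs : tsupport g ⊆ K := by
      refine closure_mono fun z hz => ?_
      intro h0
      exact hz (by rw [hgz, h0, mul_zero])
    have hgb : ∀ z, ‖g z‖ ≤ ε * B := by
      intro z
      rw [hgz, norm_mul]
      by_cases hz : z ∈ K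
      · refine mul_le_mul ?_ (hB z) (norm_nonneg _) hε.le
        calc ‖∑ i ∈ s, (ρ i z : ℂ) * (h j k z - h j k i)‖
            ≤ ∑ i ∈ s, ρ i z * ε := by
              refine (norm_sum_le _ _).trans (Finset.sum_le_sum fun i _ => ?_)
              rw [norm_mul, Complex.norm_real, Real.norm_of_nonneg (ρ.nonneg i z)]
              by_cases hi : ρ i z = 0
              · rw [hi, zero_mul, zero_mul]
              · exact mul_le_mul_of_nonneg_left
                  (hρ i (subset_tsupport _ hi) j k).le (ρ.nonneg i z)
          _ = ε := by rw [← Finset.sum_mul, hsum z hz, one_mul]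
      · rw [image_eq_zero_of_notMem_tsupport hz, norm_zero, mul_zero]
        positivity
    calc ‖coeffJK T a j k g‖ ≤ C j k * (ε * B) := hC j k g hgs _ hgb
      _ ≤ |C j k| * (ε * B) := mul_le_mul_of_nonneg_right (le_abs_self _) (by positivity)
      _ = ε * (|C j k| * B) := by ring

/-! ### Regularization of plurisubharmonic functions -/

/-- Taylor's formula of order two. -/
lemma exists_taylor_two {E : Type*} [NormedAddCommGroup E] [NormedSpace ℝ E] {w : E → ℝ}
    (hw : ContDiff ℝ ∞ w) (z : E) {ε : ℝ} (hε : 0 < ε) :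
    ∃ ρ > 0, ∀ x, ‖x‖ < ρ →
      |w (z + x) - w z - fderiv ℝ w z x - (1 / 2) * fderiv ℝ (fderiv ℝ w) z x x| ≤ ε * ‖x‖ ^ 2 := by
  set Q := fderiv ℝ (fderiv ℝ w) z
  have hd : HasFDerivAt (fderiv ℝ w) Q z :=
    ((hw.fderiv_right (m := ∞) (by simp)).differentiable (by simp) z).hasFDerivAt
  have hsymm : ∀ x y, Q x y = Q y x := fun x y => (hw.contDiffAt.isSymmSndFDerivAt
    (by simpa using (WithTop.coe_le_coe.2 le_top : ((2 : ℕ∞) : ℕ∞ω) ≤ ((⊤ : ℕ∞) : ℕ∞ω)))).eq x y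
  obtain ⟨ρ, hρ, h⟩ := Metric.eventually_nhds_iff.1
    ((hasFDerivAt_iff_isLittleO_nhds_zero.1 hd).bound hε)
  refine ⟨ρ, hρ, fun x hx => ?_⟩
  have hE : ∀ y, HasFDerivAt (fun y => w (z + y) - w z - fderiv ℝ w z y - (1 / 2) * Q y y)
      (fderiv ℝ w (z + y) - fderiv ℝ w z - Q y) y := by
    intro y
    have h1 : HasFDerivAt (fun y => w (z + y)) (fderiv ℝ w (z + y)) y := by
      have := (hw.differentiable (by simp) (z + y)).hasFDerivAt
      exact (this.comp y ((hasFDerivAt_id y).const_add z)).congr_fderiv (by ext; simp)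
    have h2 : HasFDerivAt (fun y => Q y y) ((2 : ℝ) • Q y) y := by
      have := Q.hasFDerivAt (x := y) |>.clm_apply (hasFDerivAt_id y)
      refine this.congr_fderiv ?_
      ext v
      simp [hsymm v y, two_mul]
    have h3 := ((h1.sub_const (w z)).sub (fderiv ℝ w z).hasFDerivAt).sub (h2.const_mul (1 / 2))
    refine h3.congr_fderiv ?_
    rw [smul_smul]
    norm_num
  have hmv := (convex_closedBall (0 : E) ‖x‖).norm_image_sub_le_of_norm_hasFDerivWithin_le
    (C := ε * ‖x‖) (fun y _ => (hE y).hasFDerivWithinAt) (fun y hy => by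
      have hy' : ‖y‖ ≤ ‖x‖ := by simpa using hy
      refine (h (by simpa using hy'.trans_lt hx)).trans ?_
      gcongr) (x := 0) (y := x) (by simp) (by simp)
  simp only [add_zero, map_zero, sub_self, mul_zero, sub_zero, Real.norm_eq_abs] at hmv
  rw [sq, ← mul_assoc]
  exact hmv

/-- The sub-mean value inequality on small circles makes the Laplacian on complex lines
nonnegative. -/
lemma laplacian_nonneg {w : Cn n → ℝ} (hw : ContDiff ℝ ∞ w) {z : Cn n} {δ : ℝ} (hδ : 0 < δ)
    (h : ∀ ξ : Cn n, ‖ξ‖ < δ → w z ≤ Real.circleAverage (fun c : ℂ => w (z + c • ξ)) 0 1)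
    (ξ : Cn n) : 0 ≤ fderiv ℝ (fderiv ℝ w) z ξ ξ
      + fderiv ℝ (fderiv ℝ w) z (Complex.I • ξ) (Complex.I • ξ) := by
  set Q := fderiv ℝ (fderiv ℝ w) z
  suffices hs : ∀ ε > 0, 0 ≤ ε * (4 * ‖ξ‖ ^ 2) + (Q ξ ξ + Q (Complex.I • ξ) (Complex.I • ξ)) by
    by_contra hneg
    push Not at hneg
    set c := Q ξ ξ + Q (Complex.I • ξ) (Complex.I • ξ)
    have := hs (-c / (8 * (‖ξ‖ ^ 2 + 1))) (div_pos (by linarith) (by positivity))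
    rw [div_mul_eq_mul_div, ← sub_nonneg] at this
    have h1 : -c * (4 * ‖ξ‖ ^ 2) / (8 * (‖ξ‖ ^ 2 + 1)) < -c := by
      rw [div_lt_iff₀ (by positivity)]
      nlinarith [sq_nonneg ‖ξ‖]
    linarith
  intro ε hε
  obtain ⟨ρ, hρ, hT⟩ := exists_taylor_two hw z hε
  -- the inequality on the circle of radius `r` in the direction `ξ`
  obtain ⟨r, hr, hr1⟩ : ∃ r : ℝ, 0 < r ∧ r * ‖ξ‖ < min δ ρ := by
    refine ⟨min δ ρ / (2 * (‖ξ‖ + 1)), by positivity, ?_⟩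
    rw [div_mul_eq_mul_div, div_lt_iff₀ (by positivity)]
    nlinarith [norm_nonneg ξ, lt_min hδ hρ]
  set η := r • ξ with hη
  have hηn : ‖η‖ = r * ‖ξ‖ := by rw [hη, norm_smul, Real.norm_of_nonneg hr.le]
  have hmean := h η (by rw [hηn]; exact hr1.trans_le (min_le_left _ _))
  set A := Q η η
  set D := Q (Complex.I • η) (Complex.I • η)
  set B := Q η (Complex.I • η) + Q (Complex.I • η) η
  set a := fderiv ℝ w z η
  set b := fderiv ℝ w z (Complex.I • η)
  have hpt : ∀ θ : ℝ, w (z + circleMap 0 1 θ • η) ≤ w z + ε * ‖η‖ ^ 2 + (Real.cos θ * a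
      + Real.sin θ * b) + (1 / 2) * (Real.cos θ ^ 2 * A + Real.sin θ * Real.cos θ * B
      + Real.sin θ ^ 2 * D) := by
    intro θ
    have hc : circleMap 0 1 θ • η = Real.cos θ • η + Real.sin θ • (Complex.I • η) := by
      rw [circleMap_zero, Complex.exp_mul_I, ← Complex.ofReal_cos, ← Complex.ofReal_sin]
      simp only [Complex.ofReal_one, one_mul, add_smul, mul_smul]
      rfl
    have hn : ‖circleMap 0 1 θ • η‖ = ‖η‖ := by
      rw [norm_smul, norm_circleMap_zero]; simp
    have := (abs_le.1 (hT (circleMap 0 1 θ • η)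
      (by rw [hn, hηn]; exact hr1.trans_le (min_le_right _ _)))).2
    rw [hn] at this
    have e1 : fderiv ℝ w z (circleMap 0 1 θ • η) = Real.cos θ * a + Real.sin θ * b := by
      rw [hc, map_add, (fderiv ℝ w z).map_smul (Real.cos θ) η,
        (fderiv ℝ w z).map_smul (Real.sin θ) (Complex.I • η)]; rfl
    have e2 : Q (circleMap 0 1 θ • η) (circleMap 0 1 θ • η) = Real.cos θ ^ 2 * A
        + Real.sin θ * Real.cos θ * B + Real.sin θ ^ 2 * D := by
      rw [hc]
      simp only [map_add, map_smul, FunLike.coe_add, FunLike.coe_smul, Pi.add_apply, Pi.smul_apply,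
        smul_eq_mul]
      ring
    rw [e1] at this
    erw [e2] at this
    linarith
  have hcontw : Continuous fun θ : ℝ => w (z + circleMap 0 1 θ • η) :=
    hw.continuous.comp (continuous_const.add ((continuous_circleMap 0 1).smul continuous_const))
  have hcont : Continuous fun θ : ℝ => w z + ε * ‖η‖ ^ 2 + (Real.cos θ * a
      + Real.sin θ * b) + (1 / 2) * (Real.cos θ ^ 2 * A + Real.sin θ * Real.cos θ * B
      + Real.sin θ ^ 2 * D) := by fun_prop
  have hint := intervalIntegral.integral_mono_on (μ := volume) (a := 0) (b := 2 * Real.pi)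
    (by positivity) (hcontw.intervalIntegrable _ _) (hcont.intervalIntegrable _ _)
    fun θ _ => hpt θ
  have hcalc : ∫ θ in (0 : ℝ)..2 * Real.pi, (w z + ε * ‖η‖ ^ 2 + (Real.cos θ * a
      + Real.sin θ * b) + (1 / 2) * (Real.cos θ ^ 2 * A + Real.sin θ * Real.cos θ * B
      + Real.sin θ ^ 2 * D)) = 2 * Real.pi * (w z + ε * ‖η‖ ^ 2 + (1 / 4) * (A + D)) := by
    have i1 : ∀ f : ℝ → ℝ, Continuous f → IntervalIntegrable f volume 0 (2 * Real.pi) :=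
      fun f hf => hf.intervalIntegrable _ _
    rw [intervalIntegral.integral_add (i1 _ (by fun_prop)) (i1 _ (by fun_prop)),
      intervalIntegral.integral_add (i1 _ (by fun_prop)) (i1 _ (by fun_prop)),
      intervalIntegral.integral_add (i1 _ (by fun_prop)) (i1 _ (by fun_prop)),
      intervalIntegral.integral_const_mul (1 / 2 : ℝ),
      intervalIntegral.integral_add (i1 _ (by fun_prop)) (i1 _ (by fun_prop)),
      intervalIntegral.integral_add (i1 _ (by fun_prop)) (i1 _ (by fun_prop)),
      intervalIntegral.integral_add (i1 _ (by fun_prop)) (i1 _ (by fun_prop))]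
    simp only [intervalIntegral.integral_mul_const, intervalIntegral.integral_const, integral_cos,
      integral_sin, integral_cos_sq, integral_sin_sq, integral_sin_mul_cos₁]
    simp
    ring
  rw [hcalc] at hint
  rw [Real.circleAverage_def, smul_eq_mul, inv_mul_eq_div, le_div_iff₀ (by positivity)] at hmean
  have h2 : w z ≤ w z + ε * ‖η‖ ^ 2 + (1 / 4) * (A + D) := by
    have := hmean.trans hint
    have hp : 0 < 2 * Real.pi := by positivity
    nlinarith
  have hA : A = r ^ 2 * Q ξ ξ := by
    simp only [A, hη, map_smul, FunLike.coe_smul, Pi.smul_apply, smul_eq_mul]; ring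
  have hD : D = r ^ 2 * Q (Complex.I • ξ) (Complex.I • ξ) := by
    have : Complex.I • η = r • (Complex.I • ξ) := by rw [hη, smul_comm]
    simp only [D, this, map_smul, FunLike.coe_smul, Pi.smul_apply, smul_eq_mul]; ring
  rw [hA, hD, hηn] at h2
  have hr2 : 0 < r ^ 2 := by positivity
  nlinarith

/-- The complex Hessian in terms of the real one. -/
lemma hess_ofReal_apply {w : Cn n → ℝ} (hw : ContDiff ℝ ∞ w) (z : Cn n) (j k : Fin n) :
    hess (fun z => (w z : ℂ)) j k z = (1 / 4) *
      (((fderiv ℝ (fderiv ℝ w) z (EuclideanSpace.single j 1) (EuclideanSpace.single k 1)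
        + fderiv ℝ (fderiv ℝ w) z (EuclideanSpace.single j Complex.I)
          (EuclideanSpace.single k Complex.I) : ℝ) : ℂ)
      + Complex.I * ((fderiv ℝ (fderiv ℝ w) z (EuclideanSpace.single j 1)
          (EuclideanSpace.single k Complex.I)
        - fderiv ℝ (fderiv ℝ w) z (EuclideanSpace.single j Complex.I)
          (EuclideanSpace.single k 1) : ℝ) : ℂ)) := by
  have h1 : wirt Complex.I k (fun z => (w z : ℂ)) = fun z =>
      (1 / 2) * ((fderiv ℝ w z (EuclideanSpace.single k 1) : ℂ)
        + Complex.I * (fderiv ℝ w z (EuclideanSpace.single k Complex.I) : ℂ)) := by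
    funext z
    rw [wirt, fderiv_ofReal hw, fderiv_ofReal hw]
  have hd : HasFDerivAt (fderiv ℝ w) (fderiv ℝ (fderiv ℝ w) z) z :=
    ((hw.fderiv_right (m := ∞) (by simp)).differentiable (by simp) z).hasFDerivAt
  have h3 : ∀ v : Cn n, HasFDerivAt (fun z => ((fderiv ℝ w z v : ℝ) : ℂ))
      (Complex.ofRealCLM ∘L (fderiv ℝ (fderiv ℝ w) z).flip v) z := by
    intro v
    have : HasFDerivAt (fun z => fderiv ℝ w z v) ((fderiv ℝ (fderiv ℝ w) z).flip v) z := by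
      refine (hd.clm_apply (hasFDerivAt_const v z)).congr_fderiv ?_
      ext x
      simp
    exact Complex.ofRealCLM.hasFDerivAt.comp z this
  have h4 : ∀ u : Cn n, fderiv ℝ (fun z => (1 / 2) * ((fderiv ℝ w z (EuclideanSpace.single k 1) : ℂ)
        + Complex.I * (fderiv ℝ w z (EuclideanSpace.single k Complex.I) : ℂ))) z u
      = (1 / 2) * ((fderiv ℝ (fderiv ℝ w) z u (EuclideanSpace.single k 1) : ℂ)
        + Complex.I * (fderiv ℝ (fderiv ℝ w) z u (EuclideanSpace.single k Complex.I) : ℂ)) := by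
    intro u
    have := (((h3 (EuclideanSpace.single k 1)).add
      ((h3 (EuclideanSpace.single k Complex.I)).const_mul Complex.I)).const_mul (1 / 2 : ℂ)).fderiv
    erw [this]
    simp [mul_add]
  rw [hess, h1, wirt, h4, h4]
  push_cast
  linear_combination (-(1 / 4 : ℂ) * (fderiv ℝ (fderiv ℝ w) z (EuclideanSpace.single j Complex.I)
          (EuclideanSpace.single k Complex.I) : ℂ)) * Complex.I_mul_I

/-- The complex Hessian of `w` is the Hermitian form `ξ ↦ (D²w(ξ, ξ) + D²w(iξ, iξ)) / 4`. -/
lemma levi_posSemidef_of_laplacian {w : Cn n → ℝ} (hw : ContDiff ℝ ∞ w) {z : Cn n}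
    (h : ∀ ξ : Cn n, 0 ≤ fderiv ℝ (fderiv ℝ w) z ξ ξ
      + fderiv ℝ (fderiv ℝ w) z (Complex.I • ξ) (Complex.I • ξ)) : (levi w z).PosSemidef := by
  set Q := fderiv ℝ (fderiv ℝ w) z with hQ
  have hsymm : ∀ x y, Q x y = Q y x := fun x y => (hw.contDiffAt.isSymmSndFDerivAt
    (by simpa using (WithTop.coe_le_coe.2 le_top : ((2 : ℕ∞) : ℕ∞ω) ≤ ((⊤ : ℕ∞) : ℕ∞ω)))).eq x y
  have hcs : ∀ (c : ℂ) (x : Cn n), c • x = c.re • x + c.im • (Complex.I • x) := by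
    intro c x
    conv_lhs => rw [← Complex.re_add_im c]
    rw [add_smul, mul_smul]
    rfl
  have hII : ∀ x : Cn n, Complex.I • (Complex.I • x) = -x := by
    intro x
    rw [smul_smul, Complex.I_mul_I, neg_one_smul]
  let S : Cn n →ₗ[ℂ] Cn n →ₛₗ[starRingEnd ℂ] ℂ :=
    LinearMap.mk₂'ₛₗ (RingHom.id ℂ) (starRingEnd ℂ)
      (fun x y => (1 / 4) * (((Q x y + Q (Complex.I • x) (Complex.I • y) : ℝ) : ℂ)
        + Complex.I * ((Q x (Complex.I • y) - Q (Complex.I • x) y : ℝ) : ℂ)))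
      (by
        intro x x' y
        simp only [smul_add, map_add, FunLike.coe_add, Pi.add_apply]
        push_cast
        ring)
      (by
        intro c x y
        have e1 : Complex.I • (c • x) = c.re • (Complex.I • x) + (-c.im) • x := by
          rw [smul_comm, hcs c, hII]; simp
        rw [e1, hcs c x]
        simp only [map_add, map_smul, FunLike.coe_add, FunLike.coe_smul, Pi.add_apply,
          Pi.smul_apply, smul_eq_mul]
        apply Complex.ext <;> simp <;> ring)
      (by
        intro x y y'
        simp only [smul_add, map_add]
        push_cast
        ring)
      (by
        intro c x y
        have e1 : Complex.I • (c • y) = c.re • (Complex.I • y) + (-c.im) • y := by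
          rw [smul_comm, hcs c, hII]; simp
        rw [e1, hcs c y]
        simp only [map_add, map_smul, smul_eq_mul]
        apply Complex.ext <;> simp <;> ring)
  have hSapp : ∀ x y, S x y = (1 / 4) * (((Q x y + Q (Complex.I • x) (Complex.I • y) : ℝ) : ℂ)
        + Complex.I * ((Q x (Complex.I • y) - Q (Complex.I • x) y : ℝ) : ℂ)) := fun _ _ => rfl
  have hSe : ∀ j k, levi w z j k
      = S (EuclideanSpace.single j 1) (EuclideanSpace.single k 1) := by
    intro j k
    have hI : ∀ j : Fin n, (EuclideanSpace.single j Complex.I : Cn n)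
        = Complex.I • EuclideanSpace.single j (1 : ℂ) := by
      intro j
      ext k
      simp
    rw [hSapp, ← hI, ← hI]
    exact hess_ofReal_apply hw z j k
  refine Matrix.PosSemidef.of_dotProduct_mulVec_nonneg ?_ fun x => ?_
  · ext j k
    rw [Matrix.conjTranspose_apply, hSe, hSe, hSapp, hSapp,
      hsymm (EuclideanSpace.single j 1) (EuclideanSpace.single k 1),
      hsymm (EuclideanSpace.single j 1), hsymm (Complex.I • EuclideanSpace.single j 1),
      hsymm (Complex.I • EuclideanSpace.single j 1)]
    apply Complex.ext <;> simp
  · -- `S` is linear in its first argument, while `star x` is conjugate linear in `x`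
    set ξ : Cn n := WithLp.toLp 2 fun j => (starRingEnd ℂ) (x j)
    have hξ : ξ = ∑ j, (starRingEnd ℂ) (x j) • EuclideanSpace.single j (1 : ℂ) := by
      ext k
      simp [ξ, Pi.single_apply]
    have h1 : star x ⬝ᵥ (levi w z).mulVec x = S ξ ξ := by
      rw [hξ]
      simp only [map_sum, LinearMap.sum_apply, map_smul, LinearMap.smul_apply, map_smulₛₗ,
        RCLike.conj_conj, smul_eq_mul, ← hSe, dotProduct, Matrix.mulVec, Finset.mul_sum,
        Pi.star_apply]
      rw [Finset.sum_comm]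
      exact Finset.sum_congr rfl fun j _ => Finset.sum_congr rfl fun k _ => by
        rw [starRingEnd_apply]; ring
    rw [h1, hSapp, hsymm ξ (Complex.I • ξ), sub_self]
    have := h ξ
    have h4 : (0 : ℂ) ≤ ((Q ξ ξ + Q (Complex.I • ξ) (Complex.I • ξ) : ℝ) : ℂ) := by
      exact_mod_cast this
    simpa using mul_nonneg (by positivity : (0 : ℂ) ≤ 1 / 4) h4

/-- Mollification preserves the sub-mean value inequality. -/
lemma IsContinuousPSH.mollify_submean {v : Cn n → ℝ} (hv : IsContinuousPSH Ω v) {F : Cn n → ℝ}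
    (hF : Continuous F) (hFc : HasCompactSupport F) {z : Cn n} {δ : ℝ} (hδ : 0 < δ)
    (h : ∀ x, dist x z < δ + δ → x ∈ Ω ∧ F x = v x) {ξ : Cn n} (hξ : ‖ξ‖ < δ) :
    mollify hδ F z ≤ Real.circleAverage (fun c => mollify hδ F (z + c • ξ)) 0 1 := by
  set ρ := (bump n hδ).normed Measure.addHaar with hρ
  have hρi : Integrable ρ Measure.addHaar := (bump n hδ).integrable_normed
  have hρc : Continuous ρ := (bump n hδ).contDiff_normed (n := 0) |>.continuous
  obtain ⟨C, hC⟩ := hF.bounded_above_of_compact_support hFc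
  have hGc : Continuous fun p : ℝ × Cn n => ρ p.2 * F (z + circleMap 0 1 p.1 • ξ - p.2) := by
    have := continuous_circleMap 0 1
    fun_prop
  have hG : Integrable (fun p : ℝ × Cn n => ρ p.2 * F (z + circleMap 0 1 p.1 • ξ - p.2))
      ((volume.restrict (Ioc 0 (2 * Real.pi))).prod Measure.addHaar) := by
    refine ((hρi.norm.const_mul C).comp_snd (volume.restrict (Ioc 0 (2 * Real.pi)))).mono'
      hGc.aestronglyMeasurable (Eventually.of_forall fun p => ?_)
    rw [norm_mul, mul_comm]
    exact mul_le_mul_of_nonneg_right (hC _) (norm_nonneg _)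
  have hR : Real.circleAverage (fun c => mollify hδ F (z + c • ξ)) 0 1
      = ∫ y, ρ y * Real.circleAverage (fun c => F (z + c • ξ - y)) 0 1 ∂Measure.addHaar := by
    rw [Real.circleAverage_def, intervalIntegral.integral_of_le (by positivity)]
    simp_rw [mollify_apply, smul_eq_mul]
    rw [integral_integral_swap hG, ← integral_const_mul]
    refine integral_congr_ae (Eventually.of_forall fun y => ?_)
    beta_reduce
    rw [Real.circleAverage_def, intervalIntegral.integral_of_le (by positivity),
      integral_const_mul, smul_eq_mul]
    ring
  rw [hR, mollify_apply]
  refine integral_mono ?_ ?_ fun y => ?_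
  · have hc : Continuous fun y => ρ y • F (z - y) := by fun_prop
    refine ((hρi.norm.const_mul C)).mono' hc.aestronglyMeasurable (Eventually.of_forall fun p => ?_)
    rw [norm_smul, mul_comm]
    exact mul_le_mul_of_nonneg_right (hC _) (norm_nonneg _)
  · have := hG.integral_prod_right.const_mul (2 * Real.pi)⁻¹
    refine this.congr (Eventually.of_forall fun y => ?_)
    dsimp only
    rw [Real.circleAverage_def, intervalIntegral.integral_of_le (by positivity),
      integral_const_mul, smul_eq_mul]
    ring
  · by_cases hy : ρ y = 0
    · change ρ y * _ ≤ ρ y * _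
      simp [hy]
    · have hy' : ‖y‖ < δ := by
        have : y ∈ Function.support ρ := hy
        rw [hρ, (bump n hδ).support_normed_eq] at this
        simpa [bump] using this
      refine mul_le_mul_of_nonneg_left ?_ ((bump n hδ).nonneg_normed y)
      have hc : ∀ c : ℂ, ‖c‖ ≤ 1 → dist (z - y + c • ξ) z < δ + δ := by
        intro c hc
        have : z - y + c • ξ - z = c • ξ - y := by abel
        rw [dist_eq_norm, this]
        refine (norm_sub_le _ _).trans_lt (add_lt_add ?_ hy')
        rw [norm_smul]
        nlinarith [norm_nonneg ξ, norm_nonneg c]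
      have h1 := hv.submean (z - y) ξ fun c hc' => (h _ (hc c hc')).1
      have h2 := (h (z - y) (by simpa using hc 0 (by simp))).2
      rw [h2]
      refine h1.trans_eq (Real.circleAverage_congr_sphere fun c hc' => ?_)
      have := (h _ (hc c (by simpa using (mem_sphere_zero_iff_norm.1 hc').le))).2
      beta_reduce
      rw [← this]
      congr 1
      abel

/-- A continuous plurisubharmonic function is a limit of smooth ones, uniformly on compact sets. -/
lemma IsContinuousPSH.exists_smooth_approx {v : Cn n → ℝ} (hv : IsContinuousPSH Ω v)
    {K : Set (Cn n)} (hK : IsCompact K) (hKΩ : K ⊆ Ω) :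
    ∃ w : ℕ → Cn n → ℝ, (∀ i, ContDiff ℝ ∞ (w i)) ∧ (∀ i, ∀ z ∈ K, (levi (w i) z).PosSemidef) ∧
      TendstoUniformlyOn w v atTop K ∧ ((∀ z ∈ Ω, 0 ≤ v z) → ∀ i z, 0 ≤ w i z) := by
  obtain ⟨δ, hδ, hδΩ⟩ := hK.exists_cthickening_subset_open Ω.isOpen hKΩ
  have hKδ : IsCompact (Metric.cthickening δ K) := hK.cthickening
  obtain ⟨L, hL, hKL, hLΩ⟩ := exists_compact_nhds_subset hKδ hδΩ
  obtain ⟨χ, hχ, h1, h01, hχL, χ', hχ'⟩ := exists_cutoff hKδ hL hLΩ hKL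
  have hcc := (isCc_test χ').mul_left hv.continuousOn
  set F : Cn n → ℝ := fun z => v z * χ z with hF
  have hFC : (fun z => (v z : ℂ) * χ' z) = fun z => ((F z : ℝ) : ℂ) := by
    funext z
    rw [hχ', hF]
    push_cast
    rfl
  rw [hFC] at hcc
  have hFre : F = fun z => ((F z : ℂ)).re := by simp
  have hFc : Continuous F := by
    rw [hFre]
    exact Complex.continuous_re.comp hcc.continuous
  have hFs : HasCompactSupport F := by
    refine hcc.hasCompactSupport.mono fun z hz => ?_
    simpa using hz
  have hFv : ∀ x ∈ Metric.cthickening δ K, F x = v x := fun x hx => by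
    rw [hF]
    simp only
    rw [h1.self_of_nhdsSet x hx, mul_one]
  have hpos : ∀ i : ℕ, 0 < δ / 2 / (i + 1) := fun i => by positivity
  have hle : ∀ i : ℕ, δ / 2 / (i + 1) ≤ δ / 2 := fun i =>
    div_le_self (by positivity) (by linarith [Nat.cast_nonneg (α := ℝ) i])
  refine ⟨fun i => mollify (hpos i) F, fun i => contDiff_mollify _ hFc, fun i z hz => ?_, ?_,
    fun h0 i z => mollify_nonneg _ (fun z => ?_) z⟩
  · refine levi_posSemidef_of_laplacian (contDiff_mollify _ hFc)
      (laplacian_nonneg (contDiff_mollify _ hFc) (hpos i) fun ξ hξ =>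
        hv.mollify_submean hFc hFs (hpos i) (fun x hx => ?_) hξ)
    have : x ∈ Metric.cthickening δ K :=
      Metric.mem_cthickening_of_dist_le x z _ _ hz (by linarith [hle i])
    exact ⟨hδΩ this, hFv x this⟩
  · have huc := hFs.uniformContinuous_of_continuous hFc
    rw [Metric.tendstoUniformlyOn_iff]
    intro ε hε
    obtain ⟨η, hη, h⟩ := Metric.uniformContinuous_iff.1 huc (ε / 2) (half_pos hε)
    have hlim : Tendsto (fun i : ℕ => δ / 2 / ((i : ℝ) + 1)) atTop (𝓝 0) :=
      tendsto_const_div_atTop_nhds_zero_nat (δ / 2) |>.comp (tendsto_add_atTop_nat 1) |>.congr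
        fun i => by simp
    filter_upwards [hlim.eventually_lt_const hη] with i hi z hz
    rw [dist_comm, ← hFv z (Metric.self_subset_cthickening K hz)]
    refine lt_of_le_of_lt (dist_mollify_le (hpos i) hFc fun y hy => ?_) (half_lt_self hε)
    exact (h (hy.trans hi)).le
  · by_cases hz : χ z = 0
    · simp [hF, hz]
    · exact mul_nonneg (h0 z (hLΩ (hχL (subset_tsupport _ hz)))) (h01 z).1

/-- `v² / 2` is plurisubharmonic if `v` is plurisubharmonic and nonnegative. -/
lemma IsContinuousPSH.sq_div_two {v : Cn n → ℝ} (hv : IsContinuousPSH Ω v)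
    (hv0 : ∀ z ∈ Ω, 0 ≤ v z) : IsContinuousPSH Ω fun z => v z ^ 2 / 2 := by
  refine ⟨(hv.continuousOn.pow 2).div_const 2, fun z w h => ?_⟩
  have hc : ContinuousOn (fun c : ℂ => v (z + c • w)) (Metric.sphere 0 1) :=
    hv.continuousOn.comp (by fun_prop) fun c hc => h c (mem_sphere_zero_iff_norm.1 hc).le
  have hz : z ∈ Ω := by simpa using h 0 (by simp)
  have h1 := hv.submean z w h
  have h2 := Real.circleAverage_mono (c := 0) (R := 1)
    (f₁ := fun c : ℂ => v z • v (z + c • w) - v z ^ 2 / 2)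
    (f₂ := fun c : ℂ => v (z + c • w) ^ 2 / 2)
    (((hc.const_smul (v z)).sub continuousOn_const).circleIntegrable zero_le_one)
    (((hc.pow 2).div_const 2).circleIntegrable zero_le_one)
    (fun c _ => by
      simp only [smul_eq_mul]
      nlinarith [sq_nonneg (v z - v (z + c • w))])
  have hs : ContinuousOn (fun c : ℂ => v z • v (z + c • w)) (Metric.sphere 0 1) :=
    hc.const_smul (v z)
  rw [Real.circleAverage_fun_sub (hs.circleIntegrable zero_le_one)
    (continuousOn_const.circleIntegrable zero_le_one), Real.circleAverage_const,
    Real.circleAverage_fun_smul, smul_eq_mul] at h2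
  nlinarith [hv0 z hz]

/-! ### The Bedford–Taylor operator -/

lemma sum_eq_zero_of_antisymm {A : Fin n → Fin n → ConstForm n} (h : ∀ j k, A j k = -A k j) :
    ∑ j, ∑ k, A j k = 0 := by
  have h1 : ∑ j, ∑ k, A j k = -∑ j, ∑ k, A j k := by
    conv_lhs => rw [Finset.sum_comm]
    simp_rw [← Finset.sum_neg_distrib]
    exact Finset.sum_congr rfl fun j _ => Finset.sum_congr rfl fun k _ => h k j
  have h2 : (2 : ℂ) • ∑ j, ∑ k, A j k = 0 := by
    rw [two_smul]
    nth_rw 1 [h1]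
    exact neg_add_cancel _
  exact (smul_eq_zero.1 h2).resolve_left two_ne_zero

lemma iddbar_apply (P : FormFunctional Ω) (f : 𝓓(Ω, ℂ)) : iddbar P f = ∑ j, ∑ k,
    Complex.I • (dz j * dzbar k * P (dPartial j (dbarPartial k f))) := rfl

/-- `i∂∂̄P` is closed by the symmetry of second derivatives. -/
lemma isClosedForm_iddbar (P : FormFunctional Ω) : IsClosedForm (iddbar P) := by
  intro f
  rw [neg_eq_zero, Finset.sum_add_distrib]
  have h1 : ∑ m, dz m * iddbar P (dPartial m f) = 0 := by
    have : ∀ m, dz m * iddbar P (dPartial m f) = ∑ j, ∑ k, Complex.I •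
        (dz m * dz j * dzbar k * P (dPartial j (dbarPartial k (dPartial m f)))) := by
      intro m
      rw [iddbar_apply]
      simp_rw [Finset.mul_sum, mul_smul_comm, mul_assoc]
    simp_rw [this]
    have h2 : ∀ m j, ∑ k, Complex.I •
        (dz m * dz j * dzbar k * P (dPartial j (dbarPartial k (dPartial m f)))) = -∑ k, Complex.I •
        (dz j * dz m * dzbar k * P (dPartial m (dbarPartial k (dPartial j f)))) := by
      intro m j
      rw [← Finset.sum_neg_distrib]
      refine Finset.sum_congr rfl fun k _ => ?_
      rw [dz_mul_dz m j, ← dPartial_dbarPartial_comm, ← dPartial_dbarPartial_comm,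
        dPartial_comm j m]
      simp
    exact sum_eq_zero_of_antisymm h2
  have h1' : ∑ m, dzbar m * iddbar P (dbarPartial m f) = 0 := by
    have : ∀ m, dzbar m * iddbar P (dbarPartial m f) = ∑ k, ∑ j, Complex.I •
        (-(dz j * (dzbar m * dzbar k * P (dPartial j (dbarPartial k (dbarPartial m f)))))) := by
      intro m
      rw [iddbar_apply, Finset.sum_comm]
      simp_rw [Finset.mul_sum, mul_smul_comm]
      refine Finset.sum_congr rfl fun k _ => Finset.sum_congr rfl fun j _ => ?_
      rw [← mul_assoc, ← mul_assoc, ← neg_mul, ← mul_assoc, ← mul_assoc, neg_mul,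
        dz_mul_dzbar j m, neg_neg]
    simp_rw [this]
    refine sum_eq_zero_of_antisymm fun m k => ?_
    rw [← Finset.sum_neg_distrib]
    refine Finset.sum_congr rfl fun j _ => ?_
    rw [dzbar_mul_dzbar m k, dbarPartial_comm k m]
    simp
  rw [h1, h1', add_zero]

lemma iddbar_mem_bideg {p : ℕ} {P : FormFunctional Ω} (hP : ∀ f, P f ∈ bideg n p p)
    (f : 𝓓(Ω, ℂ)) : iddbar P f ∈ bideg n (p + 1) (p + 1) := by
  rw [iddbar_apply]
  exact Submodule.sum_mem _ fun j _ => Submodule.sum_mem _ fun k _ => Submodule.smul_mem _ _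
    (mul_mem_bideg (dz_mul_dzbar_mem_bideg j k) (hP _) (add_comm _ _) (add_comm _ _))

open Classical in
/-- The current `i∂∂̄(wT)` for a current `T` of order zero and a function `w` that is continuous
on `Ω` (zero for other arguments). -/
def bt (w : Cn n → ℝ) (T : FormFunctional Ω) : FormFunctional Ω :=
  if h : ContinuousOn w Ω ∧ HasOrderZero T then iddbar (product h.1 h.2) else 0

lemma bt_eq {w : Cn n → ℝ} (hw : ContinuousOn w Ω) {T : FormFunctional Ω} (hT : HasOrderZero T) :
    bt w T = iddbar (product hw hT) := dif_pos ⟨hw, hT⟩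

lemma bt_apply {w : Cn n → ℝ} (hw : ContinuousOn w Ω) {T : FormFunctional Ω} (hT : HasOrderZero T)
    (f : 𝓓(Ω, ℂ)) : bt w T f = ∑ j, ∑ k, Complex.I • (dz j * dzbar k *
      extend T fun z => (w z : ℂ) * dPartial j (dbarPartial k f) z) := by
  rw [bt_eq hw hT]
  rfl

/-- `w i` are smooth functions, plurisubharmonic at the points of `K`, that tend to `v` uniformly
on `K`. -/
structure IsSmoothApprox (v : Cn n → ℝ) (K : Set (Cn n)) (w : ℕ → Cn n → ℝ) : Prop where
  contDiff : ∀ i, ContDiff ℝ ∞ (w i)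
  posSemidef : ∀ i, ∀ z ∈ K, (levi (w i) z).PosSemidef
  tendsto : TendstoUniformlyOn w v atTop K

lemma IsSmoothApprox.contDiff' {v : Cn n → ℝ} {K : Set (Cn n)} {w : ℕ → Cn n → ℝ}
    (hw : IsSmoothApprox v K w) (i : ℕ) : ContDiff ℝ ∞ fun z => (w i z : ℂ) :=
  contDiff_ofReal (hw.contDiff i)

/-- `w i f` tends uniformly to `v f`. -/
lemma IsSmoothApprox.approx_mulTest {v : Cn n → ℝ} {K : Set (Cn n)} {w : ℕ → Cn n → ℝ}
    (hw : IsSmoothApprox v K w) {f : 𝓓(Ω, ℂ)} (hf : tsupport f ⊆ K) :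
    Approx (fun z => (v z : ℂ) * f z) (fun i => mulTest _ (hw.contDiff' i) f) (tsupport f) where
  isCompact := f.hasCompactSupport
  subset := f.tsupport_subset
  tsupport_subset _ := tsupport_mulTest_subset _ _ _
  tendsto := by
    obtain ⟨B, hB⟩ := f.continuous.bounded_above_of_compact_support f.hasCompactSupport
    have hB0 : 0 ≤ B := (norm_nonneg _).trans (hB 0)
    rw [Metric.tendstoUniformly_iff]
    intro ε hε
    filter_upwards [Metric.tendstoUniformlyOn_iff.1 hw.tendsto (ε / (B + 1)) (by positivity)]
      with i hi z
    rw [mulTest_apply, dist_eq_norm, ← sub_mul, norm_mul]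
    by_cases hz : z ∈ K
    · have h1 : ‖(v z : ℂ) - w i z‖ < ε / (B + 1) := by
        rw [← Complex.ofReal_sub, Complex.norm_real]
        exact hi z hz
      calc ‖(v z : ℂ) - w i z‖ * ‖f z‖ ≤ ε / (B + 1) * B :=
            mul_le_mul h1.le (hB z) (norm_nonneg _) (by positivity)
        _ < ε := by
            rw [div_mul_eq_mul_div, div_lt_iff₀ (by positivity)]
            nlinarith
    · rw [image_eq_zero_of_notMem_tsupport fun h => hz (hf h), norm_zero, mul_zero]
      exact hε

/-- `i∂∂̄w_i ∧ T` tends to `i∂∂̄(vT)` weakly if `w_i` tends to `v`. -/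
lemma IsSmoothApprox.tendsto_lev {p q : ℕ} (hpq : p + q = n) {T : FormFunctional Ω}
    (hT : IsPositiveClosed p T) {v : Cn n → ℝ} (hv : ContinuousOn v Ω) {K : Set (Cn n)}
    {w : ℕ → Cn n → ℝ} (hw : IsSmoothApprox v K w) {f : 𝓓(Ω, ℂ)} (hf : tsupport f ⊆ K)
    (l : Module.Dual ℂ (ConstForm n)) :
    Tendsto (fun i => l (lev _ (hw.contDiff' i) T f)) atTop (𝓝 (l (bt v T f))) := by
  have hT0 := hT.hasOrderZero hpq
  simp_rw [hT.lev_eq, bt_apply hv hT0, map_sum]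
  refine tendsto_finsetSum _ fun j _ => tendsto_finsetSum _ fun k _ => ?_
  have hs : tsupport (dPartial j (dbarPartial k f)) ⊆ tsupport f :=
    (tsupport_dPartial_subset _ _).trans (tsupport_dbarPartial_subset _ _)
  exact hT0.extend_spec ((isCc_test (dPartial j (dbarPartial k f))).mul_left hv) _ _
    (hw.approx_mulTest (hs.trans hf))
    (l ∘ₗ LinearMap.lsmul ℂ _ Complex.I ∘ₗ LinearMap.mulLeft ℂ (dz j * dzbar k))

/-- Multiplication by a plurisubharmonic function followed by `i∂∂̄` preserves closed positive
currents. -/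
lemma IsPositiveClosed.bt {p : ℕ} (hp : p + 1 ≤ n) {T : FormFunctional Ω}
    (hT : IsPositiveClosed p T) {v : Cn n → ℝ} (hv : IsContinuousPSH Ω v) :
    IsPositiveClosed (p + 1) (bt v T) := by
  have hT0 := hT.hasOrderZero (Nat.add_sub_cancel' (by omega : p ≤ n))
  refine ⟨⟨fun f => ?_, ?_⟩, fun q hq a f _ hf => ?_⟩
  · rw [bt_eq hv.continuousOn hT0]
    exact iddbar_mem_bideg (fun f =>
      hT0.extend_mem ((isCc_test f).mul_left hv.continuousOn) hT.mem_bideg) f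
  · rw [bt_eq hv.continuousOn hT0]
    exact isClosedForm_iddbar _
  · obtain ⟨w, h1, h2, h3, -⟩ := hv.exists_smooth_approx f.hasCompactSupport f.tsupport_subset
    have hw : IsSmoothApprox v (tsupport f) w := ⟨h1, h2, h3⟩
    exact ge_of_tendsto' (hw.tendsto_lev (q := q + 1) (by omega) hT hv.continuousOn subset_rfl
      (berezin n ∘ₗ LinearMap.mulRight ℂ (posProd a))) fun i =>
        hT.isPositiveOn_lev (hw.contDiff' i) (hw.posSemidef i) q hq a f subset_rfl hf

/-- The convergence of `i∂∂̄w_i ∧ T` to `i∂∂̄(vT)` as measures. -/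
lemma IsSmoothApprox.tendsto_lev_approx {p : ℕ} (hp : p + 1 ≤ n) {T : FormFunctional Ω}
    (hT : IsPositiveClosed p T) {v : Cn n → ℝ} (hv : IsContinuousPSH Ω v) {K L : Set (Cn n)}
    {w : ℕ → Cn n → ℝ} (hw : IsSmoothApprox v L w) (hL : IsCompact L) (hLΩ : L ⊆ Ω)
    (hKL : K ⊆ interior L) {F : Cn n → ℂ} (hF : IsCc Ω F) {g : ℕ → 𝓓(Ω, ℂ)} (hg : Approx F g K)
    (l : Module.Dual ℂ (ConstForm n)) :
    Tendsto (fun i => l (lev _ (hw.contDiff' i) T (g i))) atTop (𝓝 (l (extend (bt v T) F))) := by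
  obtain ⟨q, hq⟩ := Nat.exists_eq_add_of_le hp
  obtain ⟨χ, -, h1, h2, hχL, χ', hχ'⟩ := exists_cutoff hg.isCompact hL hLΩ hKL
  have hχs : tsupport χ' ⊆ L := by
    refine (closure_mono fun z hz => ?_).trans hχL
    simpa [hχ'] using hz
  have hlim := fun (f : 𝓓(Ω, ℂ)) (hf : tsupport f ⊆ L) (l : Module.Dual ℂ (ConstForm n)) =>
    hw.tendsto_lev (q := q + 1) (by omega) hT hv.continuousOn hf l
  have hb : UniformlyBoundedOn (fun i => lev _ (hw.contDiff' i) T) K := by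
    refine uniformlyBoundedOn_of_isPositiveOn (p := p + 1) (q := q) (by omega) (fun i f => ?_)
      (fun i => hT.isPositiveOn_lev (hw.contDiff' i) (hw.posSemidef i)) (χ := χ')
      (fun z => ?_) (fun z hz => ?_) hχs (hKL.trans interior_subset) fun a => ?_
    · rw [lev_apply]
      exact Submodule.sum_mem _ fun j _ => Submodule.sum_mem _ fun k _ => Submodule.smul_mem _ _
        (mul_mem_bideg (dz_mul_dzbar_mem_bideg j k) (hT.mem_bideg _) (add_comm _ _) (add_comm _ _))
    · rw [hχ']
      exact_mod_cast (h2 z).1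
    · rw [hχ', h1.self_of_nhdsSet z hz, Complex.ofReal_one]
    · obtain ⟨C, hC⟩ := (hlim χ' hχs
        (berezin n ∘ₗ LinearMap.mulRight ℂ (posProd a))).norm.bddAbove_range
      exact ⟨C, fun i => hC ⟨i, rfl⟩⟩
  exact tendsto_of_uniformlyBoundedOn hb (fun f hf => hlim f (hf.trans (hKL.trans interior_subset)))
    (((hT.bt hp hv).hasOrderZero hq.symm).extend_spec hF) hg l

lemma IsClosedPure.lev {p : ℕ} {T : FormFunctional Ω} (hT : IsClosedPure p T) (w : Cn n → ℂ)
    (hw : ContDiff ℝ ∞ w) : IsClosedPure (p + 1) (lev w hw T) := by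
  have h : Pluri.lev w hw T = iddbar
      { toFun := fun f => T (mulTest w hw f)
        map_add' := fun f g => by rw [mulTest_add, map_add]
        map_smul' := fun c f => by rw [mulTest_smul, map_smul, RingHom.id_apply] } :=
    LinearMap.ext fun f => hT.lev_eq w hw f
  rw [h]
  exact ⟨iddbar_mem_bideg fun f => hT.mem_bideg _, isClosedForm_iddbar _⟩

lemma lev_comm (v w : Cn n → ℂ) (hv : ContDiff ℝ ∞ v) (hw : ContDiff ℝ ∞ w)
    (T : FormFunctional Ω) (f : 𝓓(Ω, ℂ)) :
    lev v hv (lev w hw T) f = lev w hw (lev v hv T) f := by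
  have h : ∀ (v w : Cn n → ℂ) (hv : ContDiff ℝ ∞ v) (hw : ContDiff ℝ ∞ w),
      lev v hv (lev w hw T) f = ∑ jk : Fin n × Fin n, ∑ lm : Fin n × Fin n,
      Complex.I • Complex.I • (dz jk.1 * dzbar jk.2 * (dz lm.1 * dzbar lm.2 *
        T (mulTest (hess w lm.1 lm.2) (contDiff_hess hw _ _)
          (mulTest (hess v jk.1 jk.2) (contDiff_hess hv _ _) f)))) := by
    intro v w hv hw
    simp_rw [Fintype.sum_prod_type, lev_apply, Finset.mul_sum, Finset.smul_sum, mul_smul_comm]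
  rw [h, h, Finset.sum_comm]
  refine Finset.sum_congr rfl fun jk _ => Finset.sum_congr rfl fun lm _ => ?_
  rw [← mul_assoc, dz_mul_dzbar_comm, mul_assoc]
  congr 5
  ext z
  simp only [mulTest_apply]
  ring

/-- Bedford–Taylor products commute: both products are limits of `i∂∂̄v_i ∧ i∂∂̄u_i ∧ T`. -/
lemma IsPositiveClosed.bt_comm {p : ℕ} (hp : p + 2 ≤ n) {T : FormFunctional Ω}
    (hT : IsPositiveClosed p T) {u v : Cn n → ℝ} (hu : IsContinuousPSH Ω u)
    (hv : IsContinuousPSH Ω v) : Pluri.bt v (Pluri.bt u T) = Pluri.bt u (Pluri.bt v T) := by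
  refine LinearMap.ext fun f => eq_of_forall_dual fun l => ?_
  obtain ⟨L, hL, hKL, hLΩ⟩ := exists_compact_nhds_subset f.hasCompactSupport f.tsupport_subset
  have key : ∀ {u v : Cn n → ℝ} (hu : IsContinuousPSH Ω u) (hv : IsContinuousPSH Ω v)
      {x y : ℕ → Cn n → ℝ} (hx : IsSmoothApprox u L x) (hy : IsSmoothApprox v L y),
      Tendsto (fun i => l (Pluri.lev _ (hy.contDiff' i) (Pluri.lev _ (hx.contDiff' i) T) f)) atTop
        (𝓝 (l (Pluri.bt v (Pluri.bt u T) f))) := by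
    intro u v hu hv x y hx hy
    have hR := (hT.bt (by omega) hu).hasOrderZero (Nat.add_sub_cancel' (by omega : p + 1 ≤ n))
    simp_rw [(hT.lev _ (hx.contDiff' _)).lev_eq, bt_apply hv.continuousOn hR, map_sum]
    refine tendsto_finsetSum _ fun j _ => tendsto_finsetSum _ fun k _ => ?_
    have hs : tsupport (dPartial j (dbarPartial k f)) ⊆ tsupport f :=
      (tsupport_dPartial_subset _ _).trans (tsupport_dbarPartial_subset _ _)
    exact hx.tendsto_lev_approx (by omega) hT hu hL hLΩ (hs.trans hKL)
      ((isCc_test (dPartial j (dbarPartial k f))).mul_left hv.continuousOn)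
      (hy.approx_mulTest (hs.trans (hKL.trans interior_subset)))
      (l ∘ₗ LinearMap.lsmul ℂ _ Complex.I ∘ₗ LinearMap.mulLeft ℂ (dz j * dzbar k))
  obtain ⟨x, x1, x2, x3, -⟩ := hu.exists_smooth_approx hL hLΩ
  obtain ⟨y, y1, y2, y3, -⟩ := hv.exists_smooth_approx hL hLΩ
  have hx : IsSmoothApprox u L x := ⟨x1, x2, x3⟩
  have hy : IsSmoothApprox v L y := ⟨y1, y2, y3⟩
  refine tendsto_nhds_unique (key hu hv hx hy) ?_
  simp_rw [lev_comm _ _ (hy.contDiff' _)]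
  exact key hv hu hy hx

/-! ### Functions of a plurisubharmonic function -/

/-- The function `φ ∘ v` on `Ω`, extended by zero. -/
def compZero (Ω : Opens (Cn n)) (φ : ℝ → ℝ) (v : Cn n → ℝ) : Cn n → ℂ :=
  (Ω : Set (Cn n)).indicator fun z => (φ (v z) : ℂ)

lemma compZero_of_mem {φ : ℝ → ℝ} {v : Cn n → ℝ} {z : Cn n} (hz : z ∈ Ω) :
    compZero Ω φ v z = φ (v z) := indicator_of_mem (s := (Ω : Set (Cn n))) hz _

lemma compZero_of_notMem {φ : ℝ → ℝ} {v : Cn n → ℝ} {z : Cn n} (hz : z ∉ Ω) :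
    compZero Ω φ v z = 0 := indicator_of_notMem (s := (Ω : Set (Cn n))) hz _

lemma isCc_compZero {v : Cn n → ℝ} (hv : ContinuousOn v Ω) {K : Set (Cn n)} (hK : IsCompact K)
    (hKΩ : K ⊆ Ω) {b t : ℝ} (hbt : b < t) (hvK : sublevel Ω v t ⊆ K) {φ : ℝ → ℝ}
    (hφ : Continuous φ) (hφb : ∀ s, b ≤ s → φ s = 0) : IsCc Ω (compZero Ω φ v) := by
  have hs : Function.support (compZero Ω φ v) ⊆ K := by
    intro z hz
    by_cases hzΩ : z ∈ Ω
    · by_contra hzK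
      refine hz ?_
      rw [compZero_of_mem hzΩ, hφb, Complex.ofReal_zero]
      by_contra! h
      exact hzK (hvK ⟨hzΩ, h.trans hbt⟩)
    · exact absurd (compZero_of_notMem hzΩ) hz
  have hts : tsupport (compZero Ω φ v) ⊆ K := closure_minimal hs hK.isClosed
  refine ⟨?_, hK.of_isClosed_subset (isClosed_tsupport _) hts, hts.trans hKΩ⟩
  rw [continuous_iff_continuousAt]
  intro z
  by_cases hz : z ∈ Ω
  · have h : (fun z => (φ (v z) : ℂ)) =ᶠ[𝓝 z] compZero Ω φ v := by
      filter_upwards [Ω.isOpen.mem_nhds hz] with y hy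
      rw [compZero_of_mem hy]
    exact ContinuousAt.congr (Complex.continuous_ofReal.continuousAt.comp
      (hφ.continuousAt.comp (hv.continuousAt (Ω.isOpen.mem_nhds hz)))) h
  · have h : (fun _ => (0 : ℂ)) =ᶠ[𝓝 z] compZero Ω φ v := by
      filter_upwards [hK.isClosed.isOpen_compl.mem_nhds fun h => hz (hKΩ h)] with y hy
      by_contra h
      exact hy (hs (Ne.symm h))
    exact continuousAt_const.congr h

lemma wirt_star (j : Fin n) {w : Cn n → ℝ} (hw : ContDiff ℝ ∞ w) (z : Cn n) :
    star (wirt (-Complex.I) j (fun z => (w z : ℂ)) z)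
      = wirt Complex.I j (fun z => (w z : ℂ)) z := by
  simp [wirt, fderiv_ofReal hw]

lemma wirt_sq_div_two (ε : ℂ) (j : Fin n) {w : Cn n → ℝ} (hw : ContDiff ℝ ∞ w) (z : Cn n) :
    wirt ε j (fun z => ((w z ^ 2 / 2 : ℝ) : ℂ)) z
      = (w z : ℂ) * wirt ε j (fun z => (w z : ℂ)) z := by
  rw [wirt_comp ε j (φ := fun s => s ^ 2 / 2) (by fun_prop) hw]
  simp

lemma hess_sq_div_two (j k : Fin n) {w : Cn n → ℝ} (hw : ContDiff ℝ ∞ w) (z : Cn n) :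
    hess (fun z => ((w z ^ 2 / 2 : ℝ) : ℂ)) j k z
      = wirt (-Complex.I) j (fun z => (w z : ℂ)) z * wirt Complex.I k (fun z => (w z : ℂ)) z
        + (w z : ℂ) * hess (fun z => (w z : ℂ)) j k z := by
  rw [hess, funext (wirt_sq_div_two Complex.I k hw),
    wirt_mul _ _ (contDiff_ofReal hw) (contDiff_wirt _ _ (contDiff_ofReal hw))]
  rfl

/-- `i∂∂̄(w²/2) = w i∂∂̄w + i ∂w ∧ ∂̄w`. -/
lemma levi_sq_div_two {w : Cn n → ℝ} (hw : ContDiff ℝ ∞ w) {z : Cn n} (hz : 0 ≤ w z)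
    (h : (levi w z).PosSemidef) : (levi (fun z => w z ^ 2 / 2) z).PosSemidef := by
  have : levi (fun z => w z ^ 2 / 2) z
      = Matrix.vecMulVec (fun j => wirt (-Complex.I) j (fun z => (w z : ℂ)) z)
        (star fun j => wirt (-Complex.I) j (fun z => (w z : ℂ)) z) + (w z : ℂ) • levi w z := by
    ext j k
    rw [Matrix.add_apply, Matrix.vecMulVec_apply, Pi.star_apply, wirt_star k hw]
    exact hess_sq_div_two j k hw z
  rw [this]
  exact (Matrix.posSemidef_vecMulVec_self_star _).add (h.smul (by exact_mod_cast hz))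

lemma IsSmoothApprox.sq_div_two {v : Cn n → ℝ} {L : Set (Cn n)} {w : ℕ → Cn n → ℝ}
    (hw : IsSmoothApprox v L w) (hw0 : ∀ i z, 0 ≤ w i z) (hL : IsCompact L)
    (hv : ContinuousOn v L) :
    IsSmoothApprox (fun z => v z ^ 2 / 2) L fun i z => w i z ^ 2 / 2 := by
  refine ⟨fun i => ((hw.contDiff i).pow 2).div_const 2,
    fun i z hz => levi_sq_div_two (hw.contDiff i) (hw0 i z) (hw.posSemidef i z hz), ?_⟩
  obtain ⟨M, hM⟩ := hL.exists_bound_of_continuousOn hv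
  rw [Metric.tendstoUniformlyOn_iff]
  intro ε hε
  have hpos : 0 < min 1 (ε / (|M| + 1)) := by positivity
  filter_upwards [Metric.tendstoUniformlyOn_iff.1 hw.tendsto _ hpos] with i hi z hz
  have h1 := hi z hz
  rw [Real.dist_eq] at h1 ⊢
  obtain ⟨h2, h3⟩ := lt_min_iff.1 h1
  have h4 : |v z| ≤ |M| := (hM z hz).trans (le_abs_self M)
  have h5 : |v z + w i z| < 2 * (|M| + 1) := by
    have : v z + w i z = 2 * v z - (v z - w i z) := by ring
    rw [this]
    refine (abs_sub _ _).trans_lt ?_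
    rw [abs_mul, abs_two]
    linarith
  have h6 : v z ^ 2 / 2 - w i z ^ 2 / 2 = (v z - w i z) * (v z + w i z) / 2 := by ring
  rw [h6, abs_div, abs_mul, abs_two, div_lt_iff₀ two_pos]
  rw [lt_div_iff₀ (by positivity)] at h3
  calc |v z - w i z| * |v z + w i z| ≤ |v z - w i z| * (2 * (|M| + 1)) :=
        mul_le_mul_of_nonneg_left h5.le (abs_nonneg _)
    _ < ε * 2 := by linarith

/-- The masses of `φ(w) i∂∂̄(w²/2) ∧ S` and `ψ(w) i∂∂̄w ∧ S` agree if `ψ' = s φ'`, for a cutoff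
function `χ` that is locally constant where `w φ(w) ≠ ψ(w)`: the difference of the two currents is
`i∂((w φ(w) - ψ(w)) ∂̄w) ∧ S`. -/
lemma IsClosedPure.lev_sq_div_two {p : ℕ} {S : FormFunctional Ω} (hS : IsClosedPure p S)
    {w : Cn n → ℝ} (hw : ContDiff ℝ ∞ w) (hw2 : ContDiff ℝ ∞ fun z => ((w z ^ 2 / 2 : ℝ) : ℂ))
    {φ ψ : ℝ → ℝ} (hφ : ContDiff ℝ ∞ φ)
    (hψ : ContDiff ℝ ∞ ψ) (hφψ : ∀ s, deriv ψ s = s * deriv φ s) (χ : 𝓓(Ω, ℂ))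
    (hχ : ∀ z, w z * φ (w z) - ψ (w z) = 0 ∨ χ =ᶠ[𝓝 z] fun _ => χ z) :
    Pluri.lev _ hw2 S
        (mulTest (fun z => (φ (w z) : ℂ)) (contDiff_ofReal (hφ.comp hw)) χ)
      = Pluri.lev _ (contDiff_ofReal hw) S
        (mulTest (fun z => (ψ (w z) : ℂ)) (contDiff_ofReal (hψ.comp hw)) χ) := by
  set Θ : ℝ → ℝ := fun s => s * φ s - ψ s with hΘ
  have hΘc : ContDiff ℝ ∞ Θ := (contDiff_id.mul hφ).sub hψ
  have hΘ' : ∀ s, deriv Θ s = φ s := by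
    intro s
    have h1 := (hasDerivAt_id s).mul (hφ.differentiable (by simp) s).hasDerivAt
    have := (h1.sub (hψ.differentiable (by simp) s).hasDerivAt).deriv
    change deriv Θ s = _ at this
    rw [this, hφψ]
    simp
  have hΘw : ContDiff ℝ ∞ fun z => (Θ (w z) : ℂ) := contDiff_ofReal (hΘc.comp hw)
  have hwk := fun k => contDiff_wirt Complex.I k (contDiff_ofReal hw)
  have key : ∀ j k, mulTest (hess (fun z => ((w z ^ 2 / 2 : ℝ) : ℂ)) j k)
        (contDiff_hess hw2 j k)
        (mulTest (fun z => (φ (w z) : ℂ)) (contDiff_ofReal (hφ.comp hw)) χ)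
      = mulTest (hess (fun z => (w z : ℂ)) j k) (contDiff_hess (contDiff_ofReal hw) j k)
        (mulTest (fun z => (ψ (w z) : ℂ)) (contDiff_ofReal (hψ.comp hw)) χ)
        + dPartial j (mulTest _ (hΘw.mul (hwk k)) χ) := by
    intro j k
    rw [dPartial_mulTest]
    ext z
    rw [FunLike.coe_add, FunLike.coe_add, Pi.add_apply, Pi.add_apply]
    simp only [mulTest_apply]
    have h0 : (Θ (w z) : ℂ) * dPartial j χ z = 0 := by
      rcases hχ z with h | h
      · rw [hΘ]
        simp [h]
      · rw [dPartial_apply, wirt, h.fderiv_eq]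
        simp
    rw [wirt_mul _ _ hΘw (hwk k), wirt_comp _ _ hΘc hw, hΘ', hess_sq_div_two _ _ hw]
    have h1 : (Θ (w z) : ℂ) = w z * φ (w z) - ψ (w z) := by
      rw [hΘ]; push_cast; rfl
    rw [h1] at h0 ⊢
    rw [hess]
    linear_combination (-wirt Complex.I k (fun z => (w z : ℂ)) z) * h0
  rw [lev_apply, lev_apply]
  simp_rw [key, map_add, mul_add, smul_add, Finset.sum_add_distrib]
  have := hS.sum_dPartial fun k => mulTest _ (hΘw.mul (hwk k)) χ
  simp_rw [← Finset.smul_sum, this, smul_zero, add_zero]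

/-- Smooth approximations of `φ ∘ v`, cut off by `χ`. -/
lemma approx_compZero {v : Cn n → ℝ} {K₀ L : Set (Cn n)} {b b' : ℝ} (hb : b < b')
    (hK₀ : ∀ z ∈ Ω, v z ≤ b' → z ∈ K₀) (hLΩ : L ⊆ Ω) {w : ℕ → Cn n → ℝ}
    (hw : IsSmoothApprox v L w) {χ : 𝓓(Ω, ℂ)} (hKL : K₀ ⊆ L) (hχ1 : ∀ z ∈ K₀, χ z = 1)
    (hχL : tsupport χ ⊆ L) {φ : ℝ → ℝ} (hφ : ContDiff ℝ ∞ φ) (hφu : UniformContinuous φ)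
    (hφb : ∀ s, b ≤ s → φ s = 0) :
    Approx (compZero Ω φ v) (fun i => mulTest (fun z => (φ (w i z) : ℂ))
      (contDiff_ofReal (hφ.comp (hw.contDiff i))) χ) (tsupport χ) where
  isCompact := χ.hasCompactSupport
  subset := χ.tsupport_subset
  tsupport_subset _ := tsupport_mulTest_subset _ _ _
  tendsto := by
    rw [Metric.tendstoUniformly_iff]
    intro ε hε
    obtain ⟨δ, hδ, h⟩ := Metric.uniformContinuous_iff.1 hφu ε hε
    have hpos : 0 < min δ (b' - b) := lt_min hδ (sub_pos.2 hb)
    filter_upwards [Metric.tendstoUniformlyOn_iff.1 hw.tendsto _ hpos] with i hi z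
    rw [mulTest_apply]
    by_cases hz : z ∈ K₀
    · rw [compZero_of_mem (hLΩ (hKL hz)), hχ1 z hz, mul_one, dist_eq_norm, ← Complex.ofReal_sub,
        Complex.norm_real, ← dist_eq_norm]
      exact h ((hi z (hKL hz)).trans_le (min_le_left _ _))
    · have h1 : compZero Ω φ v z = 0 := by
        by_cases hzΩ : z ∈ Ω
        · rw [compZero_of_mem hzΩ, hφb, Complex.ofReal_zero]
          by_contra! h'
          exact hz (hK₀ z hzΩ (h'.trans hb).le)
        · exact compZero_of_notMem hzΩ
      have h2 : (φ (w i z) : ℂ) * χ z = 0 := by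
        by_cases hzL : z ∈ L
        · have h3 : b' < v z := by
            by_contra! h'
            exact hz (hK₀ z (hLΩ hzL) h')
          have h4 := (hi z hzL).trans_le (min_le_right _ _)
          rw [Real.dist_eq] at h4
          rw [hφb _ (by linarith [le_abs_self (v z - w i z)]), Complex.ofReal_zero, zero_mul]
        · rw [image_eq_zero_of_notMem_tsupport fun h => hzL (hχL h), mul_zero]
      rw [h1, h2, dist_self]
      exact hε

/-- The currents `φ(v) i∂∂̄(v²/2) ∧ S` and `ψ(v) i∂∂̄v ∧ S` have the same total mass if
`ψ' = s φ'`. -/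
lemma IsPositiveClosed.extend_bt_sq_div_two {p : ℕ} (hp : p + 1 ≤ n) {S : FormFunctional Ω}
    (hS : IsPositiveClosed p S) {v : Cn n → ℝ} (hv : IsContinuousPSH Ω v)
    (hv0 : ∀ z ∈ Ω, 0 ≤ v z) {K : Set (Cn n)} (hK : IsCompact K)
    (hKΩ : K ⊆ Ω) {b t : ℝ} (hbt : b < t) (hvK : sublevel Ω v t ⊆ K) {φ ψ : ℝ → ℝ}
    (hφ : ContDiff ℝ ∞ φ) (hφu : UniformContinuous φ) (hφb : ∀ s, b ≤ s → φ s = 0)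
    (hψ : ContDiff ℝ ∞ ψ) (hψu : UniformContinuous ψ) (hψb : ∀ s, b ≤ s → ψ s = 0)
    (hφψ : ∀ s, deriv ψ s = s * deriv φ s) :
    extend (Pluri.bt (fun z => v z ^ 2 / 2) S) (compZero Ω φ v)
      = extend (Pluri.bt v S) (compZero Ω ψ v) := by
  obtain ⟨b', hbb', hbt'⟩ := exists_between hbt
  -- for large `i`, the functions `φ ∘ w i` and `ψ ∘ w i` vanish on `L` off the compact set `K₀`
  set K₀ := K ∩ v ⁻¹' Iic b'
  have hK₀ : IsCompact K₀ := hK.of_isClosed_subset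
    ((hv.continuousOn.mono hKΩ).preimage_isClosed_of_isClosed hK.isClosed isClosed_Iic)
    inter_subset_left
  have hK₀' : ∀ z ∈ Ω, v z ≤ b' → z ∈ K₀ := fun z hz h =>
    ⟨hvK ⟨hz, h.trans_lt hbt'⟩, h⟩
  obtain ⟨K₁, hK₁, hK₀₁, hK₁Ω⟩ := exists_compact_nhds_subset hK₀ (inter_subset_left.trans hKΩ)
  obtain ⟨L, hL, hK₁L, hLΩ⟩ := exists_compact_nhds_subset hK₁ hK₁Ω
  obtain ⟨χ, -, h1, h2, hχK₁, χ', hχ'⟩ := exists_cutoff hK₀ hK₁ hK₁Ω hK₀₁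
  have hχs : tsupport χ' ⊆ K₁ := by
    refine (closure_mono fun z hz => ?_).trans hχK₁
    simpa [hχ'] using hz
  have hK₁L' : K₁ ⊆ L := hK₁L.trans interior_subset
  have hK₀L : K₀ ⊆ L := hK₀₁.trans (interior_subset.trans hK₁L')
  have hχ1 : ∀ z ∈ K₀, χ' =ᶠ[𝓝 z] fun _ => (1 : ℂ) := by
    intro z hz
    filter_upwards [eventually_nhdsSet_iff_forall.1 h1 z hz] with y hy
    rw [hχ', hy, Complex.ofReal_one]
  obtain ⟨w, w1, w2, w3, w4⟩ := hv.exists_smooth_approx hL hLΩ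
  have hw : IsSmoothApprox v L w := ⟨w1, w2, w3⟩
  have hw2 := hw.sq_div_two (w4 hv0) hL (hv.continuousOn.mono hLΩ)
  have hsq := hv.sq_div_two hv0
  refine eq_of_forall_dual fun l => ?_
  have t1 := hw2.tendsto_lev_approx hp hS hsq hL hLΩ (hχs.trans hK₁L)
    (isCc_compZero hv.continuousOn hK hKΩ hbt hvK hφ.continuous hφb)
    (approx_compZero hbb' hK₀' hLΩ hw hK₀L (fun z hz => (hχ1 z hz).self_of_nhds)
      (hχs.trans hK₁L') hφ hφu hφb) l
  have t2 := hw.tendsto_lev_approx hp hS hv hL hLΩ (hχs.trans hK₁L)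
    (isCc_compZero hv.continuousOn hK hKΩ hbt hvK hψ.continuous hψb)
    (approx_compZero hbb' hK₀' hLΩ hw hK₀L (fun z hz => (hχ1 z hz).self_of_nhds)
      (hχs.trans hK₁L') hψ hψu hψb) l
  refine tendsto_nhds_unique_of_eventuallyEq t1 t2 ?_
  filter_upwards [Metric.tendstoUniformlyOn_iff.1 hw.tendsto _ (sub_pos.2 hbb')] with i hi
  congr 1
  refine hS.lev_sq_div_two (hw.contDiff i) _ hφ hψ hφψ χ' fun z => ?_
  by_cases hz : z ∈ L
  · rcases le_or_gt b (w i z) with h | h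
    · left
      rw [hφb _ h, hψb _ h, mul_zero, sub_zero]
    · right
      have h3 := hi z hz
      rw [Real.dist_eq] at h3
      have h4 : z ∈ K₀ := hK₀' z (hLΩ hz) (by linarith [le_abs_self (v z - w i z)])
      rw [(hχ1 z h4).self_of_nhds]
      exact hχ1 z h4
  · right
    have hz' : z ∉ tsupport χ' := fun h => hz (hK₁L' (hχs h))
    rw [image_eq_zero_of_notMem_tsupport hz']
    exact notMem_tsupport_iff_eventuallyEq.1 hz'

/-! ### Comparison of the two products on decreasing functions of `v` -/

/-- Smooth decreasing functions that are constant on `(-∞, a]` and vanish on `[b, ∞)`. -/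
structure IsDecreasingCutoff (a b : ℝ) (φ : ℝ → ℝ) : Prop where
  contDiff : ContDiff ℝ ∞ φ
  deriv_nonpos : ∀ s, deriv φ s ≤ 0
  deriv_eq_zero : ∀ s < a, deriv φ s = 0
  eq_zero : ∀ s, b ≤ s → φ s = 0

lemma IsDecreasingCutoff.deriv_eq_zero' {a b : ℝ} {φ : ℝ → ℝ} (hφ : IsDecreasingCutoff a b φ)
    {s : ℝ} (hs : b < s) : deriv φ s = 0 := by
  have : φ =ᶠ[𝓝 s] fun _ => 0 := by
    filter_upwards [lt_mem_nhds hs] with r hr using hφ.eq_zero r hr.le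
  rw [this.deriv_eq, deriv_const]

lemma IsDecreasingCutoff.uniformContinuous {a b : ℝ} {φ : ℝ → ℝ}
    (hφ : IsDecreasingCutoff a b φ) : UniformContinuous φ := by
  have hc : Continuous (deriv φ) := hφ.contDiff.continuous_deriv (by simp)
  obtain ⟨C, hC⟩ := (isCompact_Icc (a := a) (b := b)).exists_bound_of_continuousOn hc.continuousOn
  refine (lipschitzWith_of_nnnorm_deriv_le (C := (max C 0).toNNReal)
    (hφ.contDiff.differentiable (by simp)) fun s => ?_).uniformContinuous
  rw [← NNReal.coe_le_coe, coe_nnnorm, Real.coe_toNNReal _ (le_max_right _ _)]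
  rcases lt_or_ge s a with h | h
  · rw [hφ.deriv_eq_zero s h, norm_zero]
    exact le_max_right _ _
  rcases lt_or_ge b s with h' | h'
  · rw [hφ.deriv_eq_zero' h', norm_zero]
    exact le_max_right _ _
  · exact (hC s ⟨h, h'⟩).trans (le_max_left _ _)

/-- The primitive `ψ` of `s φ'(s)` satisfies `a φ ≤ ψ ≤ b φ`. -/
lemma IsDecreasingCutoff.exists_primitive {a b : ℝ} (ha : 0 ≤ a) {φ : ℝ → ℝ}
    (hφ : IsDecreasingCutoff a b φ) : ∃ ψ, IsDecreasingCutoff a b ψ ∧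
      (∀ s, deriv ψ s = s * deriv φ s) ∧ ∀ s, a * φ s ≤ ψ s ∧ ψ s ≤ b * φ s := by
  have hc : Continuous fun s => s * deriv φ s :=
    continuous_id.mul (hφ.contDiff.continuous_deriv (by simp))
  set ψ : ℝ → ℝ := fun s => ∫ r in b..s, r * deriv φ r with hψ
  have hd : ∀ s, HasDerivAt ψ (s * deriv φ s) s := fun s =>
    (hc.integral_hasStrictDerivAt b s).hasDerivAt
  have hφd : ∀ s, HasDerivAt φ (deriv φ s) s := fun s =>
    (hφ.contDiff.differentiable (by simp) s).hasDerivAt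
  have hψb : ∀ s, b ≤ s → ψ s = 0 := by
    intro s hs
    rw [hψ]
    simp only
    rw [intervalIntegral.integral_of_le hs]
    exact setIntegral_eq_zero_of_forall_eq_zero fun r hr => by
      rw [hφ.deriv_eq_zero' hr.1, mul_zero]
  have hnonpos : ∀ s, s * deriv φ s ≤ 0 := by
    intro s
    rcases lt_or_ge s a with h | h
    · rw [hφ.deriv_eq_zero s h, mul_zero]
    · exact mul_nonpos_of_nonneg_of_nonpos (ha.trans h) (hφ.deriv_nonpos s)
  refine ⟨ψ, ⟨?_, fun s => ?_, fun s hs => ?_, hψb⟩, fun s => (hd s).deriv, fun s => ?_⟩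
  · rw [contDiff_infty_iff_deriv]
    refine ⟨fun s => (hd s).differentiableAt, ?_⟩
    rw [funext fun s => (hd s).deriv]
    exact contDiff_id.mul ((contDiff_infty_iff_deriv.1 hφ.contDiff).2)
  · rw [(hd s).deriv]
    exact hnonpos s
  · rw [(hd s).deriv, hφ.deriv_eq_zero s hs, mul_zero]
  · rcases le_or_gt b s with h | h
    · rw [hψb s h, hφ.eq_zero s h, mul_zero, mul_zero]
      exact ⟨le_rfl, le_rfl⟩
    have e1 : Antitone fun s => ψ s - a * φ s := by
      have hd' : ∀ s, HasDerivAt (fun s => ψ s - a * φ s) (s * deriv φ s - a * deriv φ s) s :=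
        fun s => (hd s).sub ((hφd s).const_mul a)
      refine antitone_of_deriv_nonpos (fun s => (hd' s).differentiableAt) fun s => ?_
      rw [(hd' s).deriv, ← sub_mul]
      rcases lt_or_ge s a with h | h
      · rw [hφ.deriv_eq_zero s h, mul_zero]
      · exact mul_nonpos_of_nonneg_of_nonpos (sub_nonneg.2 h) (hφ.deriv_nonpos s)
    have e2 : Antitone fun s => b * φ s - ψ s := by
      have hd' : ∀ s, HasDerivAt (fun s => b * φ s - ψ s) (b * deriv φ s - s * deriv φ s) s :=
        fun s => ((hφd s).const_mul b).sub (hd s)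
      refine antitone_of_deriv_nonpos (fun s => (hd' s).differentiableAt) fun s => ?_
      rw [(hd' s).deriv, ← sub_mul]
      rcases lt_or_ge b s with h | h
      · rw [hφ.deriv_eq_zero' h, mul_zero]
      · exact mul_nonpos_of_nonneg_of_nonpos (sub_nonneg.2 h) (hφ.deriv_nonpos s)
    have h1 := e1 h.le
    have h2 := e2 h.le
    simp only [hψb b le_rfl, hφ.eq_zero b le_rfl] at h1 h2
    constructor <;> linarith

lemma IsPositiveClosed.extend_nonneg {S : FormFunctional Ω} (hS : IsPositiveClosed n S)
    {F : Cn n → ℂ} (hF : IsCc Ω F) (hF0 : ∀ z, 0 ≤ F z) : 0 ≤ berezin n (extend S F) := by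
  obtain ⟨g, K, hg, hg0⟩ := hF.exists_approx
  refine ge_of_tendsto' ((hS.hasOrderZero (add_zero n)).extend_spec hF g K hg (berezin n))
    fun i => ?_
  simpa [posProd_zero] using hS.isPositive 0 (add_zero n) (fun i => i.elim0) (g i) (subset_univ _)
    (hg0 hF0 i)

lemma IsPositiveClosed.extend_mono {S : FormFunctional Ω} (hS : IsPositiveClosed n S)
    {F G : Cn n → ℂ} (hF : IsCc Ω F) (hG : IsCc Ω G) (h : ∀ z, F z ≤ G z) :
    berezin n (extend S F) ≤ berezin n (extend S G) := by
  have hS0 := hS.hasOrderZero (add_zero n)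
  have h1 := hS.extend_nonneg (hG.add (hF.const_mul (-1))) fun z => by
    simpa [← sub_eq_add_neg] using h z
  rw [hS0.extend_add hG (hF.const_mul (-1)), hS0.extend_const_mul hF, map_add, map_smul] at h1
  simpa [← sub_eq_add_neg] using h1

lemma IsPositiveClosed.iterate_bt {p k : ℕ} (hpk : p + k ≤ n) {T : FormFunctional Ω}
    (hT : IsPositiveClosed p T) {v : Cn n → ℝ} (hv : IsContinuousPSH Ω v) :
    IsPositiveClosed (p + k) ((Pluri.bt v)^[k] T) := by
  induction k with
  | zero => exact hT
  | succ k ih =>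
    rw [Function.iterate_succ_apply']
    exact (ih (by omega)).bt (by omega) hv

lemma IsPositiveClosed.bt_iterate_comm {p k : ℕ} (hpk : p + k + 1 ≤ n) {T : FormFunctional Ω}
    (hT : IsPositiveClosed p T) {u v : Cn n → ℝ} (hu : IsContinuousPSH Ω u)
    (hv : IsContinuousPSH Ω v) :
    Pluri.bt v ((Pluri.bt u)^[k] T) = (Pluri.bt u)^[k] (Pluri.bt v T) := by
  induction k with
  | zero => rfl
  | succ k ih =>
    rw [Function.iterate_succ_apply', Function.iterate_succ_apply', ← ih (by omega),
      (hT.iterate_bt (by omega) hu).bt_comm (by omega) hu hv]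

/-- For decreasing cutoff functions `φ`, the masses of `φ(v) (i∂∂̄(v²/2))^k ∧ T` and of
`φ(v) (i∂∂̄v)^k ∧ T` differ by a factor between `a^k` and `b^k`. In each step one factor
`i∂∂̄(v²/2)` is traded for `i∂∂̄v`, which is absorbed into `T`. -/
lemma IsPositiveClosed.extend_iterate_bounds {v : Cn n → ℝ} (hv : IsContinuousPSH Ω v)
    (hv0 : ∀ z ∈ Ω, 0 ≤ v z) {K : Set (Cn n)} (hK : IsCompact K) (hKΩ : K ⊆ Ω) {a b t : ℝ}
    (ha : 0 ≤ a) (hb : 0 ≤ b) (hbt : b < t) (hvK : sublevel Ω v t ⊆ K) (k : ℕ) :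
    ∀ {p : ℕ} (_ : p + k = n) {T : FormFunctional Ω} (_ : IsPositiveClosed p T) {φ : ℝ → ℝ}
      (_ : IsDecreasingCutoff a b φ),
      (a : ℂ) ^ k * berezin n (extend ((Pluri.bt v)^[k] T) (compZero Ω φ v))
        ≤ berezin n (extend ((Pluri.bt fun z => v z ^ 2 / 2)^[k] T) (compZero Ω φ v)) ∧
      berezin n (extend ((Pluri.bt fun z => v z ^ 2 / 2)^[k] T) (compZero Ω φ v))
        ≤ (b : ℂ) ^ k * berezin n (extend ((Pluri.bt v)^[k] T) (compZero Ω φ v)) := by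
  induction k with
  | zero => intros; simp
  | succ k ih =>
    intro p hpk T hT φ hφ
    obtain ⟨ψ, hψ, hψ', hab⟩ := hφ.exists_primitive ha
    have hsq := hv.sq_div_two hv0
    have hS := hT.iterate_bt (k := k) (by omega) hsq
    have e1 : extend ((Pluri.bt fun z => v z ^ 2 / 2)^[k + 1] T) (compZero Ω φ v)
        = extend ((Pluri.bt fun z => v z ^ 2 / 2)^[k] (Pluri.bt v T)) (compZero Ω ψ v) := by
      rw [Function.iterate_succ_apply', hS.extend_bt_sq_div_two (by omega) hv hv0 hK hKΩ hbt hvK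
        hφ.contDiff hφ.uniformContinuous hφ.eq_zero hψ.contDiff hψ.uniformContinuous hψ.eq_zero
        hψ', hT.bt_iterate_comm (by omega) hsq hv]
    obtain ⟨h1, h2⟩ := ih (p := p + 1) (by omega) (hT.bt (by omega) hv) hψ
    have hN : IsPositiveClosed n ((Pluri.bt v)^[k] (Pluri.bt v T)) := by
      have := hT.iterate_bt (k := k + 1) (by omega) hv
      rwa [hpk] at this
    have hN0 := hN.hasOrderZero (add_zero n)
    have cφ := isCc_compZero hv.continuousOn hK hKΩ hbt hvK hφ.contDiff.continuous hφ.eq_zero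
    have cψ := isCc_compZero hv.continuousOn hK hKΩ hbt hvK hψ.contDiff.continuous hψ.eq_zero
    have m1 := hN.extend_mono (cφ.const_mul a) cψ fun z => by
      by_cases hz : z ∈ Ω
      · rw [compZero_of_mem hz, compZero_of_mem hz]
        exact_mod_cast (hab (v z)).1
      · rw [compZero_of_notMem hz, compZero_of_notMem hz, mul_zero]
    have m2 := hN.extend_mono cψ (cφ.const_mul b) fun z => by
      by_cases hz : z ∈ Ω
      · rw [compZero_of_mem hz, compZero_of_mem hz]
        exact_mod_cast (hab (v z)).2
      · rw [compZero_of_notMem hz, compZero_of_notMem hz, mul_zero]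
    rw [hN0.extend_const_mul cφ, map_smul, smul_eq_mul] at m1 m2
    rw [e1, Function.iterate_succ_apply]
    have ha' : (0 : ℂ) ≤ (a : ℂ) ^ k := by exact_mod_cast pow_nonneg ha k
    have hb' : (0 : ℂ) ≤ (b : ℂ) ^ k := by exact_mod_cast pow_nonneg hb k
    constructor
    · refine le_trans ?_ h1
      rw [pow_succ, mul_assoc]
      exact mul_le_mul_of_nonneg_left m1 ha'
    · refine h2.trans ?_
      rw [pow_succ, mul_assoc]
      exact mul_le_mul_of_nonneg_left m2 hb'

/-! ### Iterated Bedford–Taylor products -/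

/-- The Bedford–Taylor product exists, is unique, and is obtained by iterating `bt w`. -/
lemma IsPositiveClosed.isBTProduct_iff {p k : ℕ} (hpk : p + k ≤ n) {T : FormFunctional Ω}
    (hT : IsPositiveClosed p T) {w : Cn n → ℝ} (hw : IsContinuousPSH Ω w)
    {S : FormFunctional Ω} : IsBTProduct w T k S ↔ S = (Pluri.bt w)^[k] T := by
  induction k generalizing S with
  | zero => rfl
  | succ k ih =>
    have hR := (hT.iterate_bt (k := k) (by omega) hw).hasOrderZero
      (Nat.add_sub_cancel' (by omega : p + k ≤ n))
    rw [Function.iterate_succ_apply', bt_eq hw.continuousOn hR]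
    constructor
    · rintro ⟨R, P, h1, h2, rfl⟩
      rw [ih (by omega)] at h1
      subst h1
      rw [h2.unique hw.continuousOn (isProductWith_product hw.continuousOn hR)]
    · rintro rfl
      exact ⟨_, _, (ih (by omega)).2 rfl, isProductWith_product hw.continuousOn hR, rfl⟩

/-! ### Closed positive currents of bidegree `(1,1)` -/

lemma berezin_posProd_nonneg {q : ℕ} (hq : q = n) (a : Fin q → Fin n → ℂ) :
    0 ≤ berezin n (posProd a) := by
  subst hq
  exact berezin_posProd_nonneg_self a

/-- Each test function is a linear combination of nonnegative ones, so a submodule that contains the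
values of `T` on nonnegative test functions contains all values. -/
lemma mem_of_forall_nonneg {T : FormFunctional Ω} {W : Submodule ℂ (ConstForm n)}
    (h : ∀ f : 𝓓(Ω, ℂ), (∀ z, 0 ≤ f z) → T f ∈ W) (f : 𝓓(Ω, ℂ)) : T f ∈ W := by
  obtain ⟨L, hL, hKL, hLΩ⟩ := exists_compact_nhds_subset f.hasCompactSupport f.tsupport_subset
  obtain ⟨χ, -, h1, h2, -, χ', hχ'⟩ := exists_cutoff f.hasCompactSupport hL hLΩ hKL
  obtain ⟨M, hM⟩ := f.continuous.bounded_above_of_compact_support f.hasCompactSupport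
  have hχ0 : ∀ z, 0 ≤ χ' z := fun z => by
    rw [hχ']
    exact_mod_cast (h2 z).1
  have hre : ∀ g : 𝓓(Ω, ℂ), tsupport g ⊆ tsupport f → (∀ z, ‖g z‖ ≤ M) → T (reTest g) ∈ W := by
    intro g hg hgM
    have e : reTest g = (reTest g + (M : ℂ) • χ') - (M : ℂ) • χ' := by abel
    rw [e, map_sub, map_smul]
    refine W.sub_mem (h _ fun z => ?_) (W.smul_mem _ (h _ hχ0))
    rw [FunLike.coe_add, FunLike.coe_smul, Pi.add_apply, Pi.smul_apply, reTest_apply, hχ',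
      smul_eq_mul]
    by_cases hz : z ∈ tsupport f
    · rw [h1.self_of_nhdsSet z hz]
      have := (neg_le_abs _).trans ((Complex.abs_re_le_norm (g z)).trans (hgM z))
      exact_mod_cast (by linarith : 0 ≤ (g z).re + M * 1)
    · rw [image_eq_zero_of_notMem_tsupport fun h => hz (hg h)]
      have hM0 : 0 ≤ M := (norm_nonneg _).trans (hM z)
      have := mul_nonneg hM0 (h2 z).1
      simpa using (by exact_mod_cast this : (0 : ℂ) ≤ M * χ z)
  have hdec : f = reTest f + Complex.I • reTest ((-Complex.I) • f) := by
    ext z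
    rw [FunLike.coe_add, Pi.add_apply, FunLike.coe_smul, Pi.smul_apply, reTest_apply,
      reTest_apply, FunLike.coe_smul, Pi.smul_apply]
    apply Complex.ext <;> simp
  rw [hdec, map_add, map_smul]
  refine W.add_mem (hre f subset_rfl hM) (W.smul_mem _ (hre _
    (tsupport_smul_subset_right (fun _ => -Complex.I) f) fun z => ?_))
  rw [FunLike.coe_smul, Pi.smul_apply, norm_smul]
  simpa using hM z

lemma IsClosedPositiveCurrent.isPositiveClosed {θ : FormFunctional Ω}
    (hθ : IsClosedPositiveCurrent θ) : IsPositiveClosed 1 θ := by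
  refine ⟨⟨mem_of_forall_nonneg fun f hf => ?_, hθ.isClosed⟩, fun q hq a f _ hf => ?_⟩
  · obtain ⟨h, -, e⟩ := hθ.isPositive f hf
    rw [e]
    exact Submodule.sum_mem _ fun j _ => Submodule.sum_mem _ fun k _ =>
      Submodule.smul_mem _ _ (dz_mul_dzbar_mem_bideg j k)
  · obtain ⟨h, hh, e⟩ := hθ.isPositive f hf
    obtain ⟨b, hb⟩ := exists_sum_posForm hh
    rw [e, hb, Finset.sum_mul, map_sum]
    refine Finset.sum_nonneg fun l _ => ?_
    rw [← posProd_cons]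
    exact berezin_posProd_nonneg (by omega) _

/-! ### Multiplication by powers of the Kähler form -/

/-- The current `T ∧ c` for a constant form `c`. -/
def mulConst (c : ConstForm n) (T : FormFunctional Ω) : FormFunctional Ω :=
  LinearMap.mulRight ℂ c ∘ₗ T

lemma mulConst_apply (c : ConstForm n) (T : FormFunctional Ω) (f : 𝓓(Ω, ℂ)) :
    mulConst c T f = T f * c := rfl

lemma HasOrderZero.mulConst {T : FormFunctional Ω} (hT : HasOrderZero T) (c : ConstForm n) :
    HasOrderZero (mulConst c T) := fun K hK hKΩ l => hT K hK hKΩ (l ∘ₗ LinearMap.mulRight ℂ c)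

lemma HasOrderZero.extend_mulConst {T : FormFunctional Ω} (hT : HasOrderZero T) (c : ConstForm n)
    {F : Cn n → ℂ} (hF : IsCc Ω F) : extend (Pluri.mulConst c T) F = extend T F * c :=
  IsExtValue.eq_extend (hT.mulConst c) hF fun g K hg l =>
    hT.extend_spec hF g K hg (l ∘ₗ LinearMap.mulRight ℂ c)

lemma bt_mulConst {T : FormFunctional Ω} (hT : HasOrderZero T) (c : ConstForm n)
    {w : Cn n → ℝ} (hw : ContinuousOn w Ω) : bt w (mulConst c T) = mulConst c (bt w T) := by
  refine LinearMap.ext fun f => ?_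
  rw [mulConst_apply, bt_apply hw (hT.mulConst c), bt_apply hw hT]
  simp_rw [Finset.sum_mul, smul_mul_assoc, mul_assoc]
  refine Finset.sum_congr rfl fun j _ => Finset.sum_congr rfl fun k _ => ?_
  rw [hT.extend_mulConst c ((isCc_test (dPartial j (dbarPartial k f))).mul_left hw)]

lemma IsPositiveClosed.iterate_bt_mulConst {p k : ℕ} (hpk : p + k ≤ n) {T : FormFunctional Ω}
    (hT : IsPositiveClosed p T) {w : Cn n → ℝ} (hw : IsContinuousPSH Ω w) (c : ConstForm n) :
    (Pluri.bt w)^[k] (mulConst c T) = mulConst c ((Pluri.bt w)^[k] T) := by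
  induction k with
  | zero => rfl
  | succ k ih =>
    rw [Function.iterate_succ_apply', Function.iterate_succ_apply', ih (by omega), bt_mulConst
      ((hT.iterate_bt (k := k) (by omega) hw).hasOrderZero
        (Nat.add_sub_cancel' (by omega : p + k ≤ n))) c hw.continuousOn]

lemma IsPositiveClosed.mulConst_kahler {p : ℕ} {T : FormFunctional Ω}
    (hT : IsPositiveClosed p T) : IsPositiveClosed (p + 1) (mulConst (kahler n) T) := by
  refine ⟨⟨fun f => mul_mem_bideg (hT.mem_bideg f) kahler_mem_bideg rfl rfl, fun f => ?_⟩,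
    fun q hq a f _ hf => ?_⟩
  · have := congrArg (· * kahler n) (hT.isClosed f)
    simp only [neg_mul, Finset.sum_mul, add_mul, zero_mul, mul_assoc] at this
    simpa only [mulConst_apply] using this
  · rw [mulConst_apply, kahler_eq_sum, Finset.mul_sum, Finset.sum_mul, map_sum]
    refine Finset.sum_nonneg fun j _ => ?_
    rw [mul_assoc, ← posProd_cons]
    exact hT.isPositive (q + 1) (by omega) _ f (subset_univ _) hf

lemma IsPositiveClosed.mulConst_kahler_pow {p : ℕ} {T : FormFunctional Ω}
    (hT : IsPositiveClosed p T) (q : ℕ) : IsPositiveClosed (p + q) (mulConst (kahler n ^ q) T) := by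
  induction q with
  | zero =>
    have : mulConst (kahler n ^ 0) T = T := LinearMap.ext fun f => by
      rw [mulConst_apply, pow_zero, mul_one]
    rwa [this]
  | succ q ih =>
    have : mulConst (kahler n ^ (q + 1)) T = mulConst (kahler n) (mulConst (kahler n ^ q) T) :=
      LinearMap.ext fun f => by
        simp only [mulConst_apply, pow_succ, mul_assoc]
    rw [this]
    exact ih.mulConst_kahler

/-! ### Currents of top degree are measures -/

/-- `μ` is a Radon measure on `Ω`, extended by zero, that represents the current `S` of top
degree. -/
structure Represents (S : FormFunctional Ω) (μ : Measure (Cn n)) : Prop where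
  integral_eq : ∀ f : 𝓓(Ω, ℂ), ∫ z, f z ∂μ = berezin n (S f)
  finite_on_compacts : ∀ K : Set (Cn n), IsCompact K → K ⊆ Ω → μ K < ⊤
  compl_null : μ (Ω : Set (Cn n))ᶜ = 0

lemma integrable_of_bound {μ : Measure (Cn n)} {K : Set (Cn n)} (hK : IsCompact K) (hμ : μ K < ⊤)
    {F : Cn n → ℂ} (hF : Continuous F) (hFK : tsupport F ⊆ K) : Integrable F μ := by
  rw [← integrableOn_iff_integrable_of_support_subset ((subset_tsupport F).trans hFK)]
  obtain ⟨C, hC⟩ := hF.bounded_above_of_compact_support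
    (hK.of_isClosed_subset (isClosed_tsupport F) hFK)
  have : IsFiniteMeasure (μ.restrict K) := ⟨by rwa [Measure.restrict_apply_univ]⟩
  exact (integrable_const C).mono' hF.aestronglyMeasurable (Eventually.of_forall hC)

/-- The integral of a continuous function with compact support is the value of the extension. -/
lemma Represents.integral_eq_extend {S : FormFunctional Ω} (hS : HasOrderZero S)
    {μ : Measure (Cn n)} (hμ : Represents S μ) {F : Cn n → ℂ} (hF : IsCc Ω F) :
    ∫ z, F z ∂μ = berezin n (extend S F) := by
  obtain ⟨g, K, hg, -⟩ := hF.exists_approx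
  refine tendsto_nhds_unique ?_ (hS.extend_spec hF g K hg (berezin n))
  simp_rw [← hμ.integral_eq]
  have hFK : tsupport F ⊆ K := by
    refine closure_minimal (fun z hz => ?_) hg.isCompact.isClosed
    by_contra hzK
    refine hz (tendsto_nhds_unique (hg.tendsto.tendsto_at z) ?_)
    have : ∀ i, g i z = 0 := fun i =>
      image_eq_zero_of_notMem_tsupport fun h => hzK (hg.tsupport_subset i h)
    simp [this]
  have hμK := hμ.finite_on_compacts K hg.isCompact hg.subset
  have hgi : ∀ i, ∫ z, g i z ∂μ = ∫ z in K, g i z ∂μ := fun i =>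
    (setIntegral_eq_integral_of_forall_compl_eq_zero fun z hz =>
      image_eq_zero_of_notMem_tsupport fun h => hz (hg.tsupport_subset i h)).symm
  have hFi : ∫ z, F z ∂μ = ∫ z in K, F z ∂μ :=
    (setIntegral_eq_integral_of_forall_compl_eq_zero fun z hz =>
      image_eq_zero_of_notMem_tsupport fun h => hz (hFK h)).symm
  simp_rw [hgi, hFi]
  have : IsFiniteMeasure (μ.restrict K) := ⟨by rwa [Measure.restrict_apply_univ]⟩
  obtain ⟨C, hC⟩ := hF.continuous.bounded_above_of_compact_support hF.hasCompactSupport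
  obtain ⟨N, hN⟩ := hg.norm_sub_le one_pos
  refine tendsto_integral_filter_of_dominated_convergence (fun _ => C + 1)
    (Eventually.of_forall fun i => (g i).continuous.aestronglyMeasurable) ?_ (integrable_const _)
    (Eventually.of_forall fun z => hg.tendsto.tendsto_at z)
  filter_upwards [eventually_ge_atTop N] with i hi
  refine Eventually.of_forall fun z => ?_
  have e : g i z = F z - (F z - g i z) := by ring
  rw [e]
  exact (norm_sub_le _ _).trans (add_le_add (hC z) (hN i hi z))

instance : LocallyCompactSpace Ω := Ω.isOpen.locallyCompactSpace

/-- The extension by zero of a continuous function on `Ω` with compact support. -/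
def extendZero (f : CompactlySupportedContinuousMap Ω ℝ) (z : Cn n) : ℂ :=
  ((Subtype.val.extend f 0 z : ℝ) : ℂ)

lemma extendZero_coe (f : CompactlySupportedContinuousMap Ω ℝ) (z : Ω) :
    extendZero f z = f z := by
  rw [extendZero, Subtype.val_injective.extend_apply]

lemma extendZero_of_notMem (f : CompactlySupportedContinuousMap Ω ℝ) {z : Cn n} (hz : z ∉ Ω) :
    extendZero f z = 0 := by
  rw [extendZero, Function.extend_apply', Pi.zero_apply, Complex.ofReal_zero]
  rintro ⟨y, rfl⟩
  exact hz y.2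

lemma ext_extendZero {F G : Cn n → ℂ} (h : ∀ z : Ω, F z = G z) (h' : ∀ z ∉ Ω, F z = G z) :
    F = G := by
  funext z
  by_cases hz : z ∈ Ω
  · exact h ⟨z, hz⟩
  · exact h' z hz

lemma isCc_extendZero (f : CompactlySupportedContinuousMap Ω ℝ) : IsCc Ω (extendZero f) := by
  have hK : IsCompact (Subtype.val '' tsupport f) :=
    f.hasCompactSupport.isCompact.image continuous_subtype_val
  have hs : Function.support (extendZero f) ⊆ Subtype.val '' tsupport f := by
    intro z hz
    by_cases hzΩ : z ∈ Ω
    · refine ⟨⟨z, hzΩ⟩, subset_tsupport _ ?_, rfl⟩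
      have h := extendZero_coe f ⟨z, hzΩ⟩
      intro h0
      rw [h0, Complex.ofReal_zero] at h
      exact hz h
    · exact absurd (extendZero_of_notMem f hzΩ) hz
  have hts : tsupport (extendZero f) ⊆ Subtype.val '' tsupport f :=
    closure_minimal hs hK.isClosed
  refine ⟨?_, hK.of_isClosed_subset (isClosed_tsupport _) hts, hts.trans ?_⟩
  · exact Complex.continuous_ofReal.comp
      (f.hasCompactSupport.continuous_extend_zero Ω.isOpen f.continuous)
  · rintro _ ⟨z, -, rfl⟩
    exact z.2

lemma extendZero_add (f g : CompactlySupportedContinuousMap Ω ℝ) :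
    extendZero (f + g) = fun z => extendZero f z + extendZero g z := by
  refine ext_extendZero (Ω := Ω) (fun z => ?_) fun z hz => ?_
  · rw [extendZero_coe, extendZero_coe, extendZero_coe]
    simp
  · rw [extendZero_of_notMem _ hz, extendZero_of_notMem _ hz, extendZero_of_notMem _ hz, add_zero]

lemma extendZero_smul (c : ℝ) (f : CompactlySupportedContinuousMap Ω ℝ) :
    extendZero (c • f) = fun z => (c : ℂ) * extendZero f z := by
  refine ext_extendZero (Ω := Ω) (fun z => ?_) fun z hz => ?_
  · rw [extendZero_coe, extendZero_coe]
    simp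
  · rw [extendZero_of_notMem _ hz, extendZero_of_notMem _ hz, mul_zero]

/-- The positive linear functional on `C_c(Ω)` defined by a positive current of top degree. -/
def rieszFunctional {S : FormFunctional Ω} (hS : IsPositiveClosed n S) :
    CompactlySupportedContinuousMap Ω ℝ →ₚ[ℝ] ℝ :=
  PositiveLinearMap.mk₀
    { toFun := fun f => (berezin n (extend S (extendZero f))).re
      map_add' := fun f g => by
        rw [extendZero_add, (hS.hasOrderZero (add_zero n)).extend_add (isCc_extendZero f)
          (isCc_extendZero g), map_add, Complex.add_re]
      map_smul' := fun c f => by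
        rw [extendZero_smul, (hS.hasOrderZero (add_zero n)).extend_const_mul (isCc_extendZero f),
          map_smul]
        simp }
    fun f hf => by
      refine (Complex.nonneg_iff.1 (hS.extend_nonneg (isCc_extendZero f) fun z => ?_)).1
      by_cases hz : z ∈ Ω
      · rw [extendZero_coe f ⟨z, hz⟩]
        exact_mod_cast hf ⟨z, hz⟩
      · rw [extendZero_of_notMem f hz]

lemma rieszFunctional_apply {S : FormFunctional Ω} (hS : IsPositiveClosed n S)
    (f : CompactlySupportedContinuousMap Ω ℝ) :
    rieszFunctional hS f = (berezin n (extend S (extendZero f))).re := rfl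

lemma IsPositiveClosed.berezin_im_eq_zero {S : FormFunctional Ω} (hS : IsPositiveClosed n S)
    (f : CompactlySupportedContinuousMap Ω ℝ) : (berezin n (extend S (extendZero f))).im = 0 := by
  have hS0 := hS.hasOrderZero (add_zero n)
  have hsub : f = f⁺ - f⁻ := (posPart_sub_negPart f).symm
  have hnn : ∀ g : CompactlySupportedContinuousMap Ω ℝ, 0 ≤ g →
      (berezin n (extend S (extendZero g))).im = 0 := by
    intro g hg
    refine ((Complex.nonneg_iff.1 (hS.extend_nonneg (isCc_extendZero g) fun z => ?_)).2).symm
    by_cases hz : z ∈ Ω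
    · rw [extendZero_coe g ⟨z, hz⟩]
      exact_mod_cast hg ⟨z, hz⟩
    · rw [extendZero_of_notMem g hz]
  have e : extendZero f = fun z => extendZero f⁺ z + (-1) * extendZero f⁻ z := by
    conv_lhs => rw [hsub, sub_eq_add_neg, ← neg_one_smul ℝ, extendZero_add, extendZero_smul]
    simp
  rw [e, hS0.extend_add (isCc_extendZero _) ((isCc_extendZero _).const_mul _),
    hS0.extend_const_mul (isCc_extendZero _), map_add, map_smul]
  simp [hnn _ (posPart_nonneg f), hnn _ (negPart_nonneg f)]

lemma isCompact_preimage_val {K : Set (Cn n)} (hK : IsCompact K) (hKΩ : K ⊆ Ω) :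
    IsCompact (Subtype.val ⁻¹' K : Set Ω) := by
  rw [Subtype.isCompact_iff]
  convert hK
  ext z
  exact ⟨fun ⟨y, hy, h⟩ => h ▸ hy, fun h => ⟨⟨z, hKΩ h⟩, h, rfl⟩⟩

/-- The restriction to `Ω` of the real part of a test function. -/
def restrictRe (f : 𝓓(Ω, ℂ)) : CompactlySupportedContinuousMap Ω ℝ where
  toFun z := (f z).re
  continuous_toFun := by
    have := f.continuous
    fun_prop
  hasCompactSupport' := by
    refine HasCompactSupport.intro
      (isCompact_preimage_val f.hasCompactSupport f.tsupport_subset) fun z hz => ?_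
    rw [image_eq_zero_of_notMem_tsupport hz, Complex.zero_re]

lemma extendZero_restrictRe (f : 𝓓(Ω, ℂ)) : extendZero (restrictRe f) = reTest f :=
  ext_extendZero (fun z => by rw [extendZero_coe, reTest_apply]; rfl) fun z hz => by
    rw [extendZero_of_notMem _ hz, reTest_apply,
      image_eq_zero_of_notMem_tsupport fun h => hz (f.tsupport_subset h)]
    simp

lemma IsPositiveClosed.exists_represents {S : FormFunctional Ω} (hS : IsPositiveClosed n S) :
    ∃ μ, Represents S μ := by
  have hS0 := hS.hasOrderZero (add_zero n)
  have hemb : MeasurableEmbedding (Subtype.val : Ω → Cn n) :=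
    MeasurableEmbedding.subtype_coe Ω.isOpen.measurableSet
  set μ := Measure.map (Subtype.val : Ω → Cn n) (RealRMK.rieszMeasure (rieszFunctional hS))
  have hfin : ∀ K : Set (Cn n), IsCompact K → K ⊆ Ω → μ K < ⊤ := by
    intro K hK hKΩ
    rw [hemb.map_apply]
    exact (isCompact_preimage_val hK hKΩ).measure_lt_top
  have hre : ∀ f : 𝓓(Ω, ℂ), ∫ z, reTest f z ∂μ = berezin n (S (reTest f)) := by
    intro f
    rw [hemb.integral_map]
    have h1 : ∀ z : Ω, reTest f z = ((restrictRe f z : ℝ) : ℂ) := fun z => rfl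
    simp_rw [h1]
    rw [integral_complex_ofReal, RealRMK.integral_rieszMeasure, rieszFunctional_apply,
      ← hS0.extend_test (reTest f), ← extendZero_restrictRe]
    exact Complex.ext rfl (by simpa using (hS.berezin_im_eq_zero _).symm)
  refine ⟨μ, fun f => ?_, hfin, ?_⟩
  · have hdec : f = reTest f + Complex.I • reTest ((-Complex.I) • f) := by
      ext z
      rw [FunLike.coe_add, Pi.add_apply, FunLike.coe_smul, Pi.smul_apply, reTest_apply,
        reTest_apply, FunLike.coe_smul, Pi.smul_apply]
      apply Complex.ext <;> simp
    have hi : ∀ g : 𝓓(Ω, ℂ), Integrable g μ := fun g =>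
      integrable_of_bound g.hasCompactSupport (hfin _ g.hasCompactSupport g.tsupport_subset)
        g.continuous subset_rfl
    calc ∫ z, f z ∂μ = ∫ z, (reTest f z + Complex.I * reTest ((-Complex.I) • f) z) ∂μ := by
          refine integral_congr_ae (Eventually.of_forall fun z => ?_)
          exact DFunLike.congr_fun hdec z
      _ = berezin n (S (reTest f)) + Complex.I * berezin n (S (reTest ((-Complex.I) • f))) := by
          rw [integral_add (hi _) ((hi _).const_mul _), integral_const_mul, hre, hre]
      _ = berezin n (S f) := by
          conv_rhs => rw [hdec, map_add, map_smul, map_add, map_smul, smul_eq_mul]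
  · have h0 : (Subtype.val ⁻¹' (Ω : Set (Cn n))ᶜ : Set Ω) = ∅ := by
      ext z
      simp
    rw [hemb.map_apply, h0, measure_empty]

lemma Represents.unique {S : FormFunctional Ω} (hS : HasOrderZero S) {μ ν : Measure (Cn n)}
    (hμ : Represents S μ) (hν : Represents S ν) : μ = ν := by
  have hemb : MeasurableEmbedding (Subtype.val : Ω → Cn n) :=
    MeasurableEmbedding.subtype_coe Ω.isOpen.measurableSet
  have hmap : ∀ {μ : Measure (Cn n)}, Represents S μ →
      Measure.map (Subtype.val : Ω → Cn n) (μ.comap Subtype.val) = μ := by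
    intro μ hμ
    rw [hemb.map_comap, Subtype.range_coe, Measure.restrict_eq_self_of_ae_mem]
    exact mem_ae_iff.2 hμ.compl_null
  have hreg : ∀ {μ : Measure (Cn n)}, Represents S μ →
      (μ.comap (Subtype.val : Ω → Cn n)).Regular := by
    intro μ hμ
    have : IsFiniteMeasureOnCompacts (μ.comap (Subtype.val : Ω → Cn n)) := by
      refine ⟨fun K hK => ?_⟩
      rw [hemb.comap_apply]
      refine hμ.finite_on_compacts _ (hK.image continuous_subtype_val) ?_
      rintro _ ⟨z, -, rfl⟩
      exact z.2
    infer_instance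
  have := hreg hμ
  have := hreg hν
  have hint : ∀ {μ : Measure (Cn n)}, Represents S μ →
      ∀ f : CompactlySupportedContinuousMap Ω ℝ,
        ((∫ z, f z ∂(μ.comap (Subtype.val : Ω → Cn n)) : ℝ) : ℂ)
          = berezin n (extend S (extendZero f)) := by
    intro μ hμ f
    rw [← hμ.integral_eq_extend hS (isCc_extendZero f), ← integral_complex_ofReal]
    conv_rhs => rw [← hmap hμ, hemb.integral_map]
    simp_rw [extendZero_coe]
  rw [← hmap hμ, ← hmap hν]
  congr 1
  refine Measure.ext_of_integral_eq_on_compactlySupported fun f => ?_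
  exact_mod_cast (hint hμ f).trans (hint hν f).symm

/-! ### The masses of the sublevel sets -/

/-- The measures `θ ∧ (i∂∂̄w)^k ∧ β^q` are those that represent the iterated product of
`θ ∧ β^q`. -/
lemma isWedgeMeasure_iff {k q : ℕ} (hkq : 1 + k + q = n) {θ : FormFunctional Ω}
    (hθ : IsPositiveClosed 1 θ) {w : Cn n → ℝ} (hw : IsContinuousPSH Ω w) {μ : Measure (Cn n)} :
    IsWedgeMeasure θ w k q μ ↔ Represents ((bt w)^[k] (mulConst (kahler n ^ q) θ)) μ := by
  have hN : IsPositiveClosed n ((bt w)^[k] (mulConst (kahler n ^ q) θ)) := by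
    have := (hθ.mulConst_kahler_pow q).iterate_bt (k := k) (by omega) hw
    rwa [show 1 + q + k = n by omega] at this
  have h1 : ∀ f, (bt w)^[k] (mulConst (kahler n ^ q) θ) f = (bt w)^[k] θ f * kahler n ^ q := by
    intro f
    rw [hθ.iterate_bt_mulConst (by omega) hw, mulConst_apply]
  have h2 : ∀ (f : 𝓓(Ω, ℂ)) (c : ℂ), (bt w)^[k] θ f * kahler n ^ q = c • volForm n
      ↔ c = berezin n ((bt w)^[k] (mulConst (kahler n ^ q) θ) f) := by
    intro f c
    rw [← h1, eq_smul_volForm (hN.mem_bideg f), map_smul, berezin_volForm, smul_eq_mul, mul_one]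
    exact ⟨fun h => (smul_left_injective ℂ (volForm_ne_zero n) h).symm, fun h => by rw [h]⟩
  constructor
  · rintro ⟨⟨S, hS, h⟩, h3, h4⟩
    rw [hθ.isBTProduct_iff (by omega) hw] at hS
    subst hS
    exact ⟨fun f => (h2 f _).1 (h f), h3, h4⟩
  · rintro ⟨h, h3, h4⟩
    exact ⟨⟨_, (hθ.isBTProduct_iff (by omega) hw).2 rfl, fun f => (h2 f _).2 (h f)⟩, h3, h4⟩

lemma existsUnique_isWedgeMeasure {k q : ℕ} (hkq : 1 + k + q = n) {θ : FormFunctional Ω}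
    (hθ : IsPositiveClosed 1 θ) {w : Cn n → ℝ} (hw : IsContinuousPSH Ω w) :
    ∃! μ : Measure (Cn n), IsWedgeMeasure θ w k q μ := by
  have hN : IsPositiveClosed n ((bt w)^[k] (mulConst (kahler n ^ q) θ)) := by
    have := (hθ.mulConst_kahler_pow q).iterate_bt (k := k) (by omega) hw
    rwa [show 1 + q + k = n by omega] at this
  obtain ⟨μ, hμ⟩ := hN.exists_represents
  exact ⟨μ, (isWedgeMeasure_iff hkq hθ hw).2 hμ, fun ν hν =>
    ((isWedgeMeasure_iff hkq hθ hw).1 hν).unique (hN.hasOrderZero (add_zero n)) hμ⟩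

/-- Decreasing smooth functions that tend to the indicator function of `(-∞, t)`; they are one on
`(-∞, t - 2/j]` and zero on `[t - 1/j, ∞)`. -/
def stepDown (t : ℝ) (j : ℕ) (s : ℝ) : ℝ := Real.smoothTransition ((j : ℝ) * (t - s) - 1)

lemma isDecreasingCutoff_stepDown (t : ℝ) {j : ℕ} (hj : 0 < j) :
    IsDecreasingCutoff (t - 2 / j) (t - 1 / j) (stepDown t j) := by
  have hj' : (0 : ℝ) < j := by exact_mod_cast hj
  have hanti : Antitone (stepDown t j) := fun s r hsr =>
    Real.smoothTransition.monotone (by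
      have := mul_le_mul_of_nonneg_left (sub_le_sub_left hsr t) hj'.le
      linarith)
  refine ⟨Real.smoothTransition.contDiff.comp (by fun_prop), fun s => hanti.deriv_nonpos,
    fun s hs => ?_, fun s hs => ?_⟩
  · have : stepDown t j =ᶠ[𝓝 s] fun _ => 1 := by
      filter_upwards [gt_mem_nhds hs] with r hr
      refine Real.smoothTransition.one_of_one_le ?_
      have h1 : 2 / (j : ℝ) < t - r := by linarith
      rw [div_lt_iff₀ hj'] at h1
      linarith
    rw [this.deriv_eq, deriv_const]
  · refine Real.smoothTransition.zero_of_nonpos ?_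
    have h1 : t - s ≤ 1 / (j : ℝ) := by linarith
    rw [le_div_iff₀ hj'] at h1
    linarith

lemma tendsto_stepDown (t s : ℝ) :
    Tendsto (fun j => stepDown t j s) atTop (𝓝 (if s < t then 1 else 0)) := by
  split_ifs with h
  · obtain ⟨N, hN⟩ := exists_nat_gt (2 / (t - s))
    refine tendsto_const_nhds.congr' ?_
    filter_upwards [eventually_ge_atTop N] with j hj
    refine (Real.smoothTransition.one_of_one_le ?_).symm
    have h1 : 2 / (t - s) < j := hN.trans_le (by exact_mod_cast hj)
    rw [div_lt_iff₀ (sub_pos.2 h)] at h1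
    linarith
  · refine tendsto_const_nhds.congr fun j => (Real.smoothTransition.zero_of_nonpos ?_).symm
    have := mul_nonneg (Nat.cast_nonneg (α := ℝ) j) (sub_nonneg.2 (not_lt.1 h))
    linarith

lemma isOpen_sublevel {v : Cn n → ℝ} (hv : ContinuousOn v Ω) (t : ℝ) :
    IsOpen (sublevel Ω v t) :=
  hv.isOpen_inter_preimage Ω.isOpen isOpen_Iio

lemma tendsto_integral_stepDown {v : Cn n → ℝ} (hv : ContinuousOn v Ω) {K : Set (Cn n)}
    (hK : IsCompact K) (hKΩ : K ⊆ Ω) {t : ℝ} (hvK : sublevel Ω v t ⊆ K) {μ : Measure (Cn n)}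
    (hμ : μ K < ⊤) : Tendsto (fun j : ℕ => ∫ z, compZero Ω (stepDown t j) v z ∂μ) atTop
      (𝓝 (μ.real (sublevel Ω v t) : ℂ)) := by
  have hmeas := (isOpen_sublevel hv t).measurableSet
  have hlim : ((μ.real (sublevel Ω v t) : ℝ) : ℂ)
      = ∫ z, (sublevel Ω v t).indicator (fun _ => (1 : ℂ)) z ∂μ := by
    rw [integral_indicator hmeas, setIntegral_const]
    simp
  have hzero : ∀ j z, z ∉ sublevel Ω v t → compZero Ω (stepDown t j) v z = 0 := by
    intro j z hz
    by_cases hzΩ : z ∈ Ω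
    · have h : t ≤ v z := by
        by_contra! h
        exact hz ⟨hzΩ, h⟩
      have := mul_nonneg (Nat.cast_nonneg (α := ℝ) j) (sub_nonneg.2 h)
      rw [compZero_of_mem hzΩ, stepDown, Real.smoothTransition.zero_of_nonpos (by linarith),
        Complex.ofReal_zero]
    · exact compZero_of_notMem hzΩ
  rw [hlim]
  refine tendsto_integral_filter_of_dominated_convergence (K.indicator fun _ => 1) ?_ ?_ ?_ ?_
  · filter_upwards [eventually_gt_atTop 0] with j hj
    have hc := isDecreasingCutoff_stepDown t hj
    have hbt : t - 1 / (j : ℝ) < t := by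
      have : (0 : ℝ) < 1 / j := by positivity
      linarith
    exact (isCc_compZero hv hK hKΩ hbt hvK hc.contDiff.continuous
      hc.eq_zero).continuous.aestronglyMeasurable
  · refine Eventually.of_forall fun j => Eventually.of_forall fun z => ?_
    by_cases hz : z ∈ sublevel Ω v t
    · rw [indicator_of_mem (hvK hz), compZero_of_mem hz.1, Complex.norm_real,
        stepDown, Real.norm_of_nonneg (Real.smoothTransition.nonneg _)]
      exact Real.smoothTransition.le_one _
    · rw [hzero j z hz, norm_zero]
      exact indicator_nonneg (fun _ _ => zero_le_one) z
  · rw [integrable_indicator_iff hK.measurableSet]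
    exact integrableOn_const hμ.ne
  · refine Eventually.of_forall fun z => ?_
    by_cases hz : z ∈ sublevel Ω v t
    · rw [indicator_of_mem hz]
      have h1 := tendsto_stepDown t (v z)
      rw [if_pos hz.2] at h1
      have h2 := (Complex.continuous_ofReal.tendsto 1).comp h1
      rw [Complex.ofReal_one] at h2
      exact h2.congr fun j => (compZero_of_mem hz.1).symm
    · rw [indicator_of_notMem hz]
      simp [hzero _ z hz]

/-- The mass of `{v < t}` for `(i∂∂̄(v²/2))^k ∧ T` is `t^k` times that for `(i∂∂̄v)^k ∧ T`. -/
lemma IsPositiveClosed.measureReal_sublevel_eq {p k : ℕ} (hpk : p + k = n)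
    {T : FormFunctional Ω} (hT : IsPositiveClosed p T) {v : Cn n → ℝ}
    (hv : IsContinuousPSH Ω v) (hv0 : ∀ z ∈ Ω, 0 ≤ v z) {K : Set (Cn n)} (hK : IsCompact K)
    (hKΩ : K ⊆ Ω) {t : ℝ} (ht : 0 < t) (hvK : sublevel Ω v t ⊆ K) {μ ν : Measure (Cn n)}
    (hμ : Represents ((Pluri.bt fun z => v z ^ 2 / 2)^[k] T) μ)
    (hν : Represents ((Pluri.bt v)^[k] T) ν) :
    μ.real (sublevel Ω v t) = t ^ k * ν.real (sublevel Ω v t) := by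
  have hμ0 := (hT.iterate_bt hpk.le (hv.sq_div_two hv0)).hasOrderZero (q := 0) (by omega)
  have hν0 := (hT.iterate_bt hpk.le hv).hasOrderZero (q := 0) (by omega)
  have lμ := tendsto_integral_stepDown hv.continuousOn hK hKΩ hvK (hμ.finite_on_compacts K hK hKΩ)
  have lν := tendsto_integral_stepDown hv.continuousOn hK hKΩ hvK (hν.finite_on_compacts K hK hKΩ)
  have hlim : ∀ c : ℝ, Tendsto (fun j : ℕ => (((t - c / j : ℝ) : ℂ)) ^ k) atTop
      (𝓝 ((t : ℂ) ^ k)) := by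
    intro c
    have h1 : Tendsto (fun j : ℕ => t - c / (j : ℝ)) atTop (𝓝 (t - 0)) :=
      tendsto_const_nhds.sub (tendsto_const_div_atTop_nhds_zero_nat c)
    rw [sub_zero] at h1
    exact ((Complex.continuous_ofReal.tendsto t).comp h1).pow k
  obtain ⟨N, hN⟩ := exists_nat_gt (2 / t)
  have hbounds : ∀ᶠ j : ℕ in atTop,
      (((t - 2 / j : ℝ) : ℂ)) ^ k * ∫ z, compZero Ω (stepDown t j) v z ∂ν
        ≤ ∫ z, compZero Ω (stepDown t j) v z ∂μ ∧
      ∫ z, compZero Ω (stepDown t j) v z ∂μ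
        ≤ (((t - 1 / j : ℝ) : ℂ)) ^ k * ∫ z, compZero Ω (stepDown t j) v z ∂ν := by
    filter_upwards [eventually_gt_atTop 0, eventually_ge_atTop N] with j hj hjN
    have hj' : (0 : ℝ) < j := by exact_mod_cast hj
    have hc := isDecreasingCutoff_stepDown t hj
    have hpos : (0 : ℝ) < 1 / j := by positivity
    have hbt : t - 1 / (j : ℝ) < t := by linarith
    have ha : 0 ≤ t - 2 / (j : ℝ) := by
      have h1 : 2 / t < j := hN.trans_le (by exact_mod_cast hjN)
      rw [div_lt_iff₀ ht] at h1
      rw [sub_nonneg, div_le_iff₀ hj']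
      linarith
    have hb : 0 ≤ t - 1 / (j : ℝ) := by
      have : 1 / (j : ℝ) ≤ 2 / j := by gcongr; norm_num
      linarith
    have cc := isCc_compZero hv.continuousOn hK hKΩ hbt hvK hc.contDiff.continuous hc.eq_zero
    rw [hμ.integral_eq_extend hμ0 cc, hν.integral_eq_extend hν0 cc]
    exact IsPositiveClosed.extend_iterate_bounds hv hv0 hK hKΩ ha hb hbt hvK k hpk hT hc
  have h1 := le_of_tendsto_of_tendsto ((hlim 2).mul lν) lμ (hbounds.mono fun j hj => hj.1)
  have h2 := le_of_tendsto_of_tendsto lμ ((hlim 1).mul lν) (hbounds.mono fun j hj => hj.2)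
  exact_mod_cast le_antisymm h2 h1

end Pluri

end

theorem proposition2p2 {n m : ℕ} (hm : 1 ≤ m) (hmn : m ≤ n)
    (Ω : Opens (Pluri.Cn n)) (v : Pluri.Cn n → ℝ)
    (hv : Pluri.IsContinuousPSH Ω v) (hv0 : ∀ z ∈ Ω, 0 ≤ v z)
    (T : ℝ)
    (hT : ∀ t ∈ Ioo 0 T, ∃ K : Set (Pluri.Cn n),
      IsCompact K ∧ K ⊆ Ω ∧ Pluri.sublevel Ω v t ⊆ K)
    (θ : Pluri.FormFunctional Ω) (hθ : Pluri.IsClosedPositiveCurrent θ) :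
    (∃! μ : Measure (Pluri.Cn n),
      Pluri.IsWedgeMeasure θ (fun z => v z ^ 2 / 2) (m - 1) (n - m) μ) ∧
    (∃! ν : Measure (Pluri.Cn n), Pluri.IsWedgeMeasure θ v (m - 1) (n - m) ν) ∧
    ∀ μ ν : Measure (Pluri.Cn n),
      Pluri.IsWedgeMeasure θ (fun z => v z ^ 2 / 2) (m - 1) (n - m) μ →
      Pluri.IsWedgeMeasure θ v (m - 1) (n - m) ν →
      (∀ t ∈ Ioo 0 T,
        μ (Pluri.sublevel Ω v t) < ⊤ ∧ ν (Pluri.sublevel Ω v t) < ⊤ ∧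
        μ.real (Pluri.sublevel Ω v t) / t ^ (m - 1) = ν.real (Pluri.sublevel Ω v t)) ∧
      MonotoneOn (fun t : ℝ => μ.real (Pluri.sublevel Ω v t) / t ^ (m - 1)) (Ioo 0 T) := by
  have hkq : 1 + (m - 1) + (n - m) = n := by omega
  have hθ' := hθ.isPositiveClosed
  have hsq := hv.sq_div_two hv0
  refine ⟨Pluri.existsUnique_isWedgeMeasure hkq hθ' hsq,
    Pluri.existsUnique_isWedgeMeasure hkq hθ' hv, fun μ ν hμ hν => ?_⟩
  have key : ∀ t ∈ Ioo 0 T,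
      μ (Pluri.sublevel Ω v t) < ⊤ ∧ ν (Pluri.sublevel Ω v t) < ⊤ ∧
      μ.real (Pluri.sublevel Ω v t) / t ^ (m - 1) = ν.real (Pluri.sublevel Ω v t) := by
    intro t ht
    obtain ⟨K, hK, hKΩ, hvK⟩ := hT t ht
    refine ⟨(measure_mono hvK).trans_lt (hμ.finite_on_compacts K hK hKΩ),
      (measure_mono hvK).trans_lt (hν.finite_on_compacts K hK hKΩ), ?_⟩
    rw [div_eq_iff (pow_ne_zero _ ht.1.ne'), mul_comm]
    exact (hθ'.mulConst_kahler_pow (n - m)).measureReal_sublevel_eq (by omega) hv hv0 hK hKΩ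
      ht.1 hvK ((Pluri.isWedgeMeasure_iff hkq hθ' hsq).1 hμ)
      ((Pluri.isWedgeMeasure_iff hkq hθ' hv).1 hν)
  refine ⟨key, fun s hs t ht hst => ?_⟩
  simp only [(key s hs).2.2, (key t ht).2.2]
  exact measureReal_mono (fun z hz => ⟨hz.1, hz.2.trans_le hst⟩) (key t ht).2.1.ne
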